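/- Let $k\ge 2$ and let $X$ be either a non-empty compact Kähler manifold of dimension $k$ with a Kähler form $\omega$, or a non-empty bounded open subset of $\mathbb{C}^k$ with $\omega=c\,dd^c\|z\|^2$ for some $c>0$, where $d^c=\frac{i}{2\pi}(\bar\partial-\partial)$. Let $W^{1,2}(X)$ be the space of real functions in $L^2(X)$ (with respect to $\omega^k$) whose differential in the sense of currents has $L^2$ coefficients, and let $W^*(X)$ be the space of those $\varphi\in W^{1,2}(X)$ for which there is a closed current $T$ of bidegree $(1,1)$ and of finite mass on $X$ with $$ i\partial\varphi\wedge\bar\partial\varphi\le T \qquad (*)$$ in the sense of currents; it is equipped with the norm $$\|\varphi\|_*^2=\|\varphi\|_{L^2}^2+\inf\{m(T) : T \text{ closed, satisfying } (*)\},\qquad m(T)=\int_X T\wedge\omega^{k-1}.$$ For a real integrable function $f$ on an open set $U\subset\mathbb{C}^k$ and a ball $B\subset U$, put $m_B(f)=\frac1{|B|}\int_B f$. Then $f$ is in $VMO(U)$ if the mean oscillation $\frac1{|B|}\int_B|f-m_B(f)|$ is bounded over all balls $B\subset U$ and tends to $0$ when the radius of $B$ tends to $0$. On a compact manifold, $f$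 is in $VMO(X)$ if every point is the centre of a ball, in a coordinate chart around it, on which $f$ is $VMO$. Then: 1. $W^*(X)$ is not contained in $VMO(X)$. This holds both if the convergence of the mean oscillation to $0$ is required uniformly in the ball, and if it is only required for each fixed centre. 2. Smooth functions are not dense in $W^*(X)$: the set of $C^\infty$ functions on $X$ that belong to $W^*(X)$ is not dense in $W^*(X)$ for the norm $\|\cdot\|_*$. 3. Continuous functions are not dense either: the set of continuous functions on $X$ that belong to $W^*(X)$ is not dense in $W^*(X)$ for the norm $\|\cdot\|_*$. -/

import Mathlib

open MeasureTheory Filter Topology Set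
open scoped Manifold ContDiff ComplexConjugate Nat

noncomputable section

namespace WStar

/-! ### Linear algebra of real `(1,1)`-forms

A real `(1,1)`-form `(i/2) ∑ H_{jl} dz_j ∧ dz̄_l` on a complex vector space is identified with its
Hermitian form `h(v, w) = ∑ H_{jl} v̄_l w_j`, so that the form evaluated on `(v, iv)` is `h(v, v)`. -/

/-- The model space `ℂᵏ`. -/
abbrev Cn (k : ℕ) : Type := EuclideanSpace ℂ (Fin k)

/-- Sesquilinear forms, conjugate linear in the first variable. -/
abbrev SesqForm (V : Type) [AddCommGroup V] [Module ℂ V] : Type := V →ₗ⋆[ℂ] V →ₗ[ℂ] ℂ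

/-- Positive semidefinite Hermitian forms; these correspond to the positive `(1,1)`-forms. -/
def IsPosForm {V : Type} [AddCommGroup V] [Module ℂ V] (h : SesqForm V) : Prop :=
  (∀ v w, conj (h v w) = h w v) ∧ ∀ v, 0 ≤ (h v v).re

/-- The coefficient matrix in the standard basis. -/
def coeff {k : ℕ} (h : SesqForm (Cn k)) : Matrix (Fin k) (Fin k) ℂ :=
  Matrix.of fun i j => h (EuclideanSpace.single i 1) (EuclideanSpace.single j 1)

/-- The density of `κᵏ` with respect to Lebesgue measure, `κᵏ = k! det(H) dλ`. -/
def volDensity {k : ℕ} (κ : SesqForm (Cn k)) : ℝ := (k ! : ℝ) * (coeff κ).det.re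

/-- The trace of `h` with respect to `κ`; it satisfies `h ∧ κᵏ⁻¹ = (1/k) tr_κ(h) κᵏ`. -/
def trace {k : ℕ} (κ h : SesqForm (Cn k)) : ℝ := ((coeff κ)⁻¹ * coeff h).trace.re

/-- The pull-back of a form by a linear map. -/
def pullback {V W : Type} [AddCommGroup V] [Module ℂ V] [AddCommGroup W] [Module ℂ W]
    (h : SesqForm V) (D : W →ₗ[ℂ] V) : SesqForm W :=
  LinearMap.mk₂'ₛₗ (starRingEnd ℂ) (RingHom.id ℂ) (fun v w => h (D v) (D w))
    (by simp) (by simp) (by simp) (by simp)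

/-- The `(1,1)`-form `i α ∧ ᾱ` of a `(1,0)`-covector `α`; its Hermitian form is
`(v, w) ↦ 2 * conj (α v) * α w`. -/
def wedgeConj {V : Type} [AddCommGroup V] [Module ℂ V] (α : V →ₗ[ℂ] ℂ) : SesqForm V :=
  (2 : ℂ) • pullback (innerₛₗ ℂ) α

/-- The flat Kähler form `c ddᶜ‖z‖² = c (i/π) ∑ dz_j ∧ dz̄_j`, where `dᶜ = (i/2π)(∂̄ - ∂)`. -/
def flatForm (k : ℕ) (c : ℝ) : SesqForm (Cn k) :=
  ((2 * c / Real.pi : ℝ) : ℂ) • (innerₛₗ ℂ : Cn k →ₗ⋆[ℂ] Cn k →ₗ[ℂ] ℂ)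

/-! ### Calculus on open subsets of `ℂᵏ` -/

/-- The derivative `∂g(z)(v) = ∑ v_j ∂g/∂z_j` of a smooth function. -/
def del {k : ℕ} (g : Cn k → ℂ) (z v : Cn k) : ℂ :=
  (fderiv ℝ g z v - Complex.I * fderiv ℝ g z (Complex.I • v)) / 2

/-- Smooth functions with compact support contained in `Ω`. -/
def IsTest {k : ℕ} {F : Type} [NormedAddCommGroup F] [NormedSpace ℝ F]
    (Ω : Set (Cn k)) (χ : Cn k → F) : Prop :=
  ContDiff ℝ ∞ χ ∧ HasCompactSupport χ ∧ tsupport χ ⊆ Ω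

/-- `∂f = G` on `Ω` in the sense of distributions. -/
def IsWeakDelOn {k : ℕ} (Ω : Set (Cn k)) (f : Cn k → ℝ) (G : Cn k → Cn k →ₗ[ℂ] ℂ) : Prop :=
  (∀ v, AEStronglyMeasurable (fun z => G z v) (volume.restrict Ω)) ∧
  ∀ χ : Cn k → ℂ, IsTest Ω χ → ∀ v,
    ∫ z, (f z : ℂ) * del χ z v = -∫ z, G z v * χ z

/-- The measure `κᵏ` on `Ω`. -/
def volumeOn {k : ℕ} (Ω : Set (Cn k)) (κ : Cn k → SesqForm (Cn k)) : Measure (Cn k) :=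
  (volume.restrict Ω).withDensity fun z => ENNReal.ofReal (volDensity (κ z))

/-! In what follows `(θ, μ)` stands for the `(1,1)`-current `T = θ · (μ / κᵏ)` with measure
coefficients, that is `⟨T, Ψ⟩ = ∫ (θ ∧ Ψ) / κᵏ dμ`. (If `μ = κᵏ`, then `T` is the form `θ`.)
In coordinates its coefficients are the measures `θ(v, w) / volDensity κ · μ`, viewed as
distributions by means of Lebesgue measure. -/

/-- The current is `∂`-closed on `Ω`: its coefficients satisfy `∂_u T(v, w) = ∂_w T(v, u)` in the
sense of distributions. For a real current this means that it is `d`-closed. -/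
def IsClosedOn {k : ℕ} (Ω : Set (Cn k)) (κ θ : Cn k → SesqForm (Cn k))
    (μ : Measure (Cn k)) : Prop :=
  ∀ χ : Cn k → ℂ, IsTest Ω χ → ∀ u v w,
    ∫ z, del χ z u * (θ z v w / (volDensity (κ z) : ℂ)) ∂μ =
      ∫ z, del χ z w * (θ z v u / (volDensity (κ z) : ℂ)) ∂μ

/-- The inequality `i G ∧ Ḡ ≤ T` on `Ω` in the sense of currents. -/
def IsDominatedOn {k : ℕ} (Ω : Set (Cn k)) (κ : Cn k → SesqForm (Cn k))
    (G : Cn k → Cn k →ₗ[ℂ] ℂ) (θ : Cn k → SesqForm (Cn k)) (μ : Measure (Cn k)) : Prop :=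
  ∀ χ : Cn k → ℝ, IsTest Ω χ → (∀ z, 0 ≤ χ z) → ∀ v,
    ∫ z, χ z * (wedgeConj (G z) v v).re ≤
      ∫ z, χ z * ((θ z v v).re / volDensity (κ z)) ∂μ

/-! ### Mean oscillation -/

/-- The mean oscillation of `f` on the ball of centre `z` and radius `r`. -/
def meanOsc {k : ℕ} (f : Cn k → ℝ) (z : Cn k) (r : ℝ) : ℝ :=
  ⨍ y in Metric.ball z r, |f y - ⨍ x in Metric.ball z r, f x|

/-- Functions of bounded mean oscillation on an open set `Ω`. -/
def MemBMOOn {k : ℕ} (Ω : Set (Cn k)) (f : Cn k → ℝ) : Prop :=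
  IntegrableOn f Ω ∧
  ∃ C : ℝ, ∀ z r, 0 < r → Metric.ball z r ⊆ Ω → meanOsc f z r ≤ C

/-- Functions of vanishing mean oscillation on an open set `Ω`: the mean oscillation is bounded and
tends to zero with the radius, uniformly in the ball. -/
def MemVMOOn {k : ℕ} (Ω : Set (Cn k)) (f : Cn k → ℝ) : Prop :=
  MemBMOOn Ω f ∧ ∀ ε > 0, ∃ δ > 0, ∀ z r, 0 < r → r < δ → Metric.ball z r ⊆ Ω →
    meanOsc f z r < ε

/-- The larger class in which the mean oscillation is only required to tend to zero with the radius
for each fixed centre. -/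
def MemPointwiseVMOOn {k : ℕ} (Ω : Set (Cn k)) (f : Cn k → ℝ) : Prop :=
  MemBMOOn Ω f ∧ ∀ z ∈ Ω, Tendsto (meanOsc f z) (𝓝[>] 0) (𝓝 0)

/-! ### The space `W*` of an open subset `U` of `ℂᵏ` with Kähler form `κ` -/

section Domain

variable {k : ℕ} (U : Set (Cn k)) (κ : Cn k → SesqForm (Cn k))

/-- `∂f = G` in the sense of distributions, with `L²` coefficients. -/
def HasL2DelOn (f : Cn k → ℝ) (G : Cn k → Cn k →ₗ[ℂ] ℂ) : Prop :=
  IsWeakDelOn U f G ∧ Integrable (fun z => trace (κ z) (wedgeConj (G z))) (volumeOn U κ)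

/-- Positive `(1,1)`-currents of finite mass on `U`. -/
structure CurrentOn where
  /-- the underlying positive measure -/
  μ : Measure (Cn k)
  /-- the density with respect to this measure -/
  θ : Cn k → SesqForm (Cn k)
  pos : ∀ z ∈ U, IsPosForm (θ z)
  meas : ∀ v w, AEMeasurable (fun z => θ z v w) (μ.restrict U)
  finite_mass : IntegrableOn (fun z => trace (κ z) (θ z)) U μ

variable {U κ} in
/-- The mass `∫_U T ∧ κᵏ⁻¹`. -/
def CurrentOn.mass (T : CurrentOn U κ) : ℝ := (1 / k) * ∫ z in U, trace (κ z) (T.θ z) ∂T.μ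

variable {U κ} in
/-- `T` is closed and `i∂f ∧ ∂̄f ≤ T` in the sense of currents. -/
def CurrentOn.Controls (T : CurrentOn U κ) (f : Cn k → ℝ) : Prop :=
  IsClosedOn U κ T.θ T.μ ∧ ∃ G, HasL2DelOn U κ f G ∧ IsDominatedOn U κ G T.θ T.μ

/-- The functions in `W*(U)`. -/
def MemWStarOn (f : Cn k → ℝ) : Prop :=
  MemLp f 2 (volumeOn U κ) ∧ (∃ G, HasL2DelOn U κ f G) ∧
    ∃ T : CurrentOn U κ, T.Controls f

/-- The norm of `W*(U)`. -/
def wStarNormOn (f : Cn k → ℝ) : ℝ :=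
  Real.sqrt ((∫ z, f z ^ 2 ∂(volumeOn U κ)) +
    sInf {m : ℝ | ∃ T : CurrentOn U κ, T.Controls f ∧ m = T.mass})

/-- The functions in `W*(U)` having the property `P` form a dense subset for the norm. -/
def DenseInWStarOn (P : (Cn k → ℝ) → Prop) : Prop :=
  ∀ f, MemWStarOn U κ f → ∀ ε > 0, ∃ g, MemWStarOn U κ g ∧ P g ∧ wStarNormOn U κ (f - g) < ε

end Domain

/-! ### The space `W*` of a Kähler manifold -/

section Manifold

variable {k : ℕ} {X : Type*} [TopologicalSpace X] [ChartedSpace (Cn k) X]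

/-- The (complex) tangent space of `X` at `x`. -/
abbrev Tan (k : ℕ) {X : Type*} [TopologicalSpace X] [ChartedSpace (Cn k) X] (x : X) : Type :=
  TangentSpace 𝓘(ℂ, Cn k) x

/-- The coordinate vector fields of a chart: the derivative of its inverse. -/
def coordMap (e : OpenPartialHomeomorph X (Cn k)) (z : Cn k) : Cn k →ₗ[ℂ] Tan k (e.symm z) :=
  (mfderiv 𝓘(ℂ, Cn k) 𝓘(ℂ, Cn k) e.symm z).toLinearMap

/-- The expression of a `(1,1)`-form in a chart. -/
def formInChart (e : OpenPartialHomeomorph X (Cn k)) (h : ∀ x : X, SesqForm (Tan k x)) :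
    Cn k → SesqForm (Cn k) :=
  fun z => pullback (h (e.symm z)) (coordMap e z)

/-- The expression of a `(1,0)`-form in a chart. -/
def covectorInChart (e : OpenPartialHomeomorph X (Cn k)) (G : ∀ x : X, Tan k x →ₗ[ℂ] ℂ) :
    Cn k → Cn k →ₗ[ℂ] ℂ :=
  fun z => (G (e.symm z)) ∘ₗ coordMap e z

variable (k X) in
/-- Kähler forms: smooth closed positive definite `(1,1)`-forms. -/
structure KahlerForm where
  /-- the Hermitian form at a point -/
  form : ∀ x : X, SesqForm (Tan k x)
  hermitian : ∀ x v w, conj (form x v w) = form x w v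
  pos : ∀ x v, v ≠ 0 → 0 < (form x v v).re
  smooth : ∀ e ∈ atlas (Cn k) X, ∀ v w,
    ContDiffOn ℝ ∞ (fun z => formInChart e form z v w) e.target
  closed : ∀ e ∈ atlas (Cn k) X, ∀ z ∈ e.target, ∀ u v w,
    del (fun z => formInChart e form z v w) z u = del (fun z => formInChart e form z v u) z w

variable [MeasurableSpace X]

/-- A measure on `X` seen in a chart. -/
def measureInChart (e : OpenPartialHomeomorph X (Cn k)) (μ : Measure X) : Measure (Cn k) :=
  (μ.restrict e.source).map e

/-- The measure `κᵏ` on `X`: the least measure that is at least `κᵏ`, computed in coordinates, on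
the domain of each chart. (On a second countable `X` it coincides with it there.) -/
def KahlerForm.volume (κ : KahlerForm k X) : Measure X :=
  ⨆ e ∈ atlas (Cn k) X, (volumeOn e.target (formInChart e κ.form)).map e.symm

/-- `∂f = G` in the sense of distributions, with `L²` coefficients. -/
def HasL2Del (κ : KahlerForm k X) (f : X → ℝ) (G : ∀ x : X, Tan k x →ₗ[ℂ] ℂ) : Prop :=
  (∀ e ∈ atlas (Cn k) X, IsWeakDelOn e.target (f ∘ e.symm) (covectorInChart e G)) ∧
  Integrable (fun x => trace (k := k) (κ.form x) (wedgeConj (G x))) κ.volume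

/-- Positive `(1,1)`-currents of finite mass on `X`. -/
structure Current (κ : KahlerForm k X) where
  /-- the underlying positive measure -/
  μ : Measure X
  /-- the density with respect to this measure -/
  θ : ∀ x : X, SesqForm (Tan k x)
  pos : ∀ x, IsPosForm (θ x)
  meas : ∀ e ∈ atlas (Cn k) X, ∀ v w,
    AEMeasurable (fun z => formInChart e θ z v w) (measureInChart e μ)
  finite_mass : Integrable (fun x => trace (k := k) (κ.form x) (θ x)) μ

/-- The mass `∫_X T ∧ κᵏ⁻¹`. -/
def Current.mass {κ : KahlerForm k X} (T : Current κ) : ℝ :=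
  (1 / k) * ∫ x, trace (k := k) (κ.form x) (T.θ x) ∂T.μ

/-- `T` is closed and `i∂f ∧ ∂̄f ≤ T` in the sense of currents. -/
def Current.Controls {κ : KahlerForm k X} (T : Current κ) (f : X → ℝ) : Prop :=
  (∀ e ∈ atlas (Cn k) X,
    IsClosedOn e.target (formInChart e κ.form) (formInChart e T.θ) (measureInChart e T.μ)) ∧
  ∃ G, HasL2Del κ f G ∧ ∀ e ∈ atlas (Cn k) X,
    IsDominatedOn e.target (formInChart e κ.form) (covectorInChart e G) (formInChart e T.θ)
      (measureInChart e T.μ)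

/-- The functions in `W*(X)`. -/
def MemWStar (κ : KahlerForm k X) (f : X → ℝ) : Prop :=
  MemLp f 2 κ.volume ∧ (∃ G, HasL2Del κ f G) ∧ ∃ T : Current κ, T.Controls f

/-- The norm of `W*(X)`. -/
def wStarNorm (κ : KahlerForm k X) (f : X → ℝ) : ℝ :=
  Real.sqrt ((∫ x, f x ^ 2 ∂κ.volume) +
    sInf {m : ℝ | ∃ T : Current κ, T.Controls f ∧ m = T.mass})

/-- The functions in `W*(X)` having the property `P` form a dense subset for the norm. -/
def DenseInWStar (κ : KahlerForm k X) (P : (X → ℝ) → Prop) : Prop :=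
  ∀ f, MemWStar κ f → ∀ ε > 0, ∃ g, MemWStar κ g ∧ P g ∧ wStarNorm κ (f - g) < ε


variable (k) in
/-- Functions of vanishing mean oscillation on a compact manifold: every point is the centre of a
coordinate ball on which the function has vanishing mean oscillation. -/
def MemVMO (f : X → ℝ) : Prop :=
  ∀ p : X, ∃ δ > 0, Metric.ball (chartAt (Cn k) p p) δ ⊆ (chartAt (Cn k) p).target ∧
    MemVMOOn (Metric.ball (chartAt (Cn k) p p) δ) (f ∘ (chartAt (Cn k) p).symm)

variable (k) in
/-- The larger class defined by convergence to zero at each fixed centre. -/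
def MemPointwiseVMO (f : X → ℝ) : Prop :=
  ∀ p : X, ∃ δ > 0, Metric.ball (chartAt (Cn k) p p) δ ⊆ (chartAt (Cn k) p).target ∧
    MemPointwiseVMOOn (Metric.ball (chartAt (Cn k) p p) δ) (f ∘ (chartAt (Cn k) p).symm)

end Manifold

end WStar

end

/-!
The example is the same for the three assertions. Near a point `a`, in a chart, let
`f = χ |z_i - a_i|² / ‖z - a‖²` with a cutoff function `χ` (`modelFun`). The ratio is bounded,
homogeneous of degree zero and not constant, and it comes from the projective space `ℙ^{k-1}`, so that
`i∂f ∧ ∂̄f` is bounded near `a` by a multiple of the pull-back `i∂∂̄ log ‖z - a‖²` of the Fubini–Study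
form (`norm_del_ratio_sq_le`). With the potential `u = 2 χ log ‖z - a‖²` and a large constant `A`, the
form `θ = A κ + (i/2) ∂∂̄u` is therefore positive and dominates `i∂f ∧ ∂̄f` outside of `a`
(`exists_norm_del_modelFun_sq_le`). The coefficients of `θ` are `O(‖z - a‖⁻²)`; as `k ≥ 2`, cutting off
near `a` produces only negligible errors, so that the weak derivative of `f` is the pointwise one and
`θ` is closed in the sense of currents (`integral_identity_of_diff_singleton`). Hence `f` belongs to
`W*` (`exists_memWStarOn`, `exists_memWStar`).

By homogeneity the mean oscillation of `f` on the balls of centre `a` does not tend to zero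
(`not_tendsto_meanOsc`). It is detected by a test function `ψ` and its rescalings (`exists_probe`).

For the two assertions on density, let `g` be continuous and let `T` be a closed current with
`i∂(f - g) ∧ ∂̄(f - g) ≤ T`. By Lelong's bound the trace measure of `T` on the ball of radius `r` about
`a` is at most `C r^{2k-2} m(T)`, with `C` independent of `T`
(`exists_setIntegral_closedBall_le`). If `r` is small, `g` is almost constant on that ball, and pairing
`f - g` with the derivative of the rescaled test function and using the inequality of Cauchy–Schwarz
gives `m(T) ≥ ε` for a constant `ε > 0` which does not depend on `g` or `T`
(`exists_le_mass_of_controls`). Thus `‖f - g‖_*² ≥ ε`. As the infimum of the empty set of reals is zero,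
one also needs that some closed current controls `f - g`: twice the sum of a current for `f` and one for
`g` does (`exists_controls_sub`).

On a compact manifold everything is done in charts. A form is pulled back by a chart
(`formInChart_transition`), and the volume of the manifold is `κᵏ` in each chart by the change of
variables formula (`KahlerForm.volume_restrict_source`); the model function is extended by zero
(`isModelOn_inChart`).

A real `(1,1)`-form `(i/2) ∑ h_{jl} dz_j ∧ dz̄_l` is encoded by the Hermitian form `h`. Therefore
`wedgeConj G`, which stands for `i G ∧ Ḡ`, takes the value `2 |G(v)|²` at `v`, while `levi u`, the matrix
of mixed second derivatives, stands for `(i/2) ∂∂̄u`.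
-/

noncomputable section

namespace WStar

/-! ### The operator `∂` -/

section

variable {k : ℕ}

theorem two_le_infty : (2 : WithTop ℕ∞) ≤ ∞ := WithTop.coe_le_coe.2 (le_top : (2 : ℕ∞) ≤ ⊤)

theorem del_congr {f g : Cn k → ℂ} {z : Cn k} (h : f =ᶠ[𝓝 z] g) (v : Cn k) :
    del f z v = del g z v := by
  simp only [del, h.fderiv_eq]

theorem del_add {f g : Cn k → ℂ} {z : Cn k} (hf : DifferentiableAt ℝ f z)
    (hg : DifferentiableAt ℝ g z) (v : Cn k) :
    del (fun y => f y + g y) z v = del f z v + del g z v := by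
  simp only [del, fderiv_fun_add hf hg, add_apply]
  ring

theorem del_mul {f g : Cn k → ℂ} {z : Cn k} (hf : DifferentiableAt ℝ f z)
    (hg : DifferentiableAt ℝ g z) (v : Cn k) :
    del (fun y => f y * g y) z v = f z * del g z v + g z * del f z v := by
  simp only [del, fderiv_fun_mul hf hg, add_apply,
    smul_apply, smul_eq_mul]
  ring

theorem del_const_mul {g : Cn k → ℂ} {z : Cn k} (c : ℂ)
    (hg : DifferentiableAt ℝ g z) (v : Cn k) :
    del (fun y => c * g y) z v = c * del g z v := by
  rw [del_mul (differentiableAt_const c) hg]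
  simp [del]

theorem norm_del_le (g : Cn k → ℂ) (z v : Cn k) : ‖del g z v‖ ≤ ‖fderiv ℝ g z‖ * ‖v‖ := by
  have h1 := (fderiv ℝ g z).le_opNorm v
  have h2 := (fderiv ℝ g z).le_opNorm (Complex.I • v)
  rw [norm_smul, Complex.norm_I, one_mul] at h2
  have h3 : ‖Complex.I * fderiv ℝ g z (Complex.I • v)‖ = ‖fderiv ℝ g z (Complex.I • v)‖ := by
    simp
  have h4 := norm_sub_le (fderiv ℝ g z v) (Complex.I * fderiv ℝ g z (Complex.I • v))
  rw [del, norm_div]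
  simp only [Complex.norm_ofNat]
  linarith

theorem smul_eq_re_add_im (c : ℂ) (v : Cn k) :
    c • v = (c.re : ℂ) • v + (c.im : ℂ) • (Complex.I • v) := by
  rw [smul_smul, ← add_smul, Complex.re_add_im]

theorem I_smul_smul_eq (c : ℂ) (v : Cn k) :
    Complex.I • (c • v) = (c.re : ℂ) • (Complex.I • v) + ((-c.im : ℝ) : ℂ) • v := by
  rw [smul_eq_re_add_im c v, smul_add, smul_smul, smul_smul, smul_smul, smul_smul]
  congr 1
  · rw [mul_comm]
  · congr 1
    push_cast
    linear_combination (c.im : ℂ) * Complex.I_mul_I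

/-- The derivative `∂g(z)` as a `ℂ`-linear form. -/
def delLin (g : Cn k → ℂ) (z : Cn k) : Cn k →ₗ[ℂ] ℂ where
  toFun v := del g z v
  map_add' v w := by simp only [del, smul_add, map_add]; ring
  map_smul' c v := by
    have h : ∀ (r : ℝ) (w : Cn k), fderiv ℝ g z ((r : ℂ) • w) = r * fderiv ℝ g z w := by
      intro r w
      rw [Complex.coe_smul, map_smul, Complex.real_smul]
    simp only [del, RingHom.id_apply, smul_eq_mul]
    rw [I_smul_smul_eq, smul_eq_re_add_im, map_add, map_add, h, h, h, h]
    nth_rewrite 5 [← Complex.re_add_im c]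
    push_cast
    linear_combination ((c.im : ℂ) / 2 * fderiv ℝ g z (Complex.I • v)) * Complex.I_mul_I

@[simp] theorem delLin_apply (g : Cn k → ℂ) (z v : Cn k) : delLin g z v = del g z v := rfl

theorem del_ofReal {f : Cn k → ℝ} {z : Cn k} (hf : DifferentiableAt ℝ f z) (v : Cn k) :
    del (fun y => (f y : ℂ)) z v =
      ((fderiv ℝ f z v : ℂ) - Complex.I * (fderiv ℝ f z (Complex.I • v) : ℂ)) / 2 := by
  have h : HasFDerivAt (fun y => (f y : ℂ)) (Complex.ofRealCLM.comp (fderiv ℝ f z)) z :=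
    Complex.ofRealCLM.hasFDerivAt.comp z hf.hasFDerivAt
  simp [del, h.fderiv]

theorem ContDiffAt.del {g : Cn k → ℂ} {z : Cn k} (hg : ContDiffAt ℝ ∞ g z) (v : Cn k) :
    ContDiffAt ℝ ∞ (fun y => del g y v) z := by
  have h : ContDiffAt ℝ ∞ (fderiv ℝ g) z := hg.fderiv_right (by simp)
  have h1 : ∀ w : Cn k, ContDiffAt ℝ ∞ (fun y => fderiv ℝ g y w) z := fun w =>
    h.clm_apply contDiffAt_const
  exact ((h1 v).sub (contDiffAt_const.mul (h1 (Complex.I • v)))).div_const 2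

theorem ContDiff.del {g : Cn k → ℂ} (hg : ContDiff ℝ ∞ g) (v : Cn k) :
    ContDiff ℝ ∞ (fun y => del g y v) :=
  contDiff_iff_contDiffAt.2 fun _ => ContDiffAt.del hg.contDiffAt v

theorem tsupport_del_subset (g : Cn k → ℂ) (v : Cn k) :
    tsupport (fun y => del g y v) ⊆ tsupport g := by
  refine closure_minimal ?_ (isClosed_tsupport g)
  intro z hz
  by_contra hcon
  have h : g =ᶠ[𝓝 z] 0 := notMem_tsupport_iff_eventuallyEq.1 hcon
  apply hz
  simp [del, h.fderiv_eq]

theorem continuous_mul_of_tsupport {F χ : Cn k → ℂ} {Ω : Set (Cn k)} (hΩ : IsOpen Ω)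
    (hF : ContinuousOn F Ω) (hχ : Continuous χ) (hs : tsupport χ ⊆ Ω) :
    Continuous (fun z => F z * χ z) :=
  (hF.mul hχ.continuousOn).continuous_of_tsupport_subset hΩ
    ((tsupport_mul_subset_right).trans hs)

theorem integrable_mul_of_tsupport {F χ : Cn k → ℂ} {Ω : Set (Cn k)} (hΩ : IsOpen Ω)
    (hF : ContinuousOn F Ω) (hχ : Continuous χ) (hc : HasCompactSupport χ)
    (hs : tsupport χ ⊆ Ω) : Integrable (fun z => F z * χ z) :=
  (continuous_mul_of_tsupport hΩ hF hχ hs).integrable_of_hasCompactSupport hc.mul_left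

theorem hasCompactSupport_del {χ : Cn k → ℂ} (hc : HasCompactSupport χ) (v : Cn k) :
    HasCompactSupport (fun z => del χ z v) :=
  hc.mono' (subset_tsupport _ |>.trans (tsupport_del_subset χ v))

/-- Integration by parts against a test function. -/
theorem integral_mul_del {F χ : Cn k → ℂ} {Ω : Set (Cn k)} (hΩ : IsOpen Ω)
    (hF : ContDiffOn ℝ ∞ F Ω) (hχ : IsTest Ω χ) (v : Cn k) :
    ∫ z, F z * del χ z v = -∫ z, del F z v * χ z := by
  obtain ⟨hsm, hc, hs⟩ := hχ
  have hFa : ∀ z ∈ Ω, ContDiffAt ℝ ∞ F z := fun z hz => hF.contDiffAt (hΩ.mem_nhds hz)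
  have hF' : ContinuousOn (fun z => fderiv ℝ F z) Ω := fun z hz =>
    ((hFa z hz).fderiv_right (m := ∞) (by simp)).continuousAt.continuousWithinAt
  have hχ' : Continuous (fderiv ℝ χ) := hsm.continuous_fderiv (by simp)
  have hcs : ∀ w, HasCompactSupport (fun z => fderiv ℝ χ z w) := fun w => hc.fderiv_apply ℝ w
  have hss : ∀ w, tsupport (fun z => fderiv ℝ χ z w) ⊆ Ω := fun w =>
    (tsupport_fderiv_apply_subset ℝ w).trans hs
  have i1 : ∀ w, Integrable (fun z => F z * fderiv ℝ χ z w) := fun w =>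
    integrable_mul_of_tsupport hΩ hF.continuousOn (hχ'.clm_apply continuous_const) (hcs w) (hss w)
  have i2 : ∀ w, Integrable (fun z => fderiv ℝ F z w * χ z) := fun w =>
    integrable_mul_of_tsupport hΩ (hF'.clm_apply continuousOn_const) hsm.continuous hc hs
  have i3 : Integrable (fun z => F z * χ z) :=
    integrable_mul_of_tsupport hΩ hF.continuousOn hsm.continuous hc hs
  have key : ∀ w, ∫ z, F z * fderiv ℝ χ z w = -∫ z, fderiv ℝ F z w * χ z := fun w =>
    integral_mul_fderiv_eq_neg_fderiv_mul_of_integrable (i2 w) (i1 w) i3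
      (fun z hz => (hFa z (hs hz)).differentiableAt (by simp))
      (fun z _ => hsm.contDiffAt.differentiableAt (by simp))
  have e1 : ∀ z, F z * del χ z v = (1 / 2 : ℂ) * (F z * fderiv ℝ χ z v)
      - (Complex.I / 2) * (F z * fderiv ℝ χ z (Complex.I • v)) := fun z => by
    simp only [del]; ring
  have e2 : ∀ z, del F z v * χ z = (1 / 2 : ℂ) * (fderiv ℝ F z v * χ z)
      - (Complex.I / 2) * (fderiv ℝ F z (Complex.I • v) * χ z) := fun z => by
    simp only [del]; ring
  simp_rw [e1, e2]
  rw [integral_sub ((i1 _).const_mul _) ((i1 _).const_mul _),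
    integral_sub ((i2 _).const_mul _) ((i2 _).const_mul _)]
  simp_rw [integral_const_mul]
  rw [key, key]
  ring

/-! ### The Levi form -/

/-- The Levi form `(v, w) ↦ ∂̄_v ∂_w u` of a real function, expressed through the second real
derivative. It is the Hermitian form of the `(1,1)`-form `(i/2) ∂∂̄u`. -/
def levi (u : Cn k → ℝ) (z : Cn k) : SesqForm (Cn k) :=
  LinearMap.mk₂'ₛₗ (starRingEnd ℂ) (RingHom.id ℂ)
    (fun v w => ((fderiv ℝ (fderiv ℝ u) z v w : ℂ)
      + (fderiv ℝ (fderiv ℝ u) z (Complex.I • v) (Complex.I • w) : ℂ)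
      + Complex.I * ((fderiv ℝ (fderiv ℝ u) z (Complex.I • v) w : ℂ)
        - (fderiv ℝ (fderiv ℝ u) z v (Complex.I • w) : ℂ))) / 4)
    (fun v v' w => by
      simp only [smul_add, map_add, add_apply, Complex.ofReal_add]; ring)
    (fun c v w => by
      have h : ∀ (r : ℝ) (x : Cn k), fderiv ℝ (fderiv ℝ u) z ((r : ℂ) • x) =
          r • fderiv ℝ (fderiv ℝ u) z x := by
        intro r x
        rw [Complex.coe_smul, map_smul]
      rw [I_smul_smul_eq, smul_eq_re_add_im, map_add, map_add, h, h, h, h]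
      have hcc : conj c = (c.re : ℂ) - c.im * Complex.I := by
        apply Complex.ext <;> simp
      rw [hcc]
      simp only [add_apply, smul_apply, smul_eq_mul,
        Complex.ofReal_add, Complex.ofReal_mul, Complex.ofReal_neg]
      linear_combination ((c.im : ℂ) / 4 * ((fderiv ℝ (fderiv ℝ u) z (Complex.I • v) w : ℂ)
        - (fderiv ℝ (fderiv ℝ u) z v (Complex.I • w) : ℂ))) * Complex.I_mul_I)
    (fun v w w' => by
      simp only [smul_add, map_add, Complex.ofReal_add]; ring)
    (fun c v w => by
      have h : ∀ (r : ℝ) (x y : Cn k), fderiv ℝ (fderiv ℝ u) z y ((r : ℂ) • x) =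
          r * fderiv ℝ (fderiv ℝ u) z y x := by
        intro r x y
        rw [Complex.coe_smul, map_smul, smul_eq_mul]
      rw [I_smul_smul_eq, smul_eq_re_add_im]
      simp only [map_add, h, RingHom.id_apply, smul_eq_mul]
      nth_rewrite 9 [← Complex.re_add_im c]
      push_cast
      linear_combination (-(c.im : ℂ) / 4 * ((fderiv ℝ (fderiv ℝ u) z (Complex.I • v) w : ℂ)
        - (fderiv ℝ (fderiv ℝ u) z v (Complex.I • w) : ℂ))) * Complex.I_mul_I)

theorem levi_apply (u : Cn k → ℝ) (z v w : Cn k) :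
    levi u z v w = ((fderiv ℝ (fderiv ℝ u) z v w : ℂ)
      + (fderiv ℝ (fderiv ℝ u) z (Complex.I • v) (Complex.I • w) : ℂ)
      + Complex.I * ((fderiv ℝ (fderiv ℝ u) z (Complex.I • v) w : ℂ)
        - (fderiv ℝ (fderiv ℝ u) z v (Complex.I • w) : ℂ))) / 4 := rfl

/-- The derivative `∂̄g(z)(v)` of a smooth function. -/
def delbar (g : Cn k → ℂ) (z v : Cn k) : ℂ :=
  (fderiv ℝ g z v + Complex.I * fderiv ℝ g z (Complex.I • v)) / 2

theorem delbar_congr {f g : Cn k → ℂ} {z : Cn k} (h : f =ᶠ[𝓝 z] g) (v : Cn k) :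
    delbar f z v = delbar g z v := by
  simp only [delbar, h.fderiv_eq]

theorem ContDiffAt.delbar {g : Cn k → ℂ} {z : Cn k} (hg : ContDiffAt ℝ ∞ g z) (v : Cn k) :
    ContDiffAt ℝ ∞ (fun y => delbar g y v) z := by
  have h : ContDiffAt ℝ ∞ (fderiv ℝ g) z := hg.fderiv_right (by simp)
  have h1 : ∀ w : Cn k, ContDiffAt ℝ ∞ (fun y => fderiv ℝ g y w) z := fun w =>
    h.clm_apply contDiffAt_const
  exact ((h1 v).add (contDiffAt_const.mul (h1 (Complex.I • v)))).div_const 2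

section SecondDerivative

variable {g : Cn k → ℂ} {z : Cn k}

theorem hasFDerivAt_fderiv_apply (hg : ContDiffAt ℝ 2 g z) (w : Cn k) :
    HasFDerivAt (fun y => fderiv ℝ g y w) ((fderiv ℝ (fderiv ℝ g) z).flip w) z := by
  have h : ContDiffAt ℝ 1 (fderiv ℝ g) z := hg.fderiv_right (by norm_num)
  have h2 := (h.differentiableAt (by simp)).hasFDerivAt.clm_apply (hasFDerivAt_const w z)
  simpa using h2

theorem fderiv_fderiv_symm (hg : ContDiffAt ℝ 2 g z) (v w : Cn k) :
    fderiv ℝ (fderiv ℝ g) z v w = fderiv ℝ (fderiv ℝ g) z w v :=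
  (hg.isSymmSndFDerivAt (by simp)) v w

theorem hasFDerivAt_del (hg : ContDiffAt ℝ 2 g z) (w : Cn k) :
    HasFDerivAt (fun y => del g y w) ((1 / 2 : ℂ) • ((fderiv ℝ (fderiv ℝ g) z).flip w -
      Complex.I • (fderiv ℝ (fderiv ℝ g) z).flip (Complex.I • w))) z := by
  have h := ((hasFDerivAt_fderiv_apply hg w).sub
    ((hasFDerivAt_fderiv_apply hg (Complex.I • w)).const_mul Complex.I)).const_mul (1 / 2 : ℂ)
  refine h.congr_of_eventuallyEq (Eventually.of_forall fun y => ?_)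
  simp only [del, Pi.sub_apply]; ring

theorem hasFDerivAt_delbar (hg : ContDiffAt ℝ 2 g z) (w : Cn k) :
    HasFDerivAt (fun y => delbar g y w) ((1 / 2 : ℂ) • ((fderiv ℝ (fderiv ℝ g) z).flip w +
      Complex.I • (fderiv ℝ (fderiv ℝ g) z).flip (Complex.I • w))) z := by
  have h := ((hasFDerivAt_fderiv_apply hg w).add
    ((hasFDerivAt_fderiv_apply hg (Complex.I • w)).const_mul Complex.I)).const_mul (1 / 2 : ℂ)
  refine h.congr_of_eventuallyEq (Eventually.of_forall fun y => ?_)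
  simp only [delbar, Pi.add_apply]; ring

theorem del_del_comm (hg : ContDiffAt ℝ 2 g z) (u w : Cn k) :
    del (fun y => del g y w) z u = del (fun y => del g y u) z w := by
  rw [del, del, (hasFDerivAt_del hg w).fderiv, (hasFDerivAt_del hg u).fderiv]
  simp only [smul_apply, sub_apply, ContinuousLinearMap.flip_apply, smul_eq_mul]
  rw [fderiv_fderiv_symm hg u w, fderiv_fderiv_symm hg u (Complex.I • w),
    fderiv_fderiv_symm hg (Complex.I • u) w,
    fderiv_fderiv_symm hg (Complex.I • u) (Complex.I • w)]
  ring

theorem delbar_del_comm (hg : ContDiffAt ℝ 2 g z) (v w : Cn k) :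
    delbar (fun y => del g y w) z v = del (fun y => delbar g y v) z w := by
  rw [del, delbar, (hasFDerivAt_del hg w).fderiv, (hasFDerivAt_delbar hg v).fderiv]
  simp only [smul_apply, sub_apply, add_apply, ContinuousLinearMap.flip_apply, smul_eq_mul]
  rw [fderiv_fderiv_symm hg v w, fderiv_fderiv_symm hg v (Complex.I • w),
    fderiv_fderiv_symm hg (Complex.I • v) w,
    fderiv_fderiv_symm hg (Complex.I • v) (Complex.I • w)]
  ring

end SecondDerivative

theorem ContDiffAt.ofReal {u : Cn k → ℝ} {z : Cn k} {n : WithTop ℕ∞}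
    (hu : ContDiffAt ℝ n u z) : ContDiffAt ℝ n (fun y => (u y : ℂ)) z :=
  Complex.ofRealCLM.contDiff.contDiffAt.comp z hu

section Levi

variable {u : Cn k → ℝ} {z : Cn k}

theorem eventually_contDiffAt {F : Type} [NormedAddCommGroup F] [NormedSpace ℝ F]
    {u : Cn k → F} {z : Cn k} {n : ℕ} (hu : ContDiffAt ℝ n u z) :
    ∀ᶠ y in 𝓝 z, ContDiffAt ℝ n u y :=
  hu.eventually (by simp)

theorem levi_eq_delbar_del (hu : ContDiffAt ℝ 2 u z) (v w : Cn k) :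
    levi u z v w = delbar (fun y => del (fun x => (u x : ℂ)) y w) z v := by
  have h0 : ContDiffAt ℝ 1 (fderiv ℝ u) z := hu.fderiv_right (by norm_num)
  have h1 : ∀ w : Cn k, HasFDerivAt (fun y => ((fderiv ℝ u y w : ℝ) : ℂ))
      (Complex.ofRealCLM.comp ((fderiv ℝ (fderiv ℝ u) z).flip w)) z := fun w => by
    have h2 := (h0.differentiableAt (by simp)).hasFDerivAt.clm_apply (hasFDerivAt_const w z)
    have h3 : HasFDerivAt (fun y => fderiv ℝ u y w) ((fderiv ℝ (fderiv ℝ u) z).flip w) z := by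
      simpa using h2
    exact Complex.ofRealCLM.hasFDerivAt.comp z h3
  have h4 : (fun y => del (fun x => (u x : ℂ)) y w) =ᶠ[𝓝 z] fun y =>
      (1 / 2 : ℂ) * ((fderiv ℝ u y w : ℂ) - Complex.I * (fderiv ℝ u y (Complex.I • w) : ℂ)) := by
    filter_upwards [eventually_contDiffAt (n := 2) hu] with y hy
    rw [del_ofReal (hy.differentiableAt (by simp))]
    ring
  have h5 := ((h1 w).fun_sub ((h1 (Complex.I • w)).const_mul Complex.I)).const_mul (1 / 2 : ℂ)
  rw [delbar_congr h4, delbar, h5.fderiv, levi_apply]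
  simp only [smul_apply, sub_apply, ContinuousLinearMap.flip_apply, smul_eq_mul,
    ContinuousLinearMap.comp_apply, Complex.ofRealCLM_apply]
  linear_combination (((fderiv ℝ (fderiv ℝ u) z (Complex.I • v)) (Complex.I • w) : ℂ) / 4) *
    Complex.I_mul_I

theorem ContDiffAt.levi (hu : ContDiffAt ℝ ∞ u z) (v w : Cn k) :
    ContDiffAt ℝ ∞ (fun y => levi u y v w) z := by
  have h : ContDiffAt ℝ ∞ (fderiv ℝ (fderiv ℝ u)) z :=
    ContDiffAt.fderiv_right (m := ∞) (n := ∞) (hu.fderiv_right (by simp)) (by simp)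
  have h1 : ∀ v w : Cn k, ContDiffAt ℝ ∞ (fun y => ((fderiv ℝ (fderiv ℝ u) y v w : ℝ) : ℂ)) z :=
    fun v w => ContDiffAt.ofReal ((h.clm_apply contDiffAt_const).clm_apply contDiffAt_const)
  exact (((h1 _ _).add (h1 _ _)).add (contDiffAt_const.mul ((h1 _ _).sub (h1 _ _)))).div_const 4

/-- The Levi form is closed. -/
theorem del_levi_comm (hu : ContDiffAt ℝ ∞ u z) (v w x : Cn k) :
    del (fun y => levi u y v w) z x = del (fun y => levi u y v x) z w := by
  have h2 : ContDiffAt ℝ 2 u z := hu.of_le two_le_infty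
  have key : ∀ w, (fun y => WStar.levi u y v w) =ᶠ[𝓝 z]
      fun y => del (fun y' => WStar.delbar (fun x => (u x : ℂ)) y' v) y w := by
    intro w
    filter_upwards [eventually_contDiffAt (n := 2) h2] with y hy
    rw [levi_eq_delbar_del hy, delbar_del_comm (ContDiffAt.ofReal hy)]
  rw [del_congr (key w), del_congr (key x)]
  exact del_del_comm ((ContDiffAt.delbar (ContDiffAt.ofReal hu) v).of_le
    two_le_infty) x w

theorem conj_levi (hu : ContDiffAt ℝ 2 u z) (v w : Cn k) :
    conj (levi u z v w) = levi u z w v := by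
  have hs : ∀ v w, fderiv ℝ (fderiv ℝ u) z v w = fderiv ℝ (fderiv ℝ u) z w v :=
    fun v w => (hu.isSymmSndFDerivAt (by simp)) v w
  rw [levi_apply, levi_apply, hs w v, hs (Complex.I • w) (Complex.I • v), hs (Complex.I • w) v,
    hs w (Complex.I • v)]
  simp only [map_div₀, map_add, map_mul, map_sub, Complex.conj_ofReal, Complex.conj_I,
    Complex.conj_ofNat]
  ring

theorem norm_levi_le (u : Cn k → ℝ) (z v w : Cn k) :
    ‖levi u z v w‖ ≤ ‖fderiv ℝ (fderiv ℝ u) z‖ * ‖v‖ * ‖w‖ := by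
  have h : ∀ v w : Cn k, ‖((fderiv ℝ (fderiv ℝ u) z v w : ℝ) : ℂ)‖
      ≤ ‖fderiv ℝ (fderiv ℝ u) z‖ * ‖v‖ * ‖w‖ := fun v w => by
    rw [Complex.norm_real]; exact (fderiv ℝ (fderiv ℝ u) z).le_opNorm₂ v w
  have hI : ∀ v : Cn k, ‖Complex.I • v‖ = ‖v‖ := fun v => by
    rw [norm_smul, Complex.norm_I, one_mul]
  have h1 := h v w
  have h2 := h (Complex.I • v) (Complex.I • w)
  have h3 := h (Complex.I • v) w
  have h4 := h v (Complex.I • w)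
  rw [hI] at h2 h3
  rw [hI] at h2 h4
  rw [levi_apply, norm_div, Complex.norm_ofNat]
  have h5 := norm_add_le (((fderiv ℝ (fderiv ℝ u) z v w : ℝ) : ℂ)
      + (fderiv ℝ (fderiv ℝ u) z (Complex.I • v) (Complex.I • w) : ℂ))
      (Complex.I * ((fderiv ℝ (fderiv ℝ u) z (Complex.I • v) w : ℂ)
        - (fderiv ℝ (fderiv ℝ u) z v (Complex.I • w) : ℂ)))
  have h6 := norm_add_le ((fderiv ℝ (fderiv ℝ u) z v w : ℝ) : ℂ)
      (fderiv ℝ (fderiv ℝ u) z (Complex.I • v) (Complex.I • w) : ℂ)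
  have h7 := norm_sub_le (fderiv ℝ (fderiv ℝ u) z (Complex.I • v) w : ℂ)
        (fderiv ℝ (fderiv ℝ u) z v (Complex.I • w) : ℂ)
  rw [norm_mul, Complex.norm_I, one_mul] at h5
  linarith

theorem levi_congr {u u' : Cn k → ℝ} {z : Cn k} (h : u =ᶠ[𝓝 z] u') : levi u z = levi u' z := by
  have h2 : fderiv ℝ u =ᶠ[𝓝 z] fderiv ℝ u' := h.fderiv
  ext v w
  simp only [levi_apply, h2.fderiv_eq]

theorem fderiv_real_of_complex {ψ : Cn k → Cn k} {z : Cn k} (hψ : DifferentiableAt ℂ ψ z)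
    (v : Cn k) : fderiv ℝ ψ z v = fderiv ℂ ψ z v := by
  rw [hψ.fderiv_restrictScalars ℝ]; rfl

/-- Pull-back of `∂` by a holomorphic map. -/
theorem del_comp {ψ : Cn k → Cn k} {f : Cn k → ℂ} (hf : DifferentiableAt ℝ f (ψ z))
    (hψ : DifferentiableAt ℂ ψ z) (v : Cn k) :
    del (fun y => f (ψ y)) z v = del f (ψ z) (fderiv ℂ ψ z v) := by
  have h : HasFDerivAt (fun y => f (ψ y)) ((fderiv ℝ f (ψ z)).comp (fderiv ℝ ψ z)) z :=
    hf.hasFDerivAt.comp z (hψ.restrictScalars ℝ).hasFDerivAt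
  rw [del, del, h.fderiv]
  simp only [ContinuousLinearMap.comp_apply, fderiv_real_of_complex hψ, map_smul]

/-- Pull-back of the Levi form by a holomorphic map. -/
theorem levi_comp {ψ : Cn k → Cn k} (hu : ContDiffAt ℝ 2 u (ψ z)) (hψ : ContDiffAt ℂ 2 ψ z)
    (v w : Cn k) :
    levi (fun y => u (ψ y)) z v w = levi u (ψ z) (fderiv ℂ ψ z v) (fderiv ℂ ψ z w) := by
  have hψd : ∀ᶠ y in 𝓝 z, DifferentiableAt ℂ ψ y :=
    (hψ.eventually (by simp)).mono fun y hy => hy.differentiableAt (by simp)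
  have hud : ∀ᶠ y in 𝓝 z, DifferentiableAt ℝ u (ψ y) :=
    hψ.continuousAt.eventually ((eventually_contDiffAt (n := 2) hu).mono
      fun y hy => hy.differentiableAt (by simp))
  have hD : HasFDerivAt (fderiv ℂ ψ) (fderiv ℂ (fderiv ℂ ψ) z) z :=
    ((hψ.fderiv_right (m := 1) (by norm_num)).differentiableAt (by simp)).hasFDerivAt
  have hE : HasFDerivAt (fderiv ℝ u) (fderiv ℝ (fderiv ℝ u) (ψ z)) (ψ z) :=
    ((hu.fderiv_right (m := 1) (by norm_num)).differentiableAt (by simp)).hasFDerivAt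
  have hψz := hψd.self_of_nhds
  have hE' := hE.comp z (hψz.restrictScalars ℝ).hasFDerivAt
  -- the second derivative of the composition
  have key : ∀ v w, fderiv ℝ (fderiv ℝ (fun y => u (ψ y))) z v w =
      fderiv ℝ (fderiv ℝ u) (ψ z) (fderiv ℂ ψ z v) (fderiv ℂ ψ z w)
        + fderiv ℝ u (ψ z) (fderiv ℂ (fderiv ℂ ψ) z v w) := by
    intro v w
    have e1 : (fun y => fderiv ℝ (fun y => u (ψ y)) y w) =ᶠ[𝓝 z]
        fun y => fderiv ℝ u (ψ y) (fderiv ℂ ψ y w) := by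
      filter_upwards [hψd, hud] with y hy hy'
      have h : HasFDerivAt (fun y => u (ψ y)) ((fderiv ℝ u (ψ y)).comp (fderiv ℝ ψ y)) y :=
        hy'.hasFDerivAt.comp y (hy.restrictScalars ℝ).hasFDerivAt
      rw [h.fderiv, ContinuousLinearMap.comp_apply, fderiv_real_of_complex hy]
    have hc : ContDiffAt ℝ 2 (fun y => u (ψ y)) z := hu.comp z (hψ.restrict_scalars ℝ)
    have e2 := ((hc.fderiv_right (m := 1) (by norm_num)).differentiableAt
      (by simp)).hasFDerivAt.clm_apply (hasFDerivAt_const w z)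
    have e3 : HasFDerivAt (fun y => fderiv ℂ ψ y w)
        (((fderiv ℂ (fderiv ℂ ψ) z).flip w).restrictScalars ℝ) z := by
      have h := hD.clm_apply (hasFDerivAt_const w z)
      have h' : HasFDerivAt (fun y => fderiv ℂ ψ y w) ((fderiv ℂ (fderiv ℂ ψ) z).flip w) z := by
        simpa using h
      exact h'.restrictScalars ℝ
    have e4 := hE'.clm_apply e3
    have e5 := e2.fderiv
    rw [e1.fderiv_eq] at e5
    have e6 := congrArg (fun L => L v) (e5.symm.trans e4.fderiv)
    simpa [fderiv_real_of_complex hψz, add_comm] using e6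
  rw [levi_apply, levi_apply]
  simp only [key, map_smul, smul_apply, smul_smul, Complex.I_mul_I, neg_one_smul, map_neg]
  push_cast
  ring

end Levi

end

/-! ### Isolated singularities in integral identities -/

section

variable {k : ℕ}

theorem finrank_real_Cn (k : ℕ) : Module.finrank ℝ (Cn k) = 2 * k := by
  rw [← Module.finrank_mul_finrank ℝ ℂ (Cn k), Complex.finrank_real_complex]
  simp

theorem nontrivial_Cn (hk : 2 ≤ k) : Nontrivial (Cn k) := by
  have : Nonempty (Fin k) := ⟨⟨0, by omega⟩⟩
  infer_instance

/-- In real dimension at least four, `‖z - a‖⁻³` is locally integrable. -/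
theorem integrableOn_inv_norm_pow (hk : 2 ≤ k) (a : Cn k) {m : ℕ} (hm : m ≤ 3) {K : Set (Cn k)}
    (hK : Bornology.IsBounded K) : IntegrableOn (fun z => (‖z - a‖ ^ m)⁻¹) K := by
  obtain ⟨R, hR⟩ := hK.subset_ball a
  have hnt := nontrivial_Cn hk
  have h1 : Integrable (fun z : Cn k => (fun t : ℝ => (Iio R).indicator (fun t => (t ^ m)⁻¹) t) ‖z‖) := by
    rw [integrable_fun_norm_addHaar, finrank_real_Cn]
    have h2 : IntegrableOn (fun t : ℝ => t ^ (2 * k - 1 - m)) (Ioi 0 ∩ Iio R) := by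
      refine IntegrableOn.mono_set (t := Icc 0 R) ?_ (fun t ht => ⟨ht.1.le, ht.2.le⟩)
      exact (continuous_id.pow _).continuousOn.integrableOn_Icc
    have h3 : IntegrableOn ((Iio R).indicator fun t : ℝ => t ^ (2 * k - 1 - m)) (Ioi 0) := by
      rw [integrableOn_indicator_iff measurableSet_Iio, Set.inter_comm]
      exact h2
    refine h3.congr_fun ?_ measurableSet_Ioi
    intro t ht
    by_cases htR : t ∈ Iio R
    · simp only [indicator_of_mem htR, smul_eq_mul]
      have ht0 : t ≠ 0 := ne_of_gt ht
      rw [pow_sub₀ _ ht0 (by omega)]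
    · simp [indicator_of_notMem htR]
  have h4 := (h1.comp_sub_right a).integrableOn (s := Metric.ball a R)
  refine IntegrableOn.mono_set ?_ hR
  refine h4.congr_fun ?_ measurableSet_ball
  intro z hz
  have : ‖z - a‖ ∈ Iio R := by simpa [dist_eq_norm] using hz
  simp only [indicator_of_mem this]

/-- `F` is continuous on `Ω` apart from an isolated singularity at `a`, where it is
`O(‖z - a‖⁻ᵐ)`. The value at `a` is irrelevant. -/
structure HasPoleBound (Ω : Set (Cn k)) (a : Cn k) (m : ℕ) (F : Cn k → ℂ) : Prop where
  continuousOn : ContinuousOn F (Ω \ {a})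
  bound : ∀ K ⊆ Ω, IsCompact K → ∃ C, 0 ≤ C ∧ ∀ z ∈ K, z ≠ a → ‖F z‖ * ‖z - a‖ ^ m ≤ C

/-- It suffices to bound `F` near the singularity. -/
theorem HasPoleBound.of_eventually {Ω : Set (Cn k)} {a : Cn k} {m : ℕ} {F : Cn k → ℂ}
    (hF : ContinuousOn F (Ω \ {a}))
    (hb : ∃ C, ∀ᶠ z in 𝓝[≠] a, ‖F z‖ * ‖z - a‖ ^ m ≤ C) : HasPoleBound Ω a m F := by
  refine ⟨hF, fun K hK hKc => ?_⟩
  obtain ⟨C, hC⟩ := hb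
  rw [eventually_nhdsWithin_iff, Metric.eventually_nhds_iff_ball] at hC
  obtain ⟨ρ, hρ, hC⟩ := hC
  have hK' : IsCompact (K \ Metric.ball a ρ) := hKc.diff Metric.isOpen_ball
  have hcont : ContinuousOn (fun z => ‖F z‖ * ‖z - a‖ ^ m) (K \ Metric.ball a ρ) := by
    refine ContinuousOn.mul (hF.norm.mono ?_) (by fun_prop)
    intro z hz
    refine ⟨hK hz.1, fun h => hz.2 ?_⟩
    rw [mem_singleton_iff.1 h]
    exact Metric.mem_ball_self hρ
  obtain ⟨C', hC'⟩ := hK'.bddAbove_image hcont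
  refine ⟨max 0 (max C C'), le_max_left _ _, fun z hz hza => ?_⟩
  by_cases h : z ∈ Metric.ball a ρ
  · exact (hC z h hza).trans ((le_max_left _ _).trans (le_max_right _ _))
  · exact (hC' (mem_image_of_mem _ ⟨hz, h⟩)).trans ((le_max_right _ _).trans (le_max_right _ _))

theorem continuousOn_mul_of_tsupport_diff {Ω : Set (Cn k)} (hΩ : IsOpen Ω) {a : Cn k}
    {F χ : Cn k → ℂ} (hF : ContinuousOn F (Ω \ {a})) (hχ : Continuous χ) (hs : tsupport χ ⊆ Ω) :
    ContinuousOn (fun z => F z * χ z) {a}ᶜ := by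
  intro z hz
  by_cases hzΩ : z ∈ Ω
  · have : Ω \ {a} ∈ 𝓝 z := (hΩ.sdiff isClosed_singleton).mem_nhds ⟨hzΩ, hz⟩
    exact ((hF.continuousAt this).mul hχ.continuousAt).continuousWithinAt
  · have h0 : χ =ᶠ[𝓝 z] 0 := notMem_tsupport_iff_eventuallyEq.1 fun h => hzΩ (hs h)
    have h1 : (fun z => F z * χ z) =ᶠ[𝓝 z] fun _ => 0 := by
      filter_upwards [h0] with y hy
      simp [hy]
    exact (continuousAt_const.congr h1.symm).continuousWithinAt

theorem HasPoleBound.integrable_mul (hk : 2 ≤ k) {Ω : Set (Cn k)} (hΩ : IsOpen Ω) {a : Cn k} {m : ℕ}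
    (hm : m ≤ 3) {F χ : Cn k → ℂ} (hF : HasPoleBound Ω a m F) (hχ : Continuous χ)
    (hc : HasCompactSupport χ) (hs : tsupport χ ⊆ Ω) : Integrable (fun z => F z * χ z) := by
  have hnt := nontrivial_Cn hk
  obtain ⟨C, hC0, hC⟩ := hF.bound _ hs hc
  obtain ⟨M, hM⟩ := hc.exists_bound_of_continuous hχ
  have hmeas : Measurable (fun z => F z * χ z) :=
    measurable_of_continuousOn_compl_singleton a
      (continuousOn_mul_of_tsupport_diff hΩ hF.continuousOn hχ hs)
  have hint := ((integrableOn_inv_norm_pow hk a hm hc.isBounded).const_mul (C * M))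
  replace hint := (integrable_indicator_iff (isClosed_tsupport χ).measurableSet).2 hint
  refine hint.mono' hmeas.aestronglyMeasurable ?_
  have hae : ∀ᵐ z : Cn k, z ≠ a := by
    rw [ae_iff]; simp
  filter_upwards [hae] with z hz
  by_cases hzs : z ∈ tsupport χ
  · rw [indicator_of_mem hzs, norm_mul]
    have hpos : 0 < ‖z - a‖ ^ m := pow_pos (norm_pos_iff.2 (sub_ne_zero.2 hz)) m
    have h1 : ‖F z‖ ≤ C * (‖z - a‖ ^ m)⁻¹ := by
      rw [← div_eq_mul_inv, le_div_iff₀ hpos]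
      exact hC z hzs hz
    calc ‖F z‖ * ‖χ z‖ ≤ (C * (‖z - a‖ ^ m)⁻¹) * M :=
          mul_le_mul h1 (hM z) (norm_nonneg _) (by positivity)
      _ = _ := by ring
  · rw [indicator_of_notMem hzs, image_eq_zero_of_notMem_tsupport hzs]
    simp

/-- Cutoff functions `1 - β(n(z - a))` which vanish near `a`. -/
theorem exists_cutoff (a : Cn k) : ∃ (η : ℕ → Cn k → ℂ) (M : ℝ), 0 ≤ M ∧
    (∀ n, ContDiff ℝ ∞ (η n)) ∧ (∀ n, η n =ᶠ[𝓝 a] 0) ∧ (∀ n z, ‖η n z‖ ≤ 1) ∧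
    (∀ n z v, ‖z - a‖ * ‖del (η n) z v‖ ≤ M * ‖v‖) ∧
    (∀ z, z ≠ a → ∀ᶠ n in atTop, η n =ᶠ[𝓝 z] fun _ => 1) := by
  let β : ContDiffBump (0 : Cn k) := ⟨1, 2, one_pos, one_lt_two⟩
  have hβ : ContDiff ℝ ∞ β := β.contDiff
  have hβc : HasCompactSupport (fderiv ℝ β) := β.hasCompactSupport.fderiv ℝ
  obtain ⟨M, hM⟩ := hβc.exists_bound_of_continuous (hβ.continuous_fderiv (by simp))
  have hM0 : 0 ≤ M := (norm_nonneg _).trans (hM 0)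
  let η : ℕ → Cn k → ℂ := fun n z => ((1 - β (((n : ℝ) + 1) • (z - a)) : ℝ) : ℂ)
  have hsm : ∀ n, ContDiff ℝ ∞ (fun z => 1 - β (((n : ℝ) + 1) • (z - a))) := fun n =>
    contDiff_const.sub (hβ.comp ((contDiff_id.sub contDiff_const).const_smul ((n : ℝ) + 1)))
  have hn : ∀ n : ℕ, 0 < (n : ℝ) + 1 := fun n => by positivity
  refine ⟨η, 2 * M, by positivity, fun n => Complex.ofRealCLM.contDiff.comp (hsm n), ?_, ?_, ?_, ?_⟩
  · intro n
    have : Metric.ball a (1 / ((n : ℝ) + 1)) ∈ 𝓝 a :=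
      Metric.ball_mem_nhds _ (by have := hn n; positivity)
    filter_upwards [this] with z hz
    have h1 : β (((n : ℝ) + 1) • (z - a)) = 1 := by
      apply β.one_of_mem_closedBall
      rw [mem_closedBall_zero_iff, norm_smul, Real.norm_of_nonneg (hn n).le]
      rw [Metric.mem_ball, dist_eq_norm, lt_div_iff₀ (hn n)] at hz
      change _ ≤ (1 : ℝ)
      linarith [mul_comm ‖z - a‖ ((n : ℝ) + 1)]
    simp [η, h1]
  · intro n z
    have h0 := β.nonneg (x := ((n : ℝ) + 1) • (z - a))
    have h1 := β.le_one (x := ((n : ℝ) + 1) • (z - a))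
    simp only [η, Complex.norm_real]
    rw [Real.norm_of_nonneg (by linarith)]
    linarith
  · intro n z v
    have hd : HasFDerivAt (fun z => 1 - β (((n : ℝ) + 1) • (z - a)))
        (-((fderiv ℝ β (((n : ℝ) + 1) • (z - a))).comp
          (((n : ℝ) + 1) • ContinuousLinearMap.id ℝ (Cn k)))) z := by
      have e1 : HasFDerivAt (fun z : Cn k => ((n : ℝ) + 1) • (z - a))
          (((n : ℝ) + 1) • ContinuousLinearMap.id ℝ (Cn k)) z :=
        ((hasFDerivAt_id z).sub_const a).fun_const_smul _
      have e2 : HasFDerivAt β (fderiv ℝ β (((n : ℝ) + 1) • (z - a))) (((n : ℝ) + 1) • (z - a)) :=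
        (hβ.differentiable (by simp) _).hasFDerivAt
      exact (e2.comp z e1).const_sub 1
    have hd' : HasFDerivAt (η n) (Complex.ofRealCLM.comp (-((fderiv ℝ β
        (((n : ℝ) + 1) • (z - a))).comp (((n : ℝ) + 1) • ContinuousLinearMap.id ℝ (Cn k))))) z :=
      Complex.ofRealCLM.hasFDerivAt.comp z hd
    have hle : ‖fderiv ℝ (η n) z‖ ≤ ((n : ℝ) + 1) * ‖fderiv ℝ β (((n : ℝ) + 1) • (z - a))‖ := by
      rw [hd'.fderiv]
      refine ContinuousLinearMap.opNorm_le_bound _ (by have := hn n; positivity) fun x => ?_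
      simp only [ContinuousLinearMap.comp_apply, Complex.ofRealCLM_apply, Complex.norm_real,
        neg_apply, smul_apply, ContinuousLinearMap.id_apply, map_smul, norm_neg, norm_smul,
        Real.norm_of_nonneg (hn n).le]
      rw [mul_assoc]
      exact mul_le_mul_of_nonneg_left (ContinuousLinearMap.le_opNorm _ _) (hn n).le
    have hd2 := norm_del_le (η n) z v
    have hv := norm_nonneg v
    by_cases hz : ((n : ℝ) + 1) * ‖z - a‖ ≤ 2
    · have h3 := hM (((n : ℝ) + 1) • (z - a))
      calc ‖z - a‖ * ‖del (η n) z v‖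
          ≤ ‖z - a‖ * ((((n : ℝ) + 1) * M) * ‖v‖) := by
            refine mul_le_mul_of_nonneg_left (hd2.trans ?_) (norm_nonneg _)
            exact mul_le_mul_of_nonneg_right
              (hle.trans (mul_le_mul_of_nonneg_left h3 (hn n).le)) hv
        _ = (((n : ℝ) + 1) * ‖z - a‖) * (M * ‖v‖) := by ring
        _ ≤ 2 * (M * ‖v‖) := mul_le_mul_of_nonneg_right hz (by positivity)
        _ = _ := by ring
    · have h4 : ((n : ℝ) + 1) • (z - a) ∉ tsupport β := by
        rw [β.tsupport_eq, mem_closedBall_zero_iff, norm_smul, Real.norm_of_nonneg (hn n).le]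
        exact hz
      have h5 : fderiv ℝ β (((n : ℝ) + 1) • (z - a)) = 0 :=
        image_eq_zero_of_notMem_tsupport fun h => h4 (tsupport_fderiv_subset ℝ h)
      rw [h5, norm_zero, mul_zero] at hle
      have h6 : ‖del (η n) z v‖ ≤ 0 := hd2.trans (by nlinarith)
      have h7 : 0 ≤ 2 * M * ‖v‖ := by positivity
      nlinarith [norm_nonneg (z - a), norm_nonneg (del (η n) z v)]
  · intro z hz
    have hpos : 0 < ‖z - a‖ := norm_pos_iff.2 (sub_ne_zero.2 hz)
    obtain ⟨N, hN⟩ := exists_nat_gt (4 / ‖z - a‖)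
    filter_upwards [eventually_ge_atTop N] with n hnN
    have : {y : Cn k | ‖z - a‖ / 2 < ‖y - a‖} ∈ 𝓝 z :=
      (isOpen_lt continuous_const (by fun_prop)).mem_nhds (by simp only [mem_ofPred_eq]; linarith)
    filter_upwards [this] with y hy
    have h1 : β (((n : ℝ) + 1) • (y - a)) = 0 := by
      apply β.zero_of_le_dist
      rw [dist_zero_right, norm_smul, Real.norm_of_nonneg (hn n).le]
      change (2 : ℝ) ≤ _
      rw [div_lt_iff₀ hpos] at hN
      have h2 : (N : ℝ) ≤ n := by exact_mod_cast hnN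
      have h3 : ‖z - a‖ / 2 < ‖y - a‖ := hy
      nlinarith [hn n]
    simp [η, h1]

/-- An identity `∂_v F₁ = ∂_{v'} F₂ + H`, in the sense of distributions, which holds outside a point
holds across that point if `F₁` and `F₂` are `O(‖z - a‖⁻²)`: with the cutoff functions of
`exists_cutoff` the error terms are `O(‖z - a‖⁻³)`, hence dominated by an integrable function. -/
theorem integral_identity_of_diff_singleton (hk : 2 ≤ k) {Ω : Set (Cn k)} (hΩ : IsOpen Ω)
    {a : Cn k} {F₁ F₂ H : Cn k → ℂ} (h₁ : HasPoleBound Ω a 2 F₁) (h₂ : HasPoleBound Ω a 2 F₂)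
    (hH : HasPoleBound Ω a 3 H) (v₁ v₂ : Cn k)
    (h : ∀ χ, IsTest (Ω \ {a}) χ →
      ∫ z, (F₁ z * del χ z v₁ - F₂ z * del χ z v₂ + H z * χ z) = 0)
    (χ : Cn k → ℂ) (hχ : IsTest Ω χ) :
      ∫ z, (F₁ z * del χ z v₁ - F₂ z * del χ z v₂ + H z * χ z) = 0 := by
  have hnt := nontrivial_Cn hk
  obtain ⟨hsm, hc, hs⟩ := hχ
  obtain ⟨η, M, hM0, hηs, hη0, hη1, hηd, hηt⟩ := exists_cutoff a
  have hdiffχ : ∀ z, DifferentiableAt ℝ χ z := fun z => hsm.contDiffAt.differentiableAt (by simp)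
  have hdiffη : ∀ n z, DifferentiableAt ℝ (η n) z := fun n z =>
    (hηs n).contDiffAt.differentiableAt (by simp)
  have hae : ∀ᵐ z : Cn k, z ≠ a := by rw [ae_iff]; simp
  -- the identity for the test functions `η n * χ`
  have hzero : ∀ n, ∫ z, (F₁ z * del (fun y => η n y * χ y) z v₁
      - F₂ z * del (fun y => η n y * χ y) z v₂ + H z * (η n z * χ z)) = 0 := by
    intro n
    refine h _ ⟨(hηs n).mul hsm, hc.mul_left, fun z hz => ⟨hs (tsupport_mul_subset_right hz), ?_⟩⟩
    intro hza
    rw [mem_singleton_iff.1 hza] at hz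
    have : a ∉ tsupport (η n) := notMem_tsupport_iff_eventuallyEq.2 (hη0 n)
    exact this (tsupport_mul_subset_left hz)
  have hcd : ∀ v, Continuous fun z => del χ z v := fun v => (ContDiff.del hsm v).continuous
  have I1 : ∀ (F : Cn k → ℂ) (hF : HasPoleBound Ω a 2 F) v, Integrable fun z => F z * del χ z v :=
    fun F hF v => hF.integrable_mul hk hΩ (by norm_num) (hcd v) (hasCompactSupport_del hc v)
      ((tsupport_del_subset χ v).trans hs)
  -- `‖F‖ ‖χ‖ / ‖z - a‖` is integrable
  have I2 : ∀ (F : Cn k → ℂ) (hF : HasPoleBound Ω a 2 F),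
      Integrable fun z => (F z * ((‖z - a‖ : ℂ)⁻¹)) * χ z := by
    intro F hF
    refine HasPoleBound.integrable_mul (m := 3) (a := a) hk hΩ le_rfl ⟨?_, ?_⟩ hsm.continuous hc hs
    · refine hF.continuousOn.mul (ContinuousOn.inv₀ (by fun_prop) ?_)
      intro z hz
      have : z ≠ a := hz.2
      simpa [sub_eq_zero] using this
    · intro K hK hKc
      obtain ⟨C, hC0, hC⟩ := hF.bound K hK hKc
      refine ⟨C, hC0, fun z hz hza => ?_⟩
      have hne : ‖z - a‖ ≠ 0 := by simpa [sub_eq_zero] using hza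
      have := hC z hz hza
      rw [norm_mul, norm_inv, Complex.norm_real, norm_norm]
      calc ‖F z‖ * ‖z - a‖⁻¹ * ‖z - a‖ ^ 3 = ‖F z‖ * ‖z - a‖ ^ 2 := by field_simp
        _ ≤ C := this
  have I3 : Integrable fun z => H z * χ z :=
    hH.integrable_mul hk hΩ le_rfl hsm.continuous hc hs
  let bd : Cn k → ℝ := fun z => (‖F₁ z * del χ z v₁‖ + M * ‖v₁‖ * ‖(F₁ z * (‖z - a‖ : ℂ)⁻¹) * χ z‖)
    + (‖F₂ z * del χ z v₂‖ + M * ‖v₂‖ * ‖(F₂ z * (‖z - a‖ : ℂ)⁻¹) * χ z‖) + ‖H z * χ z‖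
  have hbd : Integrable bd :=
    (((I1 F₁ h₁ v₁).norm.add ((I2 F₁ h₁).norm.const_mul _)).add
      ((I1 F₂ h₂ v₂).norm.add ((I2 F₂ h₂).norm.const_mul _))).add I3.norm
  have hmeasF : ∀ (F ξ : Cn k → ℂ), ContinuousOn F (Ω \ {a}) → Continuous ξ → tsupport ξ ⊆ Ω →
      AEStronglyMeasurable (fun z => F z * ξ z) := fun F ξ hF hξ hξs =>
    (measurable_of_continuousOn_compl_singleton a
      (continuousOn_mul_of_tsupport_diff hΩ hF hξ hξs)).aestronglyMeasurable
  have hlim := tendsto_integral_of_dominated_convergence (μ := (volume : Measure (Cn k)))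
    (F := fun n z => F₁ z * del (fun y => η n y * χ y) z v₁
      - F₂ z * del (fun y => η n y * χ y) z v₂ + H z * (η n z * χ z))
    (f := fun z => F₁ z * del χ z v₁ - F₂ z * del χ z v₂ + H z * χ z) bd
    (fun n => by
      have hsn : ContDiff ℝ ∞ fun y => η n y * χ y := (hηs n).mul hsm
      have hts : tsupport (fun y => η n y * χ y) ⊆ Ω := tsupport_mul_subset_right.trans hs
      exact ((hmeasF _ _ h₁.continuousOn (ContDiff.del hsn v₁).continuous
        ((tsupport_del_subset _ _).trans hts)).sub
        (hmeasF _ _ h₂.continuousOn (ContDiff.del hsn v₂).continuous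
        ((tsupport_del_subset _ _).trans hts))).add
        (hmeasF _ _ hH.continuousOn hsn.continuous hts))
    hbd
    (fun n => by
      filter_upwards [hae] with z hz
      have hpos : 0 < ‖z - a‖ := norm_pos_iff.2 (sub_ne_zero.2 hz)
      have key : ∀ (F : Cn k → ℂ) v, ‖F z * del (fun y => η n y * χ y) z v‖ ≤
          ‖F z * del χ z v‖ + M * ‖v‖ * ‖(F z * (‖z - a‖ : ℂ)⁻¹) * χ z‖ := by
        intro F v
        rw [del_mul (hdiffη n z) (hdiffχ z)]
        have e1 : ‖del (η n) z v‖ ≤ M * ‖v‖ * ‖z - a‖⁻¹ := by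
          rw [← div_eq_mul_inv, le_div_iff₀ hpos, mul_comm]
          exact hηd n z v
        calc ‖F z * (η n z * del χ z v + χ z * del (η n) z v)‖
            = ‖η n z * (F z * del χ z v) + F z * χ z * del (η n) z v‖ := by ring_nf
          _ ≤ ‖η n z‖ * ‖F z * del χ z v‖ + ‖F z * χ z‖ * ‖del (η n) z v‖ := by
            refine (norm_add_le _ _).trans ?_
            rw [norm_mul (η n z), norm_mul (F z * χ z)]
          _ ≤ 1 * ‖F z * del χ z v‖ + ‖F z * χ z‖ * (M * ‖v‖ * ‖z - a‖⁻¹) := by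
            gcongr
            exact hη1 n z
          _ = _ := by
            simp only [norm_mul, norm_inv, Complex.norm_real, norm_norm]
            ring
      have key3 : ‖H z * (η n z * χ z)‖ ≤ ‖H z * χ z‖ := by
        rw [norm_mul, norm_mul, norm_mul]
        have := hη1 n z
        calc ‖H z‖ * (‖η n z‖ * ‖χ z‖) ≤ ‖H z‖ * (1 * ‖χ z‖) := by gcongr
          _ = _ := by ring
      refine (norm_add_le _ _).trans ?_
      refine add_le_add ((norm_sub_le _ _).trans (add_le_add (key F₁ v₁) (key F₂ v₂))) key3)
    (by
      filter_upwards [hae] with z hz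
      refine tendsto_const_nhds.congr' ?_
      filter_upwards [hηt z hz] with n hn
      have h1 : η n z = 1 := hn.self_of_nhds
      have h2 : (fun y => η n y * χ y) =ᶠ[𝓝 z] χ := by
        filter_upwards [hn] with y hy
        rw [hy, one_mul]
      rw [del_congr h2, del_congr h2, h1, one_mul])
  simp only [hzero] at hlim
  exact (tendsto_nhds_unique hlim tendsto_const_nhds)

end

section

variable {k : ℕ}

/-- A function which is smooth outside a point, and not too singular there, has its pointwise
derivative as weak derivative. -/
theorem isWeakDelOn_of_pole (hk : 2 ≤ k) {Ω : Set (Cn k)} (hΩ : IsOpen Ω) {a : Cn k}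
    {f : Cn k → ℝ} {G : Cn k → Cn k →ₗ[ℂ] ℂ} (hf : ∀ z ∈ Ω, z ≠ a → ContDiffAt ℝ ∞ f z)
    (hb : HasPoleBound Ω a 2 (fun z => (f z : ℂ))) (hG : ∀ v, HasPoleBound Ω a 3 (fun z => G z v))
    (hdel : ∀ z ∈ Ω, z ≠ a → ∀ v, G z v = del (fun y => (f y : ℂ)) z v) : IsWeakDelOn Ω f G := by
  have hnt := nontrivial_Cn hk
  have hΩa : IsOpen (Ω \ {a}) := hΩ.sdiff isClosed_singleton
  refine ⟨fun v => ?_, fun χ hχ v => ?_⟩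
  · have h1 : AEStronglyMeasurable (fun z => G z v) (volume.restrict (Ω \ {a})) :=
      (hG v).continuousOn.aestronglyMeasurable hΩa.measurableSet
    have h2 : (Ω \ {a} : Set (Cn k)) =ᵐ[volume] Ω := sdiff_null_ae_eq_self (by simp)
    rwa [Measure.restrict_congr_set h2] at h1
  · have h0 := integral_identity_of_diff_singleton hk hΩ hb (F₂ := fun _ => 0) (H := fun z => G z v)
      ⟨continuousOn_const, fun K _ _ => ⟨0, le_rfl, by simp⟩⟩ (hG v) v 0 (fun χ hχ => ?_) χ hχ
    · simp only [zero_mul, sub_zero] at h0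
      rw [integral_add] at h0
      · linear_combination h0
      · exact hb.integrable_mul hk hΩ (by norm_num) (ContDiff.del hχ.1 v).continuous
          (hasCompactSupport_del hχ.2.1 v) ((tsupport_del_subset χ v).trans hχ.2.2)
      · exact (hG v).integrable_mul hk hΩ le_rfl hχ.1.continuous hχ.2.1 hχ.2.2
    · have hF : ContDiffOn ℝ ∞ (fun z => (f z : ℂ)) (Ω \ {a}) := fun z hz =>
        (ContDiffAt.ofReal (hf z hz.1 hz.2)).contDiffWithinAt
      have h1 := integral_mul_del hΩa hF hχ v
      have h2 : ∫ z, del (fun y => (f y : ℂ)) z v * χ z = ∫ z, G z v * χ z := by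
        refine integral_congr_ae (Eventually.of_forall fun z => ?_)
        by_cases hz : z ∈ tsupport χ
        · simp only [hdel z (hχ.2.2 hz).1 (hχ.2.2 hz).2]
        · simp [image_eq_zero_of_notMem_tsupport hz]
      have hs : tsupport χ ⊆ Ω := hχ.2.2.trans sdiff_subset
      simp only [zero_mul, sub_zero]
      rw [integral_add, h1, h2, neg_add_cancel]
      · exact hb.integrable_mul hk hΩ (by norm_num) (ContDiff.del hχ.1 v).continuous
          (hasCompactSupport_del hχ.2.1 v) ((tsupport_del_subset χ v).trans hs)
      · exact (hG v).integrable_mul hk hΩ le_rfl hχ.1.continuous hχ.2.1 hs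

/-- A form which is smooth and closed outside a point, of order at most two at that point, is closed
in the sense of currents. -/
theorem integral_closed_of_pole (hk : 2 ≤ k) {Ω : Set (Cn k)} (hΩ : IsOpen Ω) {a : Cn k}
    {θ : Cn k → SesqForm (Cn k)}
    (hθ : ∀ z ∈ Ω, z ≠ a → ∀ v w, ContDiffAt ℝ ∞ (fun y => θ y v w) z)
    (hb : ∀ v w, HasPoleBound Ω a 2 (fun z => θ z v w))
    (hcl : ∀ z ∈ Ω, z ≠ a → ∀ u v w, del (fun y => θ y v w) z u = del (fun y => θ y v u) z w)
    {χ : Cn k → ℂ} (hχ : IsTest Ω χ) (u v w : Cn k) :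
    ∫ z, del χ z u * θ z v w = ∫ z, del χ z w * θ z v u := by
  have hΩa : IsOpen (Ω \ {a}) := hΩ.sdiff isClosed_singleton
  have hI : ∀ {χ : Cn k → ℂ}, IsTest Ω χ → ∀ u v w, Integrable fun z => θ z v w * del χ z u :=
    fun {χ} hχ u v w => (hb v w).integrable_mul hk hΩ (by norm_num) (ContDiff.del hχ.1 u).continuous
      (hasCompactSupport_del hχ.2.1 u) ((tsupport_del_subset χ u).trans hχ.2.2)
  have h0 := integral_identity_of_diff_singleton hk hΩ (hb v w) (hb v u) (H := fun _ => 0)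
      ⟨continuousOn_const, fun K _ _ => ⟨0, le_rfl, by simp⟩⟩ u w (fun χ hχ => ?_) χ hχ
  · simp only [zero_mul, add_zero] at h0
    rw [integral_sub (hI hχ u v w) (hI hχ w v u)] at h0
    simp_rw [mul_comm (del χ _ _)]
    exact sub_eq_zero.1 h0
  · have hF : ∀ v w, ContDiffOn ℝ ∞ (fun z => θ z v w) (Ω \ {a}) := fun v w z hz =>
      (hθ z hz.1 hz.2 v w).contDiffWithinAt
    have hχ' : IsTest Ω χ := ⟨hχ.1, hχ.2.1, hχ.2.2.trans sdiff_subset⟩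
    simp only [zero_mul, add_zero]
    rw [integral_sub (hI hχ' u v w) (hI hχ' w v u), integral_mul_del hΩa (hF v w) hχ u,
      integral_mul_del hΩa (hF v u) hχ w, sub_eq_zero, neg_inj]
    refine integral_congr_ae (Eventually.of_forall fun z => ?_)
    by_cases hz : z ∈ tsupport χ
    · simp only [hcl z (hχ.2.2 hz).1 (hχ.2.2 hz).2 u v w]
    · simp [image_eq_zero_of_notMem_tsupport hz]

/-! ### The model singularity -/

theorem delbar_mul {f g : Cn k → ℂ} {z : Cn k} (hf : DifferentiableAt ℝ f z)
    (hg : DifferentiableAt ℝ g z) (v : Cn k) :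
    delbar (fun y => f y * g y) z v = f z * delbar g z v + g z * delbar f z v := by
  simp only [delbar, fderiv_fun_mul hf hg, add_apply, smul_apply, smul_eq_mul]
  ring

theorem contDiff_norm_sq : ContDiff ℝ ∞ (fun z : Cn k => ‖z‖ ^ 2) := _root_.contDiff_norm_sq ℝ

theorem contDiff_coord (i : Fin k) : ContDiff ℝ ∞ (fun z : Cn k => z i) :=
  ((EuclideanSpace.proj (𝕜 := ℂ) i).restrictScalars ℝ).contDiff

theorem hasFDerivAt_coord (i : Fin k) (z : Cn k) : HasFDerivAt (fun z : Cn k => z i)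
    ((EuclideanSpace.proj (𝕜 := ℂ) i).restrictScalars ℝ) z :=
  ((EuclideanSpace.proj (𝕜 := ℂ) i).restrictScalars ℝ).hasFDerivAt

theorem contDiff_norm_coord_sq (i : Fin k) : ContDiff ℝ ∞ (fun z : Cn k => ‖z i‖ ^ 2) :=
  (contDiff_coord i).norm_sq ℝ

theorem fderiv_norm_sq_apply' (z v : Cn k) :
    fderiv ℝ (fun z : Cn k => ‖z‖ ^ 2) z v = 2 * (inner ℂ z v).re := by
  rw [fderiv_norm_sq_apply]
  simp [PiLp.inner_apply, Complex.inner]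

theorem fderiv_norm_coord_sq_apply (i : Fin k) (z v : Cn k) :
    fderiv ℝ (fun z : Cn k => ‖z i‖ ^ 2) z v = 2 * (conj (z i) * v i).re := by
  have h := (hasFDerivAt_coord i z).norm_sq
  rw [h.fderiv]
  simp
  ring

theorem del_norm_sq (z v : Cn k) :
    del (fun z : Cn k => ((‖z‖ ^ 2 : ℝ) : ℂ)) z v = inner ℂ z v := by
  rw [del_ofReal (contDiff_norm_sq.contDiffAt.differentiableAt (by simp)), fderiv_norm_sq_apply',
    fderiv_norm_sq_apply', inner_smul_right]
  apply Complex.ext <;> simp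

theorem delbar_norm_sq (z v : Cn k) :
    delbar (fun z : Cn k => ((‖z‖ ^ 2 : ℝ) : ℂ)) z v = inner ℂ v z := by
  have h : HasFDerivAt (fun y : Cn k => ((‖y‖ ^ 2 : ℝ) : ℂ))
      (Complex.ofRealCLM.comp (fderiv ℝ (fun y : Cn k => ‖y‖ ^ 2) z)) z :=
    Complex.ofRealCLM.hasFDerivAt.comp z
      (contDiff_norm_sq.contDiffAt.differentiableAt (by simp)).hasFDerivAt
  rw [delbar, h.fderiv]
  simp only [ContinuousLinearMap.comp_apply, Complex.ofRealCLM_apply]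
  rw [fderiv_norm_sq_apply', fderiv_norm_sq_apply', inner_smul_right, ← inner_conj_symm v z]
  generalize (inner ℂ z v : ℂ) = x
  apply Complex.ext <;> simp
  ring

theorem del_norm_coord_sq (i : Fin k) (z v : Cn k) :
    del (fun z : Cn k => ((‖z i‖ ^ 2 : ℝ) : ℂ)) z v = conj (z i) * v i := by
  rw [del_ofReal ((contDiff_norm_coord_sq i).contDiffAt.differentiableAt (by simp)),
    fderiv_norm_coord_sq_apply, fderiv_norm_coord_sq_apply]
  apply Complex.ext
  · simp
  · simp; ring

/-- The function `|z_i|² / ‖z‖²`. -/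
def ratio (i : Fin k) (z : Cn k) : ℝ := ‖z i‖ ^ 2 / ‖z‖ ^ 2

/-- The function `log ‖z‖²`. -/
def logSq (z : Cn k) : ℝ := Real.log (‖z‖ ^ 2)

theorem contDiffAt_ratio (i : Fin k) {z : Cn k} (hz : z ≠ 0) : ContDiffAt ℝ ∞ (ratio i) z :=
  (contDiff_norm_coord_sq i).contDiffAt.div contDiff_norm_sq.contDiffAt (by simpa using hz)

theorem contDiffAt_logSq {z : Cn k} (hz : z ≠ 0) : ContDiffAt ℝ ∞ (logSq (k := k)) z :=
  contDiff_norm_sq.contDiffAt.log (by simpa using hz)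

theorem ratio_nonneg (i : Fin k) (z : Cn k) : 0 ≤ ratio i z := by unfold ratio; positivity

theorem ratio_le_one (i : Fin k) (z : Cn k) : ratio i z ≤ 1 := by
  refine div_le_one_of_le₀ ?_ (by positivity)
  exact pow_le_pow_left₀ (norm_nonneg _) (PiLp.norm_apply_le z i) 2

theorem del_ratio (i : Fin k) {z : Cn k} (hz : z ≠ 0) (v : Cn k) :
    del (fun y => (ratio i y : ℂ)) z v =
      conj (z i) * (v i * (‖z‖ ^ 2 : ℝ) - z i * inner ℂ z v) / (‖z‖ ^ 2 : ℝ) ^ 2 := by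
  have hN : ((‖z‖ ^ 2 : ℝ) : ℂ) ≠ 0 := by
    norm_cast; simpa using hz
  have h1 : (fun y => ((‖y i‖ ^ 2 : ℝ) : ℂ)) =ᶠ[𝓝 z]
      fun y => (ratio i y : ℂ) * ((‖y‖ ^ 2 : ℝ) : ℂ) := by
    filter_upwards [isOpen_ne.mem_nhds hz] with y hy
    have : ‖y‖ ^ 2 ≠ 0 := by simpa using hy
    rw [← Complex.ofReal_mul, ratio, div_mul_cancel₀ _ this]
  have h2 := del_congr h1 v
  rw [del_norm_coord_sq, del_mul ((ContDiffAt.ofReal (contDiffAt_ratio i hz)).differentiableAt (by simp))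
    ((ContDiffAt.ofReal contDiff_norm_sq.contDiffAt).differentiableAt (by simp)), del_norm_sq] at h2
  have h3 : (ratio i z : ℂ) = z i * conj (z i) / ((‖z‖ ^ 2 : ℝ) : ℂ) := by
    rw [ratio, Complex.mul_conj, Complex.normSq_eq_norm_sq, Complex.ofReal_div]
  rw [h3] at h2
  rw [eq_div_iff (pow_ne_zero 2 hN)]
  field_simp at h2
  linear_combination -h2

theorem del_logSq {z : Cn k} (hz : z ≠ 0) (v : Cn k) :
    del (fun y => (logSq y : ℂ)) z v = inner ℂ z v / (‖z‖ ^ 2 : ℝ) := by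
  have hN : ‖z‖ ^ 2 ≠ 0 := by simpa using hz
  have h := ((contDiff_norm_sq (k := k)).contDiffAt.differentiableAt (x := z) (by simp)).hasFDerivAt.log hN
  rw [del_ofReal ((contDiffAt_logSq hz).differentiableAt (by simp))]
  have h' : fderiv ℝ (logSq (k := k)) z = _ := h.fderiv
  have hd := del_ofReal ((contDiff_norm_sq (k := k)).contDiffAt.differentiableAt (x := z) (by simp)) v
  rw [del_norm_sq] at hd
  rw [hd, h']
  simp only [smul_apply, smul_eq_mul]
  push_cast
  ring

theorem levi_logSq {z : Cn k} (hz : z ≠ 0) (v w : Cn k) :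
    levi logSq z v w = (inner ℂ v w * (‖z‖ ^ 2 : ℝ) - inner ℂ z w * inner ℂ v z)
      / (‖z‖ ^ 2 : ℝ) ^ 2 := by
  have hN : ((‖z‖ ^ 2 : ℝ) : ℂ) ≠ 0 := by
    norm_cast; simpa using hz
  rw [levi_eq_delbar_del ((contDiffAt_logSq hz).of_le two_le_infty)]
  set g : Cn k → ℂ := fun y => del (fun x => (logSq x : ℂ)) y w with hg
  have hgd : DifferentiableAt ℝ g z :=
    (ContDiffAt.del (ContDiffAt.ofReal (contDiffAt_logSq hz)) w).differentiableAt (by simp)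
  have h1 : (fun y : Cn k => (inner ℂ y w : ℂ)) =ᶠ[𝓝 z] fun y => g y * ((‖y‖ ^ 2 : ℝ) : ℂ) := by
    filter_upwards [isOpen_ne.mem_nhds hz] with y hy
    have : ((‖y‖ ^ 2 : ℝ) : ℂ) ≠ 0 := by norm_cast; simpa using hy
    simp only [hg]
    rw [del_logSq hy, div_mul_cancel₀ _ this]
  have h2 := delbar_congr h1 v
  rw [delbar_mul hgd ((ContDiffAt.ofReal contDiff_norm_sq.contDiffAt).differentiableAt (by simp)),
    delbar_norm_sq] at h2
  have h3 : delbar (fun y : Cn k => (inner ℂ y w : ℂ)) z v = inner ℂ v w := by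
    have h : HasFDerivAt (fun y : Cn k => conj (inner ℂ w y : ℂ))
        (Complex.conjCLE.toContinuousLinearMap.comp ((innerSL ℂ w).restrictScalars ℝ)) z :=
      (Complex.conjCLE.toContinuousLinearMap.comp
        ((innerSL ℂ w).restrictScalars ℝ)).hasFDerivAt
    simp_rw [inner_conj_symm] at h
    rw [delbar, h.fderiv]
    simp only [ContinuousLinearMap.comp_apply, ContinuousLinearMap.coe_restrictScalars',
      innerSL_apply_apply, ContinuousLinearEquiv.coe_coe, Complex.conjCLE_apply, inner_conj_symm,
      inner_smul_left, Complex.conj_I]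
    linear_combination (-(inner ℂ v w : ℂ) / 2) * Complex.I_mul_I
  have h4 : g z = inner ℂ z w / (‖z‖ ^ 2 : ℝ) := del_logSq hz w
  rw [h3, h4] at h2
  rw [eq_div_iff (pow_ne_zero 2 hN)]
  field_simp at h2
  linear_combination -h2

/-- The inequality `i∂h ∧ ∂̄h ≤ i∂∂̄ log ‖z‖²` for `h = |z_i|² / ‖z‖²`: both sides come from the
projective space, and `∂h(v)` is, up to a factor of modulus at most one, a coordinate of the
projection of `v / ‖z‖` to the orthogonal complement of `z`. -/
theorem norm_del_ratio_sq_le (i : Fin k) {z : Cn k} (hz : z ≠ 0) (v : Cn k) :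
    ‖del (fun y => (ratio i y : ℂ)) z v‖ ^ 2 ≤ (levi logSq z v v).re := by
  have hN : 0 < ‖z‖ ^ 2 := by positivity
  set N := ‖z‖ ^ 2 with hNdef
  rw [del_ratio i hz, levi_logSq hz]
  have hvv : (inner ℂ v v : ℂ) = ((‖v‖ ^ 2 : ℝ) : ℂ) := by
    rw [inner_self_eq_norm_sq_to_K]; norm_cast
  have hzv : (inner ℂ z v * inner ℂ v z : ℂ) = ((‖(inner ℂ z v : ℂ)‖ ^ 2 : ℝ) : ℂ) := by
    rw [← inner_conj_symm v z, Complex.mul_conj, Complex.normSq_eq_norm_sq]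
  rw [hvv, hzv, ← Complex.ofReal_mul, ← Complex.ofReal_sub, ← Complex.ofReal_pow,
    ← Complex.ofReal_div, Complex.ofReal_re, norm_div, Complex.norm_real, norm_mul,
    Complex.norm_conj, Real.norm_of_nonneg (by positivity), div_pow, mul_pow]
  -- the vector whose coordinate appears in `∂h(v)`
  set x : Cn k := (N : ℂ) • v - (inner ℂ z v : ℂ) • z with hx
  have hxi : v i * (N : ℂ) - z i * inner ℂ z v = x i := by
    simp [hx, mul_comm]
  have hxn : ‖x‖ ^ 2 = N * (‖v‖ ^ 2 * N - ‖(inner ℂ z v : ℂ)‖ ^ 2) := by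
    rw [hx, @norm_sub_sq ℂ, norm_smul, norm_smul, inner_smul_left, inner_smul_right,
      Complex.norm_real, Real.norm_of_nonneg hN.le, mul_pow, mul_pow, ← hNdef, Complex.conj_ofReal,
      hzv, ← Complex.ofReal_mul]
    simp only [RCLike.re_to_complex, Complex.ofReal_re]
    ring
  have h1 : ‖x i‖ ^ 2 ≤ ‖x‖ ^ 2 := pow_le_pow_left₀ (norm_nonneg _) (PiLp.norm_apply_le x i) 2
  have h2 : ‖z i‖ ^ 2 ≤ N := pow_le_pow_left₀ (norm_nonneg _) (PiLp.norm_apply_le z i) 2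
  rw [hxi, div_le_div_iff₀ (by positivity) (by positivity)]
  have h3 : ‖z i‖ ^ 2 * ‖x i‖ ^ 2 ≤ N * ‖x‖ ^ 2 :=
    mul_le_mul h2 h1 (by positivity) hN.le
  calc ‖z i‖ ^ 2 * ‖x i‖ ^ 2 * N ^ 2 ≤ (N * ‖x‖ ^ 2) * N ^ 2 :=
        mul_le_mul_of_nonneg_right h3 (by positivity)
    _ = (‖v‖ ^ 2 * N - ‖(inner ℂ z v : ℂ)‖ ^ 2) * (N ^ 2) ^ 2 := by rw [hxn]; ring

theorem norm_levi_logSq_le {z : Cn k} (hz : z ≠ 0) (v w : Cn k) :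
    ‖levi logSq z v w‖ * ‖z‖ ^ 2 ≤ 2 * ‖v‖ * ‖w‖ := by
  have hz' : 0 < ‖z‖ := norm_pos_iff.2 hz
  rw [levi_logSq hz, norm_div, norm_pow, Complex.norm_real, Real.norm_of_nonneg (by positivity),
    div_mul_eq_mul_div, div_le_iff₀ (by positivity)]
  have h1 := norm_inner_le_norm (𝕜 := ℂ) v w
  have h2 := norm_inner_le_norm (𝕜 := ℂ) z w
  have h3 := norm_inner_le_norm (𝕜 := ℂ) v z
  have h4 : ‖(inner ℂ v w * (‖z‖ ^ 2 : ℝ) - inner ℂ z w * inner ℂ v z : ℂ)‖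
      ≤ (‖v‖ * ‖w‖) * ‖z‖ ^ 2 + (‖z‖ * ‖w‖) * (‖v‖ * ‖z‖) := by
    refine (norm_sub_le _ _).trans ?_
    rw [norm_mul, norm_mul, Complex.norm_real, Real.norm_of_nonneg (by positivity)]
    gcongr
  calc _ ≤ ((‖v‖ * ‖w‖) * ‖z‖ ^ 2 + (‖z‖ * ‖w‖) * (‖v‖ * ‖z‖)) * ‖z‖ ^ 2 := by gcongr
    _ = _ := by ring

theorem norm_del_ratio_le (i : Fin k) {z : Cn k} (hz : z ≠ 0) (v : Cn k) :
    ‖del (fun y => (ratio i y : ℂ)) z v‖ * ‖z‖ ≤ 2 * ‖v‖ := by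
  have h1 := norm_del_ratio_sq_le i hz v
  have h2 := norm_levi_logSq_le hz v v
  have h3 := (Complex.re_le_norm (levi logSq z v v))
  refine le_of_sq_le_sq ?_ (by positivity)
  rw [mul_pow]
  nlinarith [norm_nonneg v, mul_le_mul_of_nonneg_right (h1.trans h3) (sq_nonneg ‖z‖)]

section Model

variable {a : Cn k}

/-- The function `|z_i - a_i|² / ‖z - a‖²`, cut off outside a ball. -/
def modelFun (i : Fin k) (β : ContDiffBump a) (z : Cn k) : ℝ := β z * ratio i (z - a)

/-- The potential `2 log ‖z - a‖²`, cut off outside a ball. -/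
def modelPot (β : ContDiffBump a) (z : Cn k) : ℝ := β z * (2 * logSq (z - a))

theorem contDiffAt_modelFun (i : Fin k) (β : ContDiffBump a) {z : Cn k} (hz : z ≠ a) :
    ContDiffAt ℝ ∞ (modelFun i β) z :=
  β.contDiffAt.mul ((contDiffAt_ratio i (sub_ne_zero.2 hz)).comp z
    (contDiffAt_id.sub contDiffAt_const))

theorem contDiffAt_modelPot (β : ContDiffBump a) {z : Cn k} (hz : z ≠ a) :
    ContDiffAt ℝ ∞ (modelPot β) z :=
  β.contDiffAt.mul (contDiffAt_const.mul (ContDiffAt.comp (g := logSq) (f := fun y => y - a) z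
    (contDiffAt_logSq (sub_ne_zero.2 hz)) (contDiffAt_id.sub contDiffAt_const)))

theorem abs_modelFun_le (i : Fin k) (β : ContDiffBump a) (z : Cn k) : |modelFun i β z| ≤ 1 := by
  rw [modelFun, abs_mul, abs_of_nonneg β.nonneg, abs_of_nonneg (ratio_nonneg i _)]
  exact mul_le_one₀ β.le_one (ratio_nonneg i _) (ratio_le_one i _)

theorem modelFun_eq_zero (i : Fin k) (β : ContDiffBump a) {z : Cn k}
    (hz : z ∉ Metric.closedBall a β.rOut) : modelFun i β z = 0 := by
  rw [modelFun, β.zero_of_le_dist, zero_mul]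
  exact (not_le.1 hz).le

theorem modelPot_eq_zero (β : ContDiffBump a) {z : Cn k}
    (hz : z ∉ Metric.closedBall a β.rOut) : modelPot β z = 0 := by
  rw [modelPot, β.zero_of_le_dist, zero_mul]
  exact (not_le.1 hz).le

theorem modelFun_eq (i : Fin k) (β : ContDiffBump a) {z : Cn k} (hz : z ∈ Metric.ball a β.rIn) :
    modelFun i β z = ratio i (z - a) := by
  rw [modelFun, β.one_of_mem_closedBall (Metric.ball_subset_closedBall hz), one_mul]

theorem del_modelFun (i : Fin k) (β : ContDiffBump a) {z : Cn k} (hz : z ∈ Metric.ball a β.rIn)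
    (hza : z ≠ a) (v : Cn k) : del (fun y => (modelFun i β y : ℂ)) z v =
      del (fun y => (ratio i y : ℂ)) (z - a) v := by
  have h : (fun y => (modelFun i β y : ℂ)) =ᶠ[𝓝 z] fun y => (ratio i (y - a) : ℂ) := by
    filter_upwards [Metric.isOpen_ball.mem_nhds hz] with y hy
    rw [modelFun_eq i β hy]
  have h2 : HasFDerivAt (fun y : Cn k => y - a) (ContinuousLinearMap.id ℂ (Cn k)) z :=
    (hasFDerivAt_id z).sub_const a
  rw [del_congr h, del_comp (f := fun y => (ratio i y : ℂ)) (ψ := fun y => y - a)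
    ((ContDiffAt.ofReal (contDiffAt_ratio i (sub_ne_zero.2 hza))).differentiableAt (by simp))
    h2.differentiableAt, h2.fderiv]
  rfl

theorem levi_modelPot (β : ContDiffBump a) {z : Cn k} (hz : z ∈ Metric.ball a β.rIn)
    (hza : z ≠ a) (v w : Cn k) : levi (modelPot β) z v w = 2 * levi logSq (z - a) v w := by
  have h : modelPot β =ᶠ[𝓝 z] fun y => (fun x => 2 * logSq x) (y - a) := by
    filter_upwards [Metric.isOpen_ball.mem_nhds hz] with y hy
    rw [modelPot, β.one_of_mem_closedBall (Metric.ball_subset_closedBall hy), one_mul]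
  have h2 : HasFDerivAt (fun y : Cn k => y - a) (ContinuousLinearMap.id ℂ (Cn k)) z :=
    (hasFDerivAt_id z).sub_const a
  have h3 := (contDiffAt_logSq (sub_ne_zero.2 hza)).of_le two_le_infty
  rw [levi_congr h, levi_comp (u := fun x => 2 * logSq x) (ψ := fun y => y - a)
    (contDiffAt_const.mul h3) (contDiffAt_id.sub contDiffAt_const), h2.fderiv]
  have h4 : fderiv ℝ (fun x : Cn k => 2 * logSq x) =ᶠ[𝓝 (z - a)]
      fun x => (2 : ℝ) • fderiv ℝ logSq x := by
    filter_upwards [eventually_contDiffAt (n := 2) h3] with y hy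
    exact fderiv_const_mul (hy.differentiableAt (by simp)) 2
  have h5 : fderiv ℝ (fderiv ℝ (fun x : Cn k => 2 * logSq x)) (z - a) =
      (2 : ℝ) • fderiv ℝ (fderiv ℝ logSq) (z - a) := by
    have h6 := (h3.fderiv_right (m := 1) (by norm_num)).differentiableAt (by simp)
    rw [h4.fderiv_eq, (h6.hasFDerivAt.fun_const_smul (2 : ℝ)).fderiv]
  simp only [levi_apply, h5, smul_apply, smul_eq_mul, ContinuousLinearMap.id_apply]
  push_cast
  ring

theorem two_mul_norm_del_modelFun_sq_le (i : Fin k) (β : ContDiffBump a) {z : Cn k}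
    (hz : z ∈ Metric.ball a β.rIn) (hza : z ≠ a) (v : Cn k) :
    2 * ‖del (fun y => (modelFun i β y : ℂ)) z v‖ ^ 2 ≤ (levi (modelPot β) z v v).re := by
  have h := norm_del_ratio_sq_le i (sub_ne_zero.2 hza) v
  rw [del_modelFun i β hz hza, levi_modelPot β hz hza]
  simp only [Complex.mul_re, Complex.re_ofNat, Complex.im_ofNat, zero_mul, sub_zero]
  linarith

theorem norm_del_modelFun_le (i : Fin k) (β : ContDiffBump a) {z : Cn k}
    (hz : z ∈ Metric.ball a β.rIn) (hza : z ≠ a) (v : Cn k) :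
    ‖del (fun y => (modelFun i β y : ℂ)) z v‖ * ‖z - a‖ ≤ 2 * ‖v‖ := by
  rw [del_modelFun i β hz hza]
  exact norm_del_ratio_le i (sub_ne_zero.2 hza) v

theorem norm_levi_modelPot_le (β : ContDiffBump a) {z : Cn k}
    (hz : z ∈ Metric.ball a β.rIn) (hza : z ≠ a) (v w : Cn k) :
    ‖levi (modelPot β) z v w‖ * ‖z - a‖ ^ 2 ≤ 4 * ‖v‖ * ‖w‖ := by
  have := norm_levi_logSq_le (sub_ne_zero.2 hza) v w
  rw [levi_modelPot β hz hza, norm_mul, Complex.norm_ofNat]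
  linarith

end Model

end

/-! ### Linear algebra of `(1,1)`-forms -/

section

open scoped ComplexOrder Matrix

variable {k : ℕ}

theorem sum_smul_single (v : Cn k) : v = ∑ i, v i • EuclideanSpace.single i (1 : ℂ) := by
  ext j
  simp [Finset.sum_apply, Pi.single_apply]

theorem sesqForm_apply (h : SesqForm (Cn k)) (v w : Cn k) :
    h v w = ∑ i, ∑ j, conj (v i) * coeff h i j * w j := by
  conv_lhs => rw [sum_smul_single v, sum_smul_single w]
  simp only [map_sum, LinearMap.sum_apply, map_smulₛₗ, LinearMap.smul_apply, smul_eq_mul, coeff,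
    Matrix.of_apply, RingHom.id_apply, Finset.mul_sum]
  rw [Finset.sum_comm]
  refine Finset.sum_congr rfl fun i _ => Finset.sum_congr rfl fun j _ => ?_
  ring

theorem sesqForm_apply_eq_dotProduct (h : SesqForm (Cn k)) (x y : Fin k → ℂ) :
    star x ⬝ᵥ (coeff h *ᵥ y) = h (WithLp.toLp 2 x) (WithLp.toLp 2 y) := by
  rw [sesqForm_apply]
  simp [dotProduct, Matrix.mulVec, Finset.mul_sum, mul_assoc]

theorem IsPosForm.apply_self_nonneg {h : SesqForm (Cn k)} (hh : IsPosForm h) (v : Cn k) :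
    0 ≤ h v v := by
  rw [Complex.nonneg_iff]
  refine ⟨hh.2 v, ?_⟩
  have := hh.1 v v
  rw [Complex.conj_eq_iff_im] at this
  exact this.symm

theorem isHermitian_coeff {h : SesqForm (Cn k)} (hh : ∀ v w, conj (h v w) = h w v) :
    (coeff h).IsHermitian := by
  ext i j
  simp only [coeff, Matrix.conjTranspose_apply, Matrix.of_apply]
  exact hh _ _

theorem IsPosForm.posSemidef {h : SesqForm (Cn k)} (hh : IsPosForm h) :
    (coeff h).PosSemidef := by
  refine .of_dotProduct_mulVec_nonneg (isHermitian_coeff hh.1) fun x => ?_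
  rw [sesqForm_apply_eq_dotProduct]
  exact hh.apply_self_nonneg _

/-- Positive definite Hermitian forms. -/
def IsPosDefForm (h : SesqForm (Cn k)) : Prop :=
  (∀ v w, conj (h v w) = h w v) ∧ ∀ v, v ≠ 0 → 0 < (h v v).re

theorem IsPosDefForm.isPosForm {h : SesqForm (Cn k)} (hh : IsPosDefForm h) : IsPosForm h := by
  refine ⟨hh.1, fun v => ?_⟩
  by_cases hv : v = 0
  · simp [hv]
  · exact (hh.2 v hv).le

theorem IsPosDefForm.posDef {h : SesqForm (Cn k)} (hh : IsPosDefForm h) :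
    (coeff h).PosDef := by
  refine .of_dotProduct_mulVec_pos (isHermitian_coeff hh.1) fun x hx => ?_
  rw [sesqForm_apply_eq_dotProduct, Complex.pos_iff]
  have hne : (WithLp.toLp 2 x : Cn k) ≠ 0 := fun h => hx (by
    have := congrArg WithLp.ofLp h
    simpa using this)
  exact ⟨hh.2 _ hne, (Complex.nonneg_iff.1 (hh.isPosForm.apply_self_nonneg _)).2⟩

theorem IsPosDefForm.volDensity_pos {h : SesqForm (Cn k)} (hh : IsPosDefForm h) :
    0 < volDensity h := by
  have := (Complex.pos_iff.1 hh.posDef.det_pos).1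
  exact mul_pos (by exact_mod_cast k.factorial_pos) this

open scoped MatrixOrder in
theorem trace_mul_nonneg {A B : Matrix (Fin k) (Fin k) ℂ} (hA : A.PosSemidef) (hB : B.PosSemidef) :
    0 ≤ (A * B).trace := by
  have h1 : CFC.sqrt B * CFC.sqrt B = B := CFC.sqrt_mul_sqrt_self B hB.nonneg
  have h2 : (CFC.sqrt B).IsHermitian := (Matrix.nonneg_iff_posSemidef.1 (CFC.sqrt_nonneg B)).1
  have h3 := (hA.mul_mul_conjTranspose_same (CFC.sqrt B)).trace_nonneg
  rw [h2.eq, Matrix.trace_mul_comm, ← Matrix.mul_assoc, h1, Matrix.trace_mul_comm] at h3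
  exact h3

theorem trace_nonneg {κ h : SesqForm (Cn k)} (hκ : IsPosDefForm κ) (hh : IsPosForm h) :
    0 ≤ trace κ h :=
  (Complex.nonneg_iff.1 (trace_mul_nonneg hκ.posDef.inv.posSemidef hh.posSemidef)).1

@[simp] theorem coeff_add (h h' : SesqForm (Cn k)) : coeff (h + h') = coeff h + coeff h' := rfl

@[simp] theorem coeff_smul (c : ℂ) (h : SesqForm (Cn k)) : coeff (c • h) = c • coeff h := rfl

theorem trace_add (κ h h' : SesqForm (Cn k)) : trace κ (h + h') = trace κ h + trace κ h' := by
  simp [trace, Matrix.mul_add]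

theorem trace_smul (κ h : SesqForm (Cn k)) (c : ℝ) : trace κ ((c : ℂ) • h) = c * trace κ h := by
  simp [trace]

theorem trace_self {κ : SesqForm (Cn k)} (hκ : IsPosDefForm κ) : trace κ κ = k := by
  rw [trace, Matrix.nonsing_inv_mul _ ((Matrix.isUnit_iff_isUnit_det _).1 hκ.posDef.isUnit)]
  simp

theorem IsPosForm.add {V : Type} [AddCommGroup V] [Module ℂ V] {h h' : SesqForm V}
    (hh : IsPosForm h) (hh' : IsPosForm h') : IsPosForm (h + h') := by
  refine ⟨fun v w => ?_, fun v => ?_⟩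
  · simp only [LinearMap.add_apply, map_add, hh.1, hh'.1]
  · simp only [LinearMap.add_apply, Complex.add_re]
    exact add_nonneg (hh.2 v) (hh'.2 v)

theorem IsPosForm.smul {V : Type} [AddCommGroup V] [Module ℂ V] {h : SesqForm V}
    (hh : IsPosForm h) {c : ℝ} (hc : 0 ≤ c) : IsPosForm ((c : ℂ) • h) := by
  refine ⟨fun v w => ?_, fun v => ?_⟩
  · simp only [LinearMap.smul_apply, smul_eq_mul, map_mul, hh.1, Complex.conj_ofReal]
  · simp only [LinearMap.smul_apply, smul_eq_mul, Complex.re_ofReal_mul]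
    exact mul_nonneg hc (hh.2 v)

@[simp] theorem pullback_apply {V W : Type} [AddCommGroup V] [Module ℂ V] [AddCommGroup W]
    [Module ℂ W] (h : SesqForm V) (D : W →ₗ[ℂ] V) (v w : W) : pullback h D v w = h (D v) (D w) :=
  rfl

theorem IsPosForm.pullback {V W : Type} [AddCommGroup V] [Module ℂ V] [AddCommGroup W]
    [Module ℂ W] {h : SesqForm V} (hh : IsPosForm h) (D : W →ₗ[ℂ] V) :
    IsPosForm (pullback h D) :=
  ⟨fun v w => hh.1 (D v) (D w), fun v => hh.2 (D v)⟩

theorem wedgeConj_apply {V : Type} [AddCommGroup V] [Module ℂ V] (α : V →ₗ[ℂ] ℂ) (v w : V) :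
    wedgeConj α v w = 2 * (conj (α v) * α w) := by
  simp [wedgeConj, mul_comm]

theorem wedgeConj_self_re {V : Type} [AddCommGroup V] [Module ℂ V] (α : V →ₗ[ℂ] ℂ) (v : V) :
    (wedgeConj α v v).re = 2 * ‖α v‖ ^ 2 := by
  rw [wedgeConj_apply, mul_comm (conj (α v)), Complex.mul_conj, Complex.normSq_eq_norm_sq]
  rw [Complex.mul_re]
  simp only [Complex.re_ofNat, Complex.ofReal_re, Complex.im_ofNat, zero_mul, sub_zero]

theorem isPosForm_wedgeConj {V : Type} [AddCommGroup V] [Module ℂ V] (α : V →ₗ[ℂ] ℂ) :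
    IsPosForm (wedgeConj α) := by
  refine ⟨fun v w => ?_, fun v => ?_⟩
  · simp only [wedgeConj_apply, map_mul, Complex.conj_conj, Complex.conj_ofNat]
    ring
  · rw [wedgeConj_self_re]; positivity

theorem trace_mono {κ h h' : SesqForm (Cn k)} (hκ : IsPosDefForm κ) (hd : IsPosForm (h' - h)) :
    trace κ h ≤ trace κ h' := by
  have := trace_nonneg hκ hd
  have h2 := trace_add κ (h' - h) h
  rw [sub_add_cancel] at h2
  linarith

theorem trace_wedgeConj_sub_le {κ : SesqForm (Cn k)} (hκ : IsPosDefForm κ) (α β : Cn k →ₗ[ℂ] ℂ) :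
    trace κ (wedgeConj (α - β)) ≤ 2 * trace κ (wedgeConj α) + 2 * trace κ (wedgeConj β) := by
  rw [← trace_smul, ← trace_smul, ← trace_add]
  refine trace_mono hκ ?_
  have : ((2 : ℝ) : ℂ) • wedgeConj α + ((2 : ℝ) : ℂ) • wedgeConj β - wedgeConj (α - β)
      = wedgeConj (α + β) := by
    ext v w
    simp only [LinearMap.sub_apply, LinearMap.add_apply, LinearMap.smul_apply, smul_eq_mul,
      wedgeConj_apply, map_add, map_sub]
    push_cast
    ring
  rw [this]
  exact isPosForm_wedgeConj _

/-! ### Pull-backs of forms and traces -/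

/-- The matrix of an endomorphism of `ℂᵏ` in the standard basis. -/
def mat (D : Cn k →ₗ[ℂ] Cn k) : Matrix (Fin k) (Fin k) ℂ :=
  LinearMap.toMatrix (EuclideanSpace.basisFun (Fin k) ℂ).toBasis
    (EuclideanSpace.basisFun (Fin k) ℂ).toBasis D

theorem mat_apply (D : Cn k →ₗ[ℂ] Cn k) (i j : Fin k) :
    mat D i j = D (EuclideanSpace.single j 1) i := by
  simp [mat, LinearMap.toMatrix_apply]

theorem det_mat (D : Cn k →ₗ[ℂ] Cn k) : (mat D).det = LinearMap.det D :=
  LinearMap.det_toMatrix _ _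

theorem coeff_pullback (h : SesqForm (Cn k)) (D : Cn k →ₗ[ℂ] Cn k) :
    coeff (pullback h D) = (mat D)ᴴ * coeff h * mat D := by
  ext i j
  simp only [coeff, Matrix.of_apply, pullback_apply]
  rw [sesqForm_apply, Matrix.mul_apply, Finset.sum_comm]
  refine Finset.sum_congr rfl fun l _ => ?_
  rw [Matrix.mul_apply, Finset.sum_mul]
  refine Finset.sum_congr rfl fun m _ => ?_
  simp only [Matrix.conjTranspose_apply, mat_apply, coeff, Matrix.of_apply, RCLike.star_def]

theorem volDensity_pullback (h : SesqForm (Cn k)) (D : Cn k →ₗ[ℂ] Cn k) :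
    volDensity (pullback h D) = ‖LinearMap.det D‖ ^ 2 * volDensity h := by
  have : ((mat D)ᴴ * coeff h * mat D).det = ((‖LinearMap.det D‖ ^ 2 : ℝ) : ℂ) * (coeff h).det := by
    rw [Matrix.det_mul, Matrix.det_mul, Matrix.det_conjTranspose, det_mat,
      ← Complex.normSq_eq_norm_sq, ← Complex.mul_conj]
    simp only [RCLike.star_def]
    ring
  rw [volDensity, volDensity, coeff_pullback, this, Complex.re_ofReal_mul]
  ring

theorem trace_pullback (κ h : SesqForm (Cn k)) {D : Cn k →ₗ[ℂ] Cn k} (hD : LinearMap.det D ≠ 0) :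
    trace (pullback κ D) (pullback h D) = trace κ h := by
  have hu : IsUnit (mat D).det := by rw [det_mat]; exact hD.isUnit
  have hu' : IsUnit ((mat D)ᴴ).det := by
    rw [Matrix.det_conjTranspose]; exact hu.star
  rw [trace, trace, coeff_pullback, coeff_pullback, Matrix.mul_inv_rev, Matrix.mul_inv_rev]
  congr 1
  have : (mat D)⁻¹ * ((coeff κ)⁻¹ * (mat D)ᴴ⁻¹) * ((mat D)ᴴ * coeff h * mat D) =
      (mat D)⁻¹ * ((coeff κ)⁻¹ * (((mat D)ᴴ⁻¹ * (mat D)ᴴ) * coeff h) * mat D) := by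
    simp only [Matrix.mul_assoc]
  rw [this, Matrix.nonsing_inv_mul _ hu', Matrix.one_mul, Matrix.trace_mul_comm, Matrix.mul_assoc,
    Matrix.mul_nonsing_inv _ hu, Matrix.mul_one]

theorem wedgeConj_comp {V W : Type} [AddCommGroup V] [Module ℂ V] [AddCommGroup W] [Module ℂ W]
    (α : V →ₗ[ℂ] ℂ) (D : W →ₗ[ℂ] V) : wedgeConj (α ∘ₗ D) = pullback (wedgeConj α) D := by
  ext v w
  simp [wedgeConj_apply]

/-! ### Comparison of traces and norms -/

/-- The trace with respect to the standard Hermitian form. -/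
def stdTrace (h : SesqForm (Cn k)) : ℝ := (coeff h).trace.re

theorem stdTrace_eq_sum (h : SesqForm (Cn k)) :
    (stdTrace h : ℝ) = ∑ j, (h (EuclideanSpace.single j 1) (EuclideanSpace.single j 1)).re := by
  simp [stdTrace, Matrix.trace, coeff]

theorem IsPosForm.stdTrace_nonneg {h : SesqForm (Cn k)} (hh : IsPosForm h) : 0 ≤ stdTrace h := by
  rw [stdTrace_eq_sum]
  exact Finset.sum_nonneg fun j _ => hh.2 _

theorem stdTrace_le_trace {κ h : SesqForm (Cn k)} (hh : IsPosForm h) {m : ℝ}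
    (hm : ((coeff κ)⁻¹ - (m : ℂ) • (1 : Matrix (Fin k) (Fin k) ℂ)).PosSemidef) :
    m * stdTrace h ≤ trace κ h := by
  have h1 := (Complex.nonneg_iff.1 (trace_mul_nonneg hm hh.posSemidef)).1
  rw [Matrix.sub_mul, Matrix.trace_sub, Complex.sub_re, Matrix.smul_mul, Matrix.one_mul,
    Matrix.trace_smul, smul_eq_mul, Complex.re_ofReal_mul] at h1
  rw [trace, stdTrace]
  linarith

theorem IsPosForm.norm_apply_le {V : Type} [AddCommGroup V] [Module ℂ V] {h : SesqForm V}
    (hh : IsPosForm h) (v w : V) : ‖h v w‖ ≤ ((h v v).re + (h w w).re) / 2 := by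
  -- positivity on `v - c w` for a suitable `c` of modulus one
  obtain ⟨c, hc, hcv⟩ : ∃ c : ℂ, ‖c‖ = 1 ∧ c * h v w = (‖h v w‖ : ℂ) := by
    by_cases h0 : h v w = 0
    · exact ⟨1, by simp, by simp [h0]⟩
    · have h1 : (‖h v w‖ : ℂ) ≠ 0 := by simpa using h0
      refine ⟨(‖h v w‖ : ℂ) / h v w, ?_, div_mul_cancel₀ _ h0⟩
      rw [norm_div, Complex.norm_real, norm_norm, div_self (by simpa using h0)]
  have h1 := hh.2 (v - c • w)
  have h2 : h w v = conj (h v w) := (hh.1 v w).symm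
  have h3 : conj c * conj (h v w) = (‖h v w‖ : ℂ) := by
    rw [← map_mul, hcv, Complex.conj_ofReal]
  have h4 : conj c * c = 1 := by
    rw [mul_comm, Complex.mul_conj, Complex.normSq_eq_norm_sq, hc]; simp
  have h5 : h (v - c • w) (v - c • w) = h v v + h w w - 2 * (‖h v w‖ : ℂ) := by
    simp only [map_sub, LinearMap.sub_apply, map_smulₛₗ, LinearMap.smul_apply, smul_eq_mul,
      RingHom.id_apply, h2]
    linear_combination (h w w) * h4 - hcv - h3
  rw [h5] at h1
  simp only [Complex.sub_re, Complex.add_re, Complex.mul_re, Complex.ofReal_re, Complex.re_ofNat,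
    Complex.im_ofNat, Complex.ofReal_im, zero_mul, sub_zero] at h1
  linarith

theorem IsPosForm.apply_self_le {h : SesqForm (Cn k)} (hh : IsPosForm h) (v : Cn k) :
    (h v v).re ≤ ‖v‖ ^ 2 * stdTrace h := by
  let x : Fin k → ℂ := fun i => v i
  have hpsd : (((‖v‖ ^ 2 : ℝ) : ℂ) • (1 : Matrix (Fin k) (Fin k) ℂ)
      - Matrix.vecMulVec x (star x)).PosSemidef := by
    refine .of_dotProduct_mulVec_nonneg ?_ fun y => ?_
    · refine Matrix.IsHermitian.sub ?_ (Matrix.posSemidef_vecMulVec_self_star x).1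
      rw [Matrix.IsHermitian, Matrix.conjTranspose_smul, Matrix.conjTranspose_one]
      simp
    · set y' : Cn k := WithLp.toLp 2 y
      have e1 : star y ⬝ᵥ y = ((‖y'‖ ^ 2 : ℝ) : ℂ) := by
        have := inner_self_eq_norm_sq_to_K (𝕜 := ℂ) y'
        rw [EuclideanSpace.inner_eq_star_dotProduct, dotProduct_comm] at this
        simpa using this
      have e2 : star y ⬝ᵥ x = inner ℂ y' v := by
        rw [EuclideanSpace.inner_eq_star_dotProduct, dotProduct_comm]
      have e3 : star x ⬝ᵥ y = inner ℂ v y' := by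
        rw [EuclideanSpace.inner_eq_star_dotProduct, dotProduct_comm]
      rw [Matrix.sub_mulVec, Matrix.smul_mulVec, Matrix.one_mulVec, Matrix.vecMulVec_mulVec,
        dotProduct_sub, dotProduct_smul, dotProduct_smul, e1, e2, e3, ← inner_conj_symm y' v]
      simp only [MulOpposite.smul_eq_mul_unop, MulOpposite.unop_op, smul_eq_mul]
      rw [mul_comm (conj _), Complex.mul_conj, Complex.normSq_eq_norm_sq, ← Complex.ofReal_mul,
        ← Complex.ofReal_sub]
      rw [Complex.zero_le_real, sub_nonneg, ← mul_pow]
      exact pow_le_pow_left₀ (norm_nonneg _) (norm_inner_le_norm v y') 2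
  have h1 := (Complex.nonneg_iff.1 (trace_mul_nonneg hpsd hh.posSemidef)).1
  have h2 : (Matrix.vecMulVec x (star x) * coeff h).trace = h v v := by
    rw [Matrix.trace_mul_comm, Matrix.mul_vecMulVec, Matrix.trace_vecMulVec, dotProduct_comm,
      sesqForm_apply_eq_dotProduct]
  rw [Matrix.sub_mul, Matrix.trace_sub, Complex.sub_re, Matrix.smul_mul, Matrix.one_mul,
    Matrix.trace_smul, smul_eq_mul, Complex.re_ofReal_mul, h2] at h1
  rw [stdTrace]
  linarith

theorem isPosDefForm_flatForm {c : ℝ} (hc : 0 < c) : IsPosDefForm (flatForm k c) := by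
  have h : 0 < 2 * c / Real.pi := by positivity
  refine ⟨fun v w => ?_, fun v hv => ?_⟩
  · simp only [flatForm, LinearMap.smul_apply, smul_eq_mul, map_mul, Complex.conj_ofReal,
      innerₛₗ_apply_apply, inner_conj_symm]
  · simp only [flatForm, LinearMap.smul_apply, smul_eq_mul, Complex.re_ofReal_mul,
      innerₛₗ_apply_apply]
    rw [inner_self_eq_norm_sq_to_K]
    have : 0 < ‖v‖ := norm_pos_iff.2 hv
    refine mul_pos h ?_
    change 0 < (((‖v‖ : ℝ) : ℂ) ^ 2).re
    rw [← Complex.ofReal_pow, Complex.ofReal_re]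
    positivity

/-! ### Traces with respect to a continuous metric -/

theorem continuousOn_coeff {Ω : Set (Cn k)} {θ : Cn k → SesqForm (Cn k)}
    (hθ : ∀ v w, ContinuousOn (fun z => θ z v w) Ω) : ContinuousOn (fun z => coeff (θ z)) Ω := by
  have h : ContinuousOn (fun z (i j : Fin k) =>
      θ z (EuclideanSpace.single i 1) (EuclideanSpace.single j 1)) Ω :=
    continuousOn_pi.2 fun _ => continuousOn_pi.2 fun _ => hθ _ _
  exact h

theorem continuousOn_volDensity {Ω : Set (Cn k)} {κ : Cn k → SesqForm (Cn k)}
    (hκ : ∀ v w, ContinuousOn (fun z => κ z v w) Ω) : ContinuousOn (fun z => volDensity (κ z)) Ω :=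
  continuousOn_const.mul (Complex.continuous_re.comp_continuousOn
    ((continuous_id (X := Matrix (Fin k) (Fin k) ℂ)).matrix_det.comp_continuousOn
      (continuousOn_coeff hκ)))

theorem continuousOn_coeff_inv {Ω : Set (Cn k)} {κ : Cn k → SesqForm (Cn k)}
    (hκ : ∀ v w, ContinuousOn (fun z => κ z v w) Ω) (hpos : ∀ z ∈ Ω, IsPosDefForm (κ z)) :
    ContinuousOn (fun z => (coeff (κ z))⁻¹) Ω := by
  have h1 : ContinuousOn (fun z => (coeff (κ z)).det) Ω :=
    (continuous_id (X := Matrix (Fin k) (Fin k) ℂ)).matrix_det.comp_continuousOn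
      (continuousOn_coeff hκ)
  have h2 : ContinuousOn (fun z => (coeff (κ z)).adjugate) Ω :=
    (continuous_id (X := Matrix (Fin k) (Fin k) ℂ)).matrix_adjugate.comp_continuousOn
      (continuousOn_coeff hκ)
  have h3 := (h1.inv₀ fun z hz => (hpos z hz).posDef.det_pos.ne').smul h2
  simp only [Matrix.inv_def, Ring.inverse_eq_inv']
  exact h3

theorem trace_eq_sum (κ h : SesqForm (Cn k)) : trace κ h =
    ∑ i, ∑ j, ((coeff κ)⁻¹ i j * h (EuclideanSpace.single j 1) (EuclideanSpace.single i 1)).re := by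
  simp [trace, Matrix.trace, Matrix.mul_apply, coeff, Complex.re_sum]

theorem aestronglyMeasurable_trace {Ω : Set (Cn k)} (hΩ : MeasurableSet Ω) {μ : Measure (Cn k)}
    {κ θ : Cn k → SesqForm (Cn k)}
    (hκ : ∀ v w, ContinuousOn (fun z => κ z v w) Ω) (hpos : ∀ z ∈ Ω, IsPosDefForm (κ z))
    (hθ : ∀ v w, AEStronglyMeasurable (fun z => θ z v w) (μ.restrict Ω)) :
    AEStronglyMeasurable (fun z => trace (κ z) (θ z)) (μ.restrict Ω) := by
  simp only [trace_eq_sum]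
  have h := continuousOn_coeff_inv hκ hpos
  refine Finset.aestronglyMeasurable_fun_sum _ fun i _ =>
    Finset.aestronglyMeasurable_fun_sum _ fun j _ => ?_
  exact Complex.continuous_re.comp_aestronglyMeasurable
    (((continuousOn_pi.1 (continuousOn_pi.1 h i) j).aestronglyMeasurable hΩ).mul (hθ _ _))

theorem exists_norm_sq_le_dotProduct {K : Set (Cn k)} (hK : IsCompact K)
    {M : Cn k → Matrix (Fin k) (Fin k) ℂ} (hM : ContinuousOn M K)
    (hpos : ∀ z ∈ K, (M z).PosDef) :
    ∃ m : ℝ, 0 < m ∧ ∀ z ∈ K, ∀ v : Cn k,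
      m * ‖v‖ ^ 2 ≤ (star v.ofLp ⬝ᵥ (M z *ᵥ v.ofLp)).re := by
  by_cases hne : (K ×ˢ Metric.sphere (0 : Cn k) 1).Nonempty
  · have hc : ContinuousOn (fun p : Cn k × Cn k => (star p.2.ofLp ⬝ᵥ (M p.1 *ᵥ p.2.ofLp)).re)
        (K ×ˢ Metric.sphere (0 : Cn k) 1) := by
      have h1 : ContinuousOn (fun p : Cn k × Cn k => M p.1) (K ×ˢ Metric.sphere (0 : Cn k) 1) :=
        hM.comp continuousOn_fst fun p hp => hp.1
      have h2 : ∀ i j, ContinuousOn (fun p : Cn k × Cn k => M p.1 i j)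
          (K ×ˢ Metric.sphere (0 : Cn k) 1) := fun i j =>
        continuousOn_pi.1 (continuousOn_pi.1 h1 i) j
      refine Complex.continuous_re.comp_continuousOn ?_
      simp only [dotProduct, Matrix.mulVec]
      refine continuousOn_finsetSum _ fun i _ => ContinuousOn.mul ?_
        (continuousOn_finsetSum _ fun j _ => (h2 i j).mul ?_)
      · have : Continuous fun p : Cn k × Cn k => star (p.2.ofLp i) := by fun_prop
        exact this.continuousOn
      · fun_prop
    obtain ⟨p, hp, hmin⟩ := (hK.prod (isCompact_sphere 0 1)).exists_isMinOn hne hc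
    have hp2 : p.2.ofLp ≠ 0 := fun h => by
      have h1 : ‖p.2‖ = 1 := by simpa using hp.2
      have h2 : p.2 = 0 := by ext i; simpa using congrFun h i
      simp [h2] at h1
    refine ⟨_, (Complex.pos_iff.1 ((hpos p.1 hp.1).dotProduct_mulVec_pos hp2)).1,
      fun z hz v => ?_⟩
    by_cases hv : v = 0
    · simp [hv]
    · have hv' : 0 < ‖v‖ := norm_pos_iff.2 hv
      set u : Cn k := ((‖v‖⁻¹ : ℝ) : ℂ) • v with hu
      have hu1 : ‖u‖ = 1 := by
        rw [hu, norm_smul, Complex.norm_real, norm_inv, norm_norm, inv_mul_cancel₀ hv'.ne']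
      have h1 := hmin (show (z, u) ∈ K ×ˢ Metric.sphere (0 : Cn k) 1 from ⟨hz, by simpa using hu1⟩)
      simp only [mem_ofPred_eq] at h1
      have h2 : v = ((‖v‖ : ℝ) : ℂ) • u := by
        rw [hu, smul_smul, ← Complex.ofReal_mul, mul_inv_cancel₀ hv'.ne', Complex.ofReal_one,
          one_smul]
      have h3 : star v.ofLp ⬝ᵥ (M z *ᵥ v.ofLp) =
          ((‖v‖ ^ 2 : ℝ) : ℂ) * (star u.ofLp ⬝ᵥ (M z *ᵥ u.ofLp)) := by
        conv_lhs => rw [h2]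
        rw [WithLp.ofLp_smul, star_smul, Matrix.mulVec_smul, smul_dotProduct, dotProduct_smul]
        simp only [RCLike.star_def, Complex.conj_ofReal, smul_eq_mul]
        push_cast
        ring
      rw [h3, Complex.re_ofReal_mul, mul_comm]
      exact mul_le_mul_of_nonneg_left h1 (by positivity)
  · refine ⟨1, one_pos, fun z hz v => ?_⟩
    have hv : v = 0 := by
      by_contra hv
      refine hne ⟨(z, ((‖v‖⁻¹ : ℝ) : ℂ) • v), hz, ?_⟩
      have hv' : 0 < ‖v‖ := norm_pos_iff.2 hv
      rw [mem_sphere_zero_iff_norm, norm_smul, Complex.norm_real, norm_inv, norm_norm,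
        inv_mul_cancel₀ hv'.ne']
    simp [hv]

/-- On a compact set, the trace with respect to `κ` dominates the standard one. -/
theorem exists_stdTrace_le_trace {K : Set (Cn k)} (hK : IsCompact K) {κ : Cn k → SesqForm (Cn k)}
    (hκ : ∀ v w, ContinuousOn (fun z => κ z v w) K) (hpos : ∀ z ∈ K, IsPosDefForm (κ z)) :
    ∃ m : ℝ, 0 < m ∧ ∀ z ∈ K, ∀ h, IsPosForm h → m * stdTrace h ≤ trace (κ z) h := by
  obtain ⟨m, hm, hb⟩ := exists_norm_sq_le_dotProduct hK (continuousOn_coeff_inv hκ hpos)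
    fun z hz => (hpos z hz).posDef.inv
  refine ⟨m, hm, fun z hz h hh => stdTrace_le_trace hh ?_⟩
  have hinv := (hpos z hz).posDef.inv
  refine .of_dotProduct_mulVec_nonneg ?_ fun x => ?_
  · refine hinv.1.sub ?_
    rw [Matrix.IsHermitian, Matrix.conjTranspose_smul, Matrix.conjTranspose_one]
    simp
  · have e1 : star x ⬝ᵥ x = ((‖(WithLp.toLp 2 x : Cn k)‖ ^ 2 : ℝ) : ℂ) := by
      have := inner_self_eq_norm_sq_to_K (𝕜 := ℂ) (WithLp.toLp 2 x : Cn k)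
      rw [EuclideanSpace.inner_eq_star_dotProduct, dotProduct_comm] at this
      simpa using this
    have h1 := hb z hz (WithLp.toLp 2 x)
    have h2 := Complex.nonneg_iff.1 (hinv.posSemidef.dotProduct_mulVec_nonneg x)
    rw [Matrix.sub_mulVec, Matrix.smul_mulVec, Matrix.one_mulVec, dotProduct_sub,
      dotProduct_smul, e1, smul_eq_mul, ← Complex.ofReal_mul, Complex.nonneg_iff]
    refine ⟨?_, ?_⟩
    · rw [Complex.sub_re, Complex.ofReal_re, sub_nonneg]
      exact h1
    · rw [Complex.sub_im, Complex.ofReal_im, sub_zero]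
      exact h2.2

/-- On a compact set, `κ` dominates the standard Hermitian form. -/
theorem exists_norm_sq_le {K : Set (Cn k)} (hK : IsCompact K) {κ : Cn k → SesqForm (Cn k)}
    (hκ : ∀ v w, ContinuousOn (fun z => κ z v w) K) (hpos : ∀ z ∈ K, IsPosDefForm (κ z)) :
    ∃ m : ℝ, 0 < m ∧ ∀ z ∈ K, ∀ v, m * ‖v‖ ^ 2 ≤ (κ z v v).re := by
  obtain ⟨m, hm, hb⟩ := exists_norm_sq_le_dotProduct hK (continuousOn_coeff hκ)
    fun z hz => (hpos z hz).posDef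
  refine ⟨m, hm, fun z hz v => ?_⟩
  have := hb z hz v
  rwa [sesqForm_apply_eq_dotProduct] at this

end

/-! ### Positive closed currents: integrability and the growth of the mass on small balls -/

section

variable {k : ℕ} {Ω : Set (Cn k)} {κ : Cn k → SesqForm (Cn k)}

/-- A continuous positive definite form on `Ω`. -/
structure IsMetricOn (Ω : Set (Cn k)) (κ : Cn k → SesqForm (Cn k)) : Prop where
  continuousOn : ∀ v w, ContinuousOn (fun z => κ z v w) Ω
  pos : ∀ z ∈ Ω, IsPosDefForm (κ z)

theorem IsMetricOn.volDensity_pos (hκ : IsMetricOn Ω κ) {z : Cn k} (hz : z ∈ Ω) :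
    0 < volDensity (κ z) := (hκ.pos z hz).volDensity_pos

/-- The density, with respect to `T.μ`, of the trace of the coefficients of `T` in the standard
coordinates. -/
def CurrentOn.traceDensity (T : CurrentOn Ω κ) (z : Cn k) : ℝ :=
  stdTrace (T.θ z) / volDensity (κ z)

theorem CurrentOn.traceDensity_nonneg (hκ : IsMetricOn Ω κ) (T : CurrentOn Ω κ) {z : Cn k}
    (hz : z ∈ Ω) : 0 ≤ T.traceDensity z :=
  div_nonneg (T.pos z hz).stdTrace_nonneg (hκ.volDensity_pos hz).le

theorem CurrentOn.mass_nonneg (hκ : IsMetricOn Ω κ) (hΩ : IsOpen Ω) (T : CurrentOn Ω κ) :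
    0 ≤ T.mass :=
  mul_nonneg (by positivity) (setIntegral_nonneg hΩ.measurableSet fun z hz =>
    trace_nonneg (hκ.pos z hz) (T.pos z hz))

theorem CurrentOn.aestronglyMeasurable_apply (hκ : IsMetricOn Ω κ) (hΩ : IsOpen Ω)
    (T : CurrentOn Ω κ) (v w : Cn k) :
    AEStronglyMeasurable (fun z => T.θ z v w / (volDensity (κ z) : ℂ)) (T.μ.restrict Ω) := by
  have h1 := (T.meas v w).aestronglyMeasurable
  have h2 : AEStronglyMeasurable (fun z => ((volDensity (κ z) : ℝ) : ℂ)⁻¹) (T.μ.restrict Ω) := by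
    refine ContinuousOn.aestronglyMeasurable (ContinuousOn.inv₀ ?_ fun z hz => ?_) hΩ.measurableSet
    · exact Complex.continuous_ofReal.comp_continuousOn (continuousOn_volDensity hκ.continuousOn)
    · exact_mod_cast (hκ.volDensity_pos hz).ne'
  simp only [div_eq_mul_inv]
  exact h1.mul h2

theorem CurrentOn.traceDensity_eq_sum (T : CurrentOn Ω κ) (z : Cn k) :
    T.traceDensity z = ∑ j, (T.θ z (EuclideanSpace.single j 1) (EuclideanSpace.single j 1) /
      (volDensity (κ z) : ℂ)).re := by
  simp [CurrentOn.traceDensity, stdTrace_eq_sum, Finset.sum_div]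

/-- The standard trace of a current is locally bounded by its mass. -/
theorem exists_setIntegral_traceDensity_le (hk : 0 < k) (hκ : IsMetricOn Ω κ) (hΩ : IsOpen Ω)
    {K : Set (Cn k)} (hK : IsCompact K) (hKΩ : K ⊆ Ω) :
    ∃ C : ℝ, 0 < C ∧ ∀ T : CurrentOn Ω κ, IntegrableOn T.traceDensity K T.μ ∧
      ∫ z in K, T.traceDensity z ∂T.μ ≤ C * T.mass := by
  obtain ⟨m, hm, hmb⟩ := exists_stdTrace_le_trace hK (fun v w => (hκ.continuousOn v w).mono hKΩ)
    fun z hz => hκ.pos z (hKΩ hz)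
  obtain ⟨c, hc, hcb⟩ : ∃ c : ℝ, 0 < c ∧ ∀ z ∈ K, c ≤ volDensity (κ z) := by
    by_cases hne : K.Nonempty
    · obtain ⟨z, hz, hmin⟩ := hK.exists_isMinOn hne
        ((continuousOn_volDensity hκ.continuousOn).mono hKΩ)
      exact ⟨_, hκ.volDensity_pos (hKΩ hz), fun y hy => hmin hy⟩
    · exact ⟨1, one_pos, fun z hz => (hne ⟨z, hz⟩).elim⟩
  refine ⟨(m * c)⁻¹ * k, by positivity, fun T => ?_⟩
  have hle : ∀ z ∈ K, T.traceDensity z ≤ (m * c)⁻¹ * trace (κ z) (T.θ z) := by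
    intro z hz
    have h1 := hmb z hz _ (T.pos z (hKΩ hz))
    have h2 := hcb z hz
    have h3 := (T.pos z (hKΩ hz)).stdTrace_nonneg
    rw [CurrentOn.traceDensity, div_le_iff₀ (hc.trans_le h2), mul_inv]
    have h4 : stdTrace (T.θ z) ≤ m⁻¹ * trace (κ z) (T.θ z) := by
      rw [inv_mul_eq_div, le_div_iff₀ hm]; linarith
    have h5 : 1 ≤ c⁻¹ * volDensity (κ z) := by
      rw [inv_mul_eq_div, le_div_iff₀ hc]; linarith
    calc stdTrace (T.θ z) ≤ m⁻¹ * trace (κ z) (T.θ z) := h4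
      _ ≤ (m⁻¹ * trace (κ z) (T.θ z)) * (c⁻¹ * volDensity (κ z)) :=
        le_mul_of_one_le_right (h3.trans h4) h5
      _ = _ := by ring
  have hint := (T.finite_mass.mono_set hKΩ).const_mul (m * c)⁻¹
  have hI : IntegrableOn T.traceDensity K T.μ := by
    refine Integrable.mono' hint ?_ ?_
    · have h : T.traceDensity = fun z => ∑ j, (T.θ z (EuclideanSpace.single j 1)
          (EuclideanSpace.single j 1) / (volDensity (κ z) : ℂ)).re :=
        funext fun z => T.traceDensity_eq_sum z
      rw [h]
      exact Finset.aestronglyMeasurable_fun_sum _ fun j _ =>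
        Complex.continuous_re.comp_aestronglyMeasurable
          ((T.aestronglyMeasurable_apply hκ hΩ _ _).mono_measure
            (Measure.restrict_mono hKΩ le_rfl))
    · filter_upwards [ae_restrict_mem hK.measurableSet] with z hz
      rw [Real.norm_of_nonneg (T.traceDensity_nonneg hκ (hKΩ hz))]
      exact hle z hz
  refine ⟨hI, ?_⟩
  have h1 : ∫ z in K, T.traceDensity z ∂T.μ ≤ ∫ z in K, (m * c)⁻¹ * trace (κ z) (T.θ z) ∂T.μ :=
    setIntegral_mono_on hI hint hK.measurableSet hle
  have h2 : ∫ z in K, trace (κ z) (T.θ z) ∂T.μ ≤ ∫ z in Ω, trace (κ z) (T.θ z) ∂T.μ := by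
    refine setIntegral_mono_set T.finite_mass ?_ (LE.le.eventuallyLE hKΩ)
    filter_upwards [ae_restrict_mem hΩ.measurableSet] with z hz
    exact trace_nonneg (hκ.pos z hz) (T.pos z hz)
  rw [integral_const_mul] at h1
  refine h1.trans ?_
  have hk' : (k : ℝ) ≠ 0 := by positivity
  rw [CurrentOn.mass, mul_assoc, ← mul_assoc (k : ℝ), mul_one_div_cancel hk', one_mul]
  exact mul_le_mul_of_nonneg_left h2 (by positivity)

theorem CurrentOn.integrableOn_traceDensity (hk : 0 < k) (hκ : IsMetricOn Ω κ) (hΩ : IsOpen Ω)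
    (T : CurrentOn Ω κ) {K : Set (Cn k)} (hK : IsCompact K) (hKΩ : K ⊆ Ω) :
    IntegrableOn T.traceDensity K T.μ := by
  obtain ⟨C, -, hC⟩ := exists_setIntegral_traceDensity_le hk hκ hΩ hK hKΩ
  exact (hC T).1

theorem CurrentOn.norm_apply_div_le (hκ : IsMetricOn Ω κ) (T : CurrentOn Ω κ) {z : Cn k}
    (hz : z ∈ Ω) (v w : Cn k) : ‖T.θ z v w / (volDensity (κ z) : ℂ)‖ ≤
      (‖v‖ ^ 2 + ‖w‖ ^ 2) / 2 * T.traceDensity z := by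
  have hp := T.pos z hz
  have hd := hκ.volDensity_pos hz
  rw [norm_div, Complex.norm_real, Real.norm_of_nonneg hd.le, CurrentOn.traceDensity, ← mul_div_assoc]
  refine div_le_div_of_nonneg_right ((hp.norm_apply_le v w).trans ?_) hd.le
  have h1 := hp.apply_self_le v
  have h2 := hp.apply_self_le w
  linarith

theorem CurrentOn.integrable_mul (hk : 0 < k) (hκ : IsMetricOn Ω κ) (hΩ : IsOpen Ω)
    (T : CurrentOn Ω κ) {χ : Cn k → ℂ} (hχ : Continuous χ) (hc : HasCompactSupport χ)
    (hs : tsupport χ ⊆ Ω) (v w : Cn k) :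
    Integrable (fun z => χ z * (T.θ z v w / (volDensity (κ z) : ℂ))) T.μ := by
  have h1 : IntegrableOn (fun z => T.θ z v w / (volDensity (κ z) : ℂ)) (tsupport χ) T.μ := by
    refine Integrable.mono' ((T.integrableOn_traceDensity hk hκ hΩ hc hs).const_mul
      ((‖v‖ ^ 2 + ‖w‖ ^ 2) / 2)) ((T.aestronglyMeasurable_apply hκ hΩ v w).mono_measure
      (Measure.restrict_mono hs le_rfl)) ?_
    filter_upwards [ae_restrict_mem (isClosed_tsupport χ).measurableSet] with z hz
    exact T.norm_apply_div_le hκ (hs hz) v w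
  have h2 : IntegrableOn (fun z => χ z * (T.θ z v w / (volDensity (κ z) : ℂ))) (tsupport χ) T.μ :=
    h1.continuousOn_mul hχ.continuousOn hc
  refine (integrableOn_iff_integrable_of_support_subset fun z hz => ?_).1 h2
  exact subset_tsupport χ (left_ne_zero_of_mul hz)

theorem del_radial {q : ℝ → ℝ} {q' : ℝ} {a z : Cn k} (hq : HasDerivAt q q' (‖z - a‖ ^ 2))
    (v : Cn k) : del (fun y => ((q (‖y - a‖ ^ 2) : ℝ) : ℂ)) z v = q' * inner ℂ (z - a) v := by
  have h0 : HasFDerivAt (fun y : Cn k => ‖y - a‖ ^ 2) (fderiv ℝ (fun y : Cn k => ‖y‖ ^ 2) (z - a))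
      z := by
    have h1 := ((contDiff_norm_sq (k := k)).contDiffAt.differentiableAt (x := z - a)
      (by simp)).hasFDerivAt
    exact h1.comp z ((hasFDerivAt_id z).sub_const a)
  have h2 := hq.comp_hasFDerivAt z h0
  have h3 := del_norm_sq (z - a) v
  rw [del_ofReal (contDiff_norm_sq.contDiffAt.differentiableAt (by simp))] at h3
  have h4 : fderiv ℝ (fun y : Cn k => q (‖y - a‖ ^ 2)) z = _ := h2.fderiv
  rw [del_ofReal (f := fun y : Cn k => q (‖y - a‖ ^ 2)) h2.differentiableAt, ← h3, h4]
  simp only [smul_apply, smul_eq_mul]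
  push_cast
  ring

/-- Closedness of a current tested against the functions `q(‖z - a‖²) (z - a)_m`. -/
theorem CurrentOn.integral_radial_eq_zero (hk : 0 < k) (hκ : IsMetricOn Ω κ) (hΩ : IsOpen Ω)
    (T : CurrentOn Ω κ) (hT : IsClosedOn Ω κ T.θ T.μ) {a : Cn k} {q q' : ℝ → ℝ} {R : ℝ}
    (hR : Metric.closedBall a R ⊆ Ω) (hR0 : 0 ≤ R)
    (hsm : ContDiff ℝ ∞ (fun z : Cn k => q (‖z - a‖ ^ 2)))
    (hq : ∀ t, 0 ≤ t → HasDerivAt q (q' t) t) (hq0 : ∀ t, R ^ 2 ≤ t → q t = 0) :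
    Integrable (fun z => (((((k : ℝ) - 1) * q (‖z - a‖ ^ 2) + ‖z - a‖ ^ 2 * q' (‖z - a‖ ^ 2)) *
      T.traceDensity z)
        - q' (‖z - a‖ ^ 2) * ((T.θ z (z - a) (z - a)).re / volDensity (κ z)))) T.μ ∧
    ∫ z, (((((k : ℝ) - 1) * q (‖z - a‖ ^ 2) + ‖z - a‖ ^ 2 * q' (‖z - a‖ ^ 2)) * T.traceDensity z)
      - q' (‖z - a‖ ^ 2) * ((T.θ z (z - a) (z - a)).re / volDensity (κ z))) ∂T.μ = 0 := by
  let e : Fin k → Cn k := fun j => EuclideanSpace.single j 1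
  let Q : Cn k → ℂ := fun z => ((q (‖z - a‖ ^ 2) : ℝ) : ℂ)
  let χ : Fin k → Cn k → ℂ := fun m z => Q z * (z - a) m
  have hQ : ContDiff ℝ ∞ Q := Complex.ofRealCLM.contDiff.comp hsm
  have hco : ∀ m, ContDiff ℝ ∞ fun z : Cn k => (z - a) m := fun m =>
    (contDiff_coord m).comp (contDiff_id.sub contDiff_const)
  have hχsm : ∀ m, ContDiff ℝ ∞ (χ m) := fun m => hQ.mul (hco m)
  have hQs : tsupport Q ⊆ Metric.closedBall a R := by
    refine closure_minimal (fun z hz => ?_) Metric.isClosed_closedBall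
    by_contra hcon
    rw [Metric.mem_closedBall, dist_eq_norm, not_le] at hcon
    exact hz (by simp only [Q]; rw [hq0 _ (pow_le_pow_left₀ hR0 hcon.le 2)]; simp)
  have hQc : HasCompactSupport Q :=
    HasCompactSupport.intro (isCompact_closedBall a R) fun z hz =>
      image_eq_zero_of_notMem_tsupport fun h => hz (hQs h)
  have htest : ∀ m, IsTest Ω (χ m) := fun m =>
    ⟨hχsm m, hQc.mul_right, (tsupport_mul_subset_left.trans hQs).trans hR⟩
  have hdel : ∀ m j z, del (χ m) z (e j) =
      (q' (‖z - a‖ ^ 2) : ℂ) * conj ((z - a) j) * (z - a) m + if j = m then Q z else 0 := by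
    intro m j z
    rw [del_mul (hQ.contDiffAt.differentiableAt (by simp))
      ((hco m).contDiffAt.differentiableAt (by simp)), del_radial (hq _ (by positivity))]
    have h1 : del (fun y : Cn k => (y - a) m) z (e j) = if j = m then 1 else 0 := by
      have h2 : HasFDerivAt (fun y : Cn k => (y - a) m)
          ((EuclideanSpace.proj (𝕜 := ℂ) m).restrictScalars ℝ) z :=
        HasFDerivAt.comp (g := fun y : Cn k => y m) (f := fun y : Cn k => y - a) z
          (hasFDerivAt_coord m (z - a)) ((hasFDerivAt_id z).sub_const a)
      rw [del, h2.fderiv]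
      by_cases hjm : j = m
      · subst hjm
        simp [e]
      · simp [e, hjm, Ne.symm hjm]
    rw [h1]
    have h3 : (inner ℂ (z - a) (e j) : ℂ) = conj ((z - a) j) := by
      simp [e, EuclideanSpace.inner_single_right]
    rw [h3]
    split_ifs <;> ring
  have hint : ∀ m j u w, Integrable (fun z => del (χ m) z (e j) *
      (T.θ z u w / (volDensity (κ z) : ℂ))) T.μ := fun m j u w =>
    T.integrable_mul hk hκ hΩ (ContDiff.del (hχsm m) _).continuous
      (hasCompactSupport_del (htest m).2.1 _) ((tsupport_del_subset _ _).trans (htest m).2.2) u w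
  have hI : ∀ j m, Integrable (fun z =>
      del (χ m) z (e m) * (T.θ z (e j) (e j) / (volDensity (κ z) : ℂ))
        - del (χ m) z (e j) * (T.θ z (e j) (e m) / (volDensity (κ z) : ℂ))) T.μ := fun j m =>
    (hint m m (e j) (e j)).sub (hint m j (e j) (e m))
  have hz : ∫ z, ∑ j, ∑ m, (del (χ m) z (e m) * (T.θ z (e j) (e j) / (volDensity (κ z) : ℂ))
      - del (χ m) z (e j) * (T.θ z (e j) (e m) / (volDensity (κ z) : ℂ))) ∂T.μ = 0 := by
    rw [integral_finsetSum _ fun j _ => integrable_finsetSum _ fun m _ => hI j m]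
    refine Finset.sum_eq_zero fun j _ => ?_
    rw [integral_finsetSum _ fun m _ => hI j m]
    refine Finset.sum_eq_zero fun m _ => ?_
    rw [integral_sub (hint m m _ _) (hint m j _ _), sub_eq_zero]
    exact hT (χ m) (htest m) (e m) (e j) (e j)
  have hre := congrArg Complex.re hz
  have hIsum := integrable_finsetSum (μ := T.μ) Finset.univ
    fun j (_ : j ∈ Finset.univ) => integrable_finsetSum Finset.univ
      fun m (_ : m ∈ Finset.univ) => hI j m
  have hre2 := integral_re (𝕜 := ℂ) hIsum
  rw [← RCLike.re_eq_complex_re, ← hre2] at hre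
  rw [RCLike.re_eq_complex_re, Complex.zero_re] at hre
  rw [← hre]
  suffices hpt : (fun z => (((((k : ℝ) - 1) * q (‖z - a‖ ^ 2) + ‖z - a‖ ^ 2 * q' (‖z - a‖ ^ 2)) *
      T.traceDensity z)
        - q' (‖z - a‖ ^ 2) * ((T.θ z (z - a) (z - a)).re / volDensity (κ z)))) =
      fun z => (∑ j, ∑ m, (del (χ m) z (e m) * (T.θ z (e j) (e j) / (volDensity (κ z) : ℂ))
      - del (χ m) z (e j) * (T.θ z (e j) (e m) / (volDensity (κ z) : ℂ)))).re by
    rw [hpt]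
    exact ⟨hIsum.re, rfl⟩
  funext z
  have hN : ∑ m, conj ((z - a) m) * (z - a) m = ((‖z - a‖ ^ 2 : ℝ) : ℂ) := by
    rw [EuclideanSpace.norm_sq_eq]
    push_cast
    refine Finset.sum_congr rfl fun m _ => ?_
    rw [mul_comm, Complex.mul_conj, Complex.normSq_eq_norm_sq, Complex.ofReal_pow]
  set q1 := q' (‖z - a‖ ^ 2) with hq1
  set V : ℂ := (volDensity (κ z) : ℂ) with hV
  have e1 : ∑ m, del (χ m) z (e m) = q1 * ((‖z - a‖ ^ 2 : ℝ) : ℂ) + k * Q z := by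
    simp only [hdel, if_true, Finset.sum_add_distrib, mul_assoc, ← Finset.mul_sum, hN, ← hq1]
    simp
  have e2 : ∑ j, ∑ m, del (χ m) z (e j) * (T.θ z (e j) (e m) / V) =
      q1 * (T.θ z (z - a) (z - a) / V) + Q z * ∑ j, (T.θ z (e j) (e j) / V) := by
    rw [sesqForm_apply]
    simp only [hdel, add_mul, Finset.sum_add_distrib, ite_mul, zero_mul, Finset.sum_ite_eq,
      Finset.mem_univ, if_true, Finset.mul_sum, Finset.sum_div]
    congr 1
    refine Finset.sum_congr rfl fun j _ => Finset.sum_congr rfl fun m _ => ?_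
    simp only [coeff, Matrix.of_apply, e, ← hq1]
    ring
  have e3 : ∑ j, ∑ m, (del (χ m) z (e m) * (T.θ z (e j) (e j) / V)
      - del (χ m) z (e j) * (T.θ z (e j) (e m) / V)) =
      (((k - 1) * q (‖z - a‖ ^ 2) + ‖z - a‖ ^ 2 * q1 : ℝ) : ℂ) * (∑ j, T.θ z (e j) (e j) / V) -
        (q1 : ℂ) * (T.θ z (z - a) (z - a) / V) := by
    simp only [Finset.sum_sub_distrib]
    rw [e2]
    simp only [← Finset.sum_mul, e1, ← Finset.mul_sum, Q]
    push_cast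
    ring
  have e4 := congrArg Complex.re e3
  rw [Complex.sub_re, Complex.re_ofReal_mul, Complex.re_ofReal_mul, Complex.re_sum Finset.univ
    fun j => T.θ z (e j) (e j) / V] at e4
  have e5 := T.traceDensity_eq_sum z
  have e6 : (T.θ z (z - a) (z - a) / V).re = (T.θ z (z - a) (z - a)).re / volDensity (κ z) := by
    rw [hV, Complex.div_ofReal_re]
  rw [e6] at e4
  refine Eq.trans ?_ e4.symm
  rw [e5]

/-- Lelong's bound: the mass of a closed positive current on a ball of radius `r` is
`O(r ^ (2 * (k - 1)))`, uniformly in terms of its total mass. Closedness is tested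
against `q(‖z - a‖²) (z - a)_m` with `q(t) = (t + r²)^{-(k - 1)} η(t)`, where `η` is a cutoff: the
exponent makes the contribution of `η = 1` positive and at least of the order of `r^{-2(k - 1)}` times
the mass on the ball, while `η' ≠ 0` only at a fixed distance from `a`. -/
theorem exists_setIntegral_closedBall_le (hk : 2 ≤ k) (hκ : IsMetricOn Ω κ) (hΩ : IsOpen Ω)
    {a : Cn k} {R : ℝ} (hR0 : 0 < R) (hR : Metric.closedBall a R ⊆ Ω) :
    ∃ C : ℝ, 0 < C ∧ ∀ T : CurrentOn Ω κ, IsClosedOn Ω κ T.θ T.μ → ∀ r, 0 < r → r ≤ R / 2 →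
      ∫ z in Metric.closedBall a r, T.traceDensity z ∂T.μ ≤ C * r ^ (2 * (k - 1)) * T.mass := by
  have hk0 : 0 < k := by omega
  obtain ⟨e, rfl⟩ : ∃ e, k = e + 2 := ⟨k - 2, by omega⟩
  obtain ⟨C₁, hC₁, hT₁⟩ := exists_setIntegral_traceDensity_le hk0 hκ hΩ (isCompact_closedBall a R) hR
  -- a cutoff function in the variable `t = ‖z - a‖²`
  let η : ℝ → ℝ := fun t => Real.smoothTransition ((R ^ 2 - t) / (3 / 4 * R ^ 2))
  have hR2 : 0 < R ^ 2 := by positivity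
  have hη : ContDiff ℝ ∞ η :=
    Real.smoothTransition.contDiff.comp ((contDiff_const.sub contDiff_id).div_const _)
  have hη0 : ∀ t, 0 ≤ η t := fun t => Real.smoothTransition.nonneg _
  have hη1 : ∀ t, t ≤ R ^ 2 / 4 → η t = 1 := fun t ht =>
    Real.smoothTransition.one_of_one_le (by rw [le_div_iff₀ (by positivity)]; linarith)
  have hηR : ∀ t, R ^ 2 ≤ t → η t = 0 := fun t ht =>
    Real.smoothTransition.zero_of_nonpos (div_nonpos_of_nonpos_of_nonneg (by linarith) (by positivity))
  have hηd : ∀ t, HasDerivAt η (deriv η t) t := fun t =>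
    (hη.differentiable (by simp) t).hasDerivAt
  have hηd0 : ∀ t, t < R ^ 2 / 4 → deriv η t = 0 := fun t ht => by
    have : η =ᶠ[𝓝 t] fun _ => 1 := by
      filter_upwards [Iio_mem_nhds ht] with x hx using hη1 x (le_of_lt hx)
    rw [this.deriv_eq, deriv_const]
  obtain ⟨M, hM⟩ := (isCompact_Icc (a := (0 : ℝ)) (b := R ^ 2)).exists_bound_of_continuousOn
    (hη.continuous_deriv (by simp)).continuousOn
  have hM0 : 0 ≤ M := (norm_nonneg _).trans (hM 0 ⟨le_rfl, hR2.le⟩)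
  set C₀ : ℝ := M * R ^ 2 * ((R ^ 2 / 4) ^ (e + 1))⁻¹ with hC₀
  have hC₀0 : 0 ≤ C₀ := by positivity
  refine ⟨2 ^ (e + 2) * C₀ * C₁ + 1, by positivity, fun T hT r hr hrR => ?_⟩
  obtain ⟨hI, hle⟩ := hT₁ T
  set s : ℝ := r ^ 2 with hs
  have hs0 : 0 < s := by positivity
  have hsR : s ≤ R ^ 2 / 4 := by
    have := pow_le_pow_left₀ hr.le hrR 2
    rw [hs]; linarith
  let q : ℝ → ℝ := fun t => ((t + s) ^ (e + 1))⁻¹ * η t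
  let q' : ℝ → ℝ := fun t => -((e + 1 : ℝ) * ((t + s) ^ (e + 2))⁻¹) * η t
    + ((t + s) ^ (e + 1))⁻¹ * deriv η t
  have hq : ∀ t, 0 ≤ t → HasDerivAt q (q' t) t := by
    intro t ht
    have hw : 0 < t + s := by linarith
    have h1 := (((hasDerivAt_id t).add_const s).pow (e + 1)).inv (pow_pos hw (e + 1)).ne'
    have h2 := h1.mul (hηd t)
    refine h2.congr_deriv ?_
    simp only [q', id, Pi.pow_apply, Pi.inv_apply]
    have hw' := hw.ne'
    field_simp
    push_cast
    ring
  have hsm : ContDiff ℝ ∞ (fun z : Cn (e + 2) => q (‖z - a‖ ^ 2)) := by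
    have h0 : ContDiff ℝ ∞ (fun z : Cn (e + 2) => ‖z - a‖ ^ 2) :=
      contDiff_norm_sq.comp (contDiff_id.sub contDiff_const)
    refine (((h0.add contDiff_const).pow (e + 1)).inv fun z => ?_).mul (hη.comp h0)
    positivity
  obtain ⟨hint, hzero⟩ := T.integral_radial_eq_zero hk0 hκ hΩ hT hR hR0.le hsm hq
    fun t ht => by simp only [q, hηR t ht, mul_zero]
  set F : Cn (e + 2) → ℝ := fun z => (((((e + 2 : ℕ) : ℝ) - 1) * q (‖z - a‖ ^ 2) +
      ‖z - a‖ ^ 2 * q' (‖z - a‖ ^ 2)) * T.traceDensity z)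
        - q' (‖z - a‖ ^ 2) * ((T.θ z (z - a) (z - a)).re / volDensity (κ z)) with hF
  have hFK : ∀ z, z ∉ Metric.closedBall a R → F z = 0 := by
    intro z hz
    rw [Metric.mem_closedBall, dist_eq_norm, not_le] at hz
    have ht : R ^ 2 < ‖z - a‖ ^ 2 := pow_lt_pow_left₀ hz hR0.le (by norm_num)
    have hd : deriv η (‖z - a‖ ^ 2) = 0 := by
      have : η =ᶠ[𝓝 (‖z - a‖ ^ 2)] fun _ => 0 := by
        filter_upwards [Ioi_mem_nhds ht] with x hx using hηR x (le_of_lt hx)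
      rw [this.deriv_eq, deriv_const]
    simp only [hF, q, q', hd, hηR _ ht.le]
    ring
  have hFint : ∫ z in Metric.closedBall a R, F z ∂T.μ = 0 := by
    rw [setIntegral_eq_integral_of_forall_compl_eq_zero hFK]
    exact hzero
  have hbr : Metric.closedBall a r ⊆ Metric.closedBall a R :=
    Metric.closedBall_subset_closedBall (by linarith)
  set c : ℝ := s * ((2 * s) ^ (e + 2))⁻¹ with hc
  have hc0 : 0 < c := by positivity
  have hpt : ∀ z ∈ Metric.closedBall a R, (Metric.closedBall a r).indicator
      (fun z => c * T.traceDensity z) z - C₀ * T.traceDensity z ≤ F z := by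
    intro z hz
    have hσ := T.traceDensity_nonneg hκ (hR hz)
    have hvd := hκ.volDensity_pos (hR hz)
    set σ := T.traceDensity z with hσd
    have hZ0 : 0 ≤ (T.θ z (z - a) (z - a)).re / volDensity (κ z) :=
      div_nonneg ((T.pos z (hR hz)).2 _) hvd.le
    have hZ1 : (T.θ z (z - a) (z - a)).re / volDensity (κ z) ≤ ‖z - a‖ ^ 2 * σ := by
      rw [hσd, CurrentOn.traceDensity, ← mul_div_assoc]
      exact div_le_div_of_nonneg_right ((T.pos z (hR hz)).apply_self_le _) hvd.le
    set Z := (T.θ z (z - a) (z - a)).re / volDensity (κ z)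
    rw [Metric.mem_closedBall, dist_eq_norm] at hz
    have htR : ‖z - a‖ ^ 2 ≤ R ^ 2 := pow_le_pow_left₀ (norm_nonneg _) hz 2
    have hmem : z ∈ Metric.closedBall a r ↔ ‖z - a‖ ^ 2 ≤ s := by
      rw [Metric.mem_closedBall, dist_eq_norm, hs, sq_le_sq₀ (norm_nonneg _) hr.le]
    set t := ‖z - a‖ ^ 2 with ht
    have ht0 : 0 ≤ t := by positivity
    have hw : 0 < t + s := by linarith
    have hFz : F z = (e + 1 : ℝ) * s * ((t + s) ^ (e + 2))⁻¹ * η t * σ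
        + (e + 1 : ℝ) * ((t + s) ^ (e + 2))⁻¹ * η t * Z
        + ((t + s) ^ (e + 1))⁻¹ * deriv η t * (t * σ - Z) := by
      have h1 : ((t + s) ^ (e + 1))⁻¹ = (t + s) * ((t + s) ^ (e + 2))⁻¹ := by
        rw [pow_succ (t + s) (e + 1)]; field_simp
      simp only [hF, q, q', ← ht, ← hσd]
      rw [h1]
      push_cast
      ring
    have hA : 0 ≤ (e + 1 : ℝ) * ((t + s) ^ (e + 2))⁻¹ * η t * Z := by
      have := hη0 t; positivity
    have hB : -(C₀ * σ) ≤ ((t + s) ^ (e + 1))⁻¹ * deriv η t * (t * σ - Z) := by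
      by_cases h4 : t < R ^ 2 / 4
      · rw [hηd0 t h4, mul_zero, zero_mul]
        have := mul_nonneg hC₀0 hσ
        linarith
      · rw [not_lt] at h4
        have h5 : ((t + s) ^ (e + 1))⁻¹ ≤ ((R ^ 2 / 4) ^ (e + 1))⁻¹ := by
          refine inv_anti₀ (by positivity) (pow_le_pow_left₀ (by positivity) (by linarith) _)
        have h6 := hM t ⟨ht0, htR⟩
        have h7 : |((t + s) ^ (e + 1))⁻¹ * deriv η t * (t * σ - Z)| ≤
            ((R ^ 2 / 4) ^ (e + 1))⁻¹ * M * (R ^ 2 * σ) := by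
          rw [abs_mul, abs_mul, abs_of_nonneg (show 0 ≤ ((t + s) ^ (e + 1))⁻¹ by positivity),
            abs_of_nonneg (show 0 ≤ t * σ - Z by linarith)]
          have h8 : t * σ - Z ≤ R ^ 2 * σ :=
            (sub_le_self _ hZ0).trans (mul_le_mul_of_nonneg_right htR hσ)
          have h9 : 0 ≤ t * σ - Z := by linarith
          have h10 : |deriv η t| ≤ M := h6
          gcongr
        have h11 := neg_abs_le (((t + s) ^ (e + 1))⁻¹ * deriv η t * (t * σ - Z))
        have h12 : ((R ^ 2 / 4) ^ (e + 1))⁻¹ * M * (R ^ 2 * σ) = C₀ * σ := by rw [hC₀]; ring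
        linarith
    have hD : (Metric.closedBall a r).indicator (fun z => c * T.traceDensity z) z ≤
        (e + 1 : ℝ) * s * ((t + s) ^ (e + 2))⁻¹ * η t * σ := by
      by_cases hzr : z ∈ Metric.closedBall a r
      · have hts := hmem.1 hzr
        rw [indicator_of_mem hzr, hη1 t (hts.trans hsR), ← hσd, mul_one]
        refine mul_le_mul_of_nonneg_right ?_ hσ
        have h13 : ((2 * s) ^ (e + 2))⁻¹ ≤ ((t + s) ^ (e + 2))⁻¹ :=
          inv_anti₀ (by positivity) (pow_le_pow_left₀ hw.le (by linarith) _)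
        calc c ≤ s * ((t + s) ^ (e + 2))⁻¹ := mul_le_mul_of_nonneg_left h13 hs0.le
          _ ≤ (e + 1 : ℝ) * (s * ((t + s) ^ (e + 2))⁻¹) :=
            le_mul_of_one_le_left (by positivity) (by linarith [(Nat.cast_nonneg e : (0 : ℝ) ≤ e)])
          _ = _ := by ring
      · rw [indicator_of_notMem hzr]
        have := hη0 t; positivity
    rw [hFz]
    linarith
  have hI2 : IntegrableOn ((Metric.closedBall a r).indicator (fun z => c * T.traceDensity z))
      (Metric.closedBall a R) T.μ :=
    (hI.const_mul c).indicator Metric.isClosed_closedBall.measurableSet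
  have h1 := setIntegral_mono_on (hI2.sub (hI.const_mul C₀)) hint.integrableOn
    Metric.isClosed_closedBall.measurableSet hpt
  rw [hFint] at h1
  have h2 : ∫ z in Metric.closedBall a R, ((Metric.closedBall a r).indicator
      (fun z => c * T.traceDensity z) - fun z => C₀ * T.traceDensity z) z ∂T.μ =
      c * ∫ z in Metric.closedBall a r, T.traceDensity z ∂T.μ -
        C₀ * ∫ z in Metric.closedBall a R, T.traceDensity z ∂T.μ := by
    rw [integral_sub' hI2 (hI.const_mul C₀), setIntegral_indicator
      Metric.isClosed_closedBall.measurableSet, inter_eq_self_of_subset_right hbr,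
      integral_const_mul, integral_const_mul]
  have h3 : c * ∫ z in Metric.closedBall a r, T.traceDensity z ∂T.μ ≤ C₀ * (C₁ * T.mass) := by
    have h4 := mul_le_mul_of_nonneg_left hle hC₀0
    have h5 := h2.symm.le.trans h1
    linarith
  have hcr : 2 ^ (e + 2) * r ^ (2 * (e + 2 - 1)) * c = 1 := by
    rw [hc, mul_pow, show r ^ (2 * (e + 2 - 1)) = s ^ (e + 1) by rw [hs, ← pow_mul]; rfl,
      pow_succ s (e + 1)]
    field_simp
  have hm := T.mass_nonneg hκ hΩ
  have h6 := mul_le_mul_of_nonneg_left h3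
    (show 0 ≤ (2 : ℝ) ^ (e + 2) * r ^ (2 * (e + 2 - 1)) by positivity)
  rw [← mul_assoc, hcr, one_mul] at h6
  refine h6.trans ?_
  have h7 : 0 ≤ r ^ (2 * (e + 2 - 1)) * T.mass := by positivity
  linarith

end

/-! ### The oscillation of `|z_i|² / ‖z‖²` at the origin -/

section

variable {k : ℕ} {Ω : Set (Cn k)} {κ : Cn k → SesqForm (Cn k)}

theorem ratio_smul (i : Fin k) {c : ℝ} (hc : c ≠ 0) (z : Cn k) : ratio i (c • z) = ratio i z := by
  have h : (c ^ 2 : ℝ) ≠ 0 := by positivity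
  simp only [ratio, PiLp.smul_apply, norm_smul, mul_pow, Real.norm_eq_abs, sq_abs]
  rw [mul_div_mul_left _ _ h]

theorem integral_del_eq_zero {χ : Cn k → ℂ} (hχ : ContDiff ℝ ∞ χ) (hc : HasCompactSupport χ)
    (v : Cn k) : ∫ z, del χ z v = 0 := by
  have h := integral_mul_del (F := fun _ => (1 : ℂ)) isOpen_univ contDiffOn_const
    ⟨hχ, hc, subset_univ _⟩ v
  simpa [del] using h

/-- A test function `ψ`, supported away from the origin, that detects the non-constancy of
`|z_i|² / ‖z‖²`: it is the product of `z_i` with a bump function at `e_i + e_j`, `j ≠ i`, so that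
its product with the derivative of the ratio along `e_i` is non-negative. -/
theorem exists_probe_zero (hk : 2 ≤ k) (i : Fin k) : ∃ (ψ : Cn k → ℂ) (c : ℝ), 0 < c ∧
    ContDiff ℝ ∞ ψ ∧ tsupport ψ ⊆ Metric.closedBall 0 2 ∧
    ∫ z, (ratio i z : ℂ) * del ψ z (EuclideanSpace.single i 1) = -(c : ℂ) := by
  have : Nontrivial (Fin k) := Fin.nontrivial_iff_two_le.2 hk
  obtain ⟨j, hj⟩ := exists_ne i
  let y : Cn k := EuclideanSpace.single i 1 + EuclideanSpace.single j 1
  have hyi : y i = 1 := by simp [y, Ne.symm hj]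
  have hyj : y j = 1 := by simp [y, hj]
  let b : ContDiffBump y := ⟨1 / 4, 1 / 2, by norm_num, by norm_num⟩
  have hb : tsupport b = Metric.closedBall y (1 / 2) := b.tsupport_eq
  have hy2 : ‖y‖ ≤ 3 / 2 := by
    have h : ‖y‖ ^ 2 = 2 := by
      have : (inner ℂ (EuclideanSpace.single i (1 : ℂ)) (EuclideanSpace.single j (1 : ℂ)) : ℂ) = 0 := by
        rw [EuclideanSpace.inner_single_left]; simp [Ne.symm hj]
      have h2 := norm_add_sq_eq_norm_sq_add_norm_sq_of_inner_eq_zero (𝕜 := ℂ) _ _ this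
      simp only [y, sq]
      rw [h2]; simp; norm_num
    nlinarith [norm_nonneg y]
  have hco : ∀ z ∈ Metric.closedBall y (1 / 2), ∀ m, y m = 1 → 0 < ‖z m‖ := by
    intro z hz m hm
    rw [Metric.mem_closedBall, dist_eq_norm] at hz
    have h1 : ‖(z - y) m‖ ≤ ‖z - y‖ := PiLp.norm_apply_le _ _
    have h2 : ‖y m‖ ≤ ‖z m‖ + ‖(z - y) m‖ := by
      have h3 : y m = z m - (z - y) m := by simp
      rw [h3]; exact norm_sub_le _ _
    rw [hm, norm_one] at h2
    linarith
  have hΩ : IsOpen ({0}ᶜ : Set (Cn k)) := isOpen_compl_singleton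
  let ψ : Cn k → ℂ := fun z => (b z : ℂ) * z i
  have hbs : ContDiff ℝ ∞ (fun z => (b z : ℂ)) := Complex.ofRealCLM.contDiff.comp b.contDiff
  have hψ : ContDiff ℝ ∞ ψ := hbs.mul (contDiff_coord i)
  have hψb : tsupport ψ ⊆ Metric.closedBall y (1 / 2) := by
    rw [← hb]
    refine closure_mono fun z hz => ?_
    intro h0
    exact hz (by simp only [ψ]; rw [h0]; simp)
  have hψc : HasCompactSupport ψ := HasCompactSupport.of_support_subset_isCompact
    (isCompact_closedBall y (1 / 2)) ((subset_tsupport _).trans hψb)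
  have hψ0 : tsupport ψ ⊆ ({0}ᶜ : Set (Cn k)) := by
    intro z hz h0
    have := hco z (hψb hz) i hyi
    rw [mem_singleton_iff.1 h0] at this
    simp at this
  have hF : ContDiffOn ℝ ∞ (fun z : Cn k => (ratio i z : ℂ)) {0}ᶜ := fun z hz =>
    (Complex.ofRealCLM.contDiff.contDiffAt.comp z (contDiffAt_ratio i hz)).contDiffWithinAt
  let P : Cn k → ℝ := fun z => b z * (‖z i‖ ^ 2 * (‖z‖ ^ 2 - ‖z i‖ ^ 2) / (‖z‖ ^ 2) ^ 2)
  have hN : ∀ z : Cn k, ‖z i‖ ^ 2 + ‖z j‖ ^ 2 ≤ ‖z‖ ^ 2 := by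
    intro z
    rw [EuclideanSpace.norm_sq_eq]
    have := Finset.sum_le_univ_sum_of_nonneg (s := {i, j}) (f := fun m => ‖z m‖ ^ 2)
      (fun m => by positivity)
    rwa [Finset.sum_pair (Ne.symm hj)] at this
  have hPeq : ∀ z, del (fun y => (ratio i y : ℂ)) z (EuclideanSpace.single i 1) * ψ z =
      ((P z : ℝ) : ℂ) := by
    intro z
    by_cases hz : z = 0
    · subst hz
      have : b (0 : Cn k) = 0 := by
        by_contra h
        have h2 := hco 0 (hb ▸ subset_tsupport b h) i hyi
        simp at h2
      simp [ψ, P]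
    · rw [del_ratio i hz, EuclideanSpace.inner_single_right]
      have h1 : conj (z i) * z i = ((‖z i‖ ^ 2 : ℝ) : ℂ) := by
        rw [mul_comm, Complex.mul_conj, Complex.normSq_eq_norm_sq]
      simp only [ψ, P, PiLp.single_apply, if_true]
      push_cast at h1 ⊢
      linear_combination ((b z : ℂ) * ((‖z‖ : ℂ) ^ 2 - (‖z i‖ : ℂ) ^ 2) / ((‖z‖ : ℂ) ^ 2) ^ 2
        - (b z : ℂ) * conj (z i) * z i / ((‖z‖ : ℂ) ^ 2) ^ 2) * h1
  have hP0 : 0 ≤ P := fun z => by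
    have h2 : 0 ≤ ‖z‖ ^ 2 - ‖z i‖ ^ 2 := by nlinarith [hN z, sq_nonneg ‖z j‖]
    exact mul_nonneg b.nonneg (by positivity)
  have hPc : Continuous P := by
    have h1 : ContinuousOn (fun z : Cn k => ‖z i‖ ^ 2 * (‖z‖ ^ 2 - ‖z i‖ ^ 2) / (‖z‖ ^ 2) ^ 2)
        {0}ᶜ := by
      have h3 : Continuous fun z : Cn k => ‖z i‖ ^ 2 := (contDiff_norm_coord_sq i).continuous
      have h4 : Continuous fun z : Cn k => ‖z‖ ^ 2 := by fun_prop
      refine ContinuousOn.div (h3.mul (h4.sub h3)).continuousOn (h4.pow 2).continuousOn ?_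
      intro z hz
      have : z ≠ 0 := hz
      positivity
    refine (b.continuous.continuousOn.mul h1).continuous_of_tsupport_subset hΩ ?_
    refine tsupport_mul_subset_left.trans ?_
    rw [hb]
    intro z hz h0
    have := hco z hz i hyi
    rw [mem_singleton_iff.1 h0] at this
    simp at this
  have hPcs : HasCompactSupport P := b.hasCompactSupport.mul_right
  have hPy : P y ≠ 0 := by
    have h1 := hN y
    rw [hyi, hyj] at h1
    simp only [norm_one, one_pow] at h1
    have h2 : 0 < ‖y‖ ^ 2 := by linarith
    have h3 : 0 < ‖y‖ ^ 2 - 1 := by linarith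
    have h4 : b y = 1 := b.one_of_mem_closedBall (Metric.mem_closedBall_self (by norm_num [b]))
    simp only [P, h4, hyi, norm_one, one_pow, one_mul]
    exact (div_pos h3 (by positivity)).ne'
  refine ⟨ψ, ∫ z, P z, hPc.integral_pos_of_hasCompactSupport_nonneg_nonzero hPcs hP0 hPy, hψ,
    hψb.trans ?_, ?_⟩
  · intro z hz
    rw [Metric.mem_closedBall, dist_eq_norm] at hz ⊢
    have : ‖z - 0‖ ≤ ‖z - y‖ + ‖y‖ := by simpa using norm_add_le (z - y) y
    linarith
  · rw [integral_mul_del hΩ hF ⟨hψ, hψc, hψ0⟩, ← integral_complex_ofReal]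
    simp only [hPeq]

/-- The rescaled test functions around a point `a`. -/
theorem exists_probe (hk : 2 ≤ k) (i : Fin k) : ∃ c M : ℝ, 0 < c ∧ 0 < M ∧
    ∀ (a : Cn k) (r : ℝ), 0 < r → ∃ ψ : Cn k → ℂ, ContDiff ℝ ∞ ψ ∧
      tsupport ψ ⊆ Metric.closedBall a (2 * r) ∧ (∀ z, ‖ψ z‖ ≤ M) ∧
      (∀ z, ‖del ψ z (EuclideanSpace.single i 1)‖ ≤ M / r) ∧
      ∫ z, (ratio i (z - a) : ℂ) * del ψ z (EuclideanSpace.single i 1) =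
        -((c * (r ^ (2 * k) / r) : ℝ) : ℂ) := by
  obtain ⟨ψ, c, hc, hψ, hs, hint⟩ := exists_probe_zero hk i
  have hcs : HasCompactSupport ψ := HasCompactSupport.of_support_subset_isCompact
    (isCompact_closedBall 0 2) ((subset_tsupport _).trans hs)
  set e : Cn k := EuclideanSpace.single i 1 with he
  obtain ⟨M₁, hM₁⟩ := hψ.continuous.bounded_above_of_compact_support hcs
  obtain ⟨M₂, hM₂⟩ := (ContDiff.del hψ e).continuous.bounded_above_of_compact_support
    (hasCompactSupport_del hcs e)
  refine ⟨c, max M₁ M₂ + 1, hc, ?_, fun a r hr => ?_⟩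
  · have := (norm_nonneg _).trans (hM₁ 0)
    have := le_max_left M₁ M₂
    linarith
  let A : Cn k → Cn k := fun z => r⁻¹ • (z - a)
  have hA : ContDiff ℝ ∞ A := (contDiff_id.sub contDiff_const).const_smul _
  have hAd : ∀ z v, DifferentiableAt ℂ A z ∧ fderiv ℂ A z v = r⁻¹ • v := by
    intro z v
    have h1 : HasFDerivAt A ((r⁻¹ : ℝ) • ContinuousLinearMap.id ℂ (Cn k)) z :=
      ((hasFDerivAt_id z).sub_const a).const_smul (r⁻¹ : ℝ)
    exact ⟨h1.differentiableAt, by rw [h1.fderiv]; simp⟩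
  have hdel : ∀ z, del (fun y => ψ (A y)) z e = (r⁻¹ : ℝ) * del ψ (A z) e := by
    intro z
    rw [del_comp (hψ.differentiable (by simp) _) (hAd z e).1, (hAd z e).2, ← delLin_apply,
      ← delLin_apply]
    have : (r⁻¹ : ℝ) • e = ((r⁻¹ : ℝ) : ℂ) • e := (Complex.coe_smul _ _).symm
    rw [this, map_smul, smul_eq_mul]
  refine ⟨fun z => ψ (A z), hψ.comp hA, ?_, fun z => (hM₁ _).trans (by
    have := le_max_left M₁ M₂
    linarith), fun z => ?_, ?_⟩
  · refine closure_minimal (fun z hz => ?_) Metric.isClosed_closedBall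
    have h1 := hs (subset_tsupport ψ hz)
    rw [Metric.mem_closedBall, dist_zero_right, norm_smul, norm_inv, Real.norm_of_nonneg hr.le,
      inv_mul_le_iff₀ hr] at h1
    rw [Metric.mem_closedBall, dist_eq_norm]
    linarith
  · rw [hdel, norm_mul, Complex.norm_real, norm_inv, Real.norm_of_nonneg hr.le, inv_mul_eq_div]
    refine div_le_div_of_nonneg_right ((hM₂ _).trans ?_) hr.le
    have := le_max_right M₁ M₂
    linarith
  · have h1 : ∀ z, (ratio i (z - a) : ℂ) * del (fun y => ψ (A y)) z e =
        (r⁻¹ : ℝ) * ((fun w => (ratio i w : ℂ) * del ψ w e) (r⁻¹ • (z - a))) := by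
      intro z
      simp only
      rw [hdel, ratio_smul i (inv_ne_zero hr.ne')]
      ring
    have h2 := Measure.integral_comp_inv_smul_of_nonneg volume
      (fun w : Cn k => (ratio i w : ℂ) * del ψ w e) hr.le
    simp only [h1]
    rw [integral_const_mul, integral_sub_right_eq_self (fun z => (fun w => (ratio i w : ℂ) *
      del ψ w e) (r⁻¹ • z))]
    rw [finrank_real_Cn, hint] at h2
    refine (congrArg (fun x => ((r⁻¹ : ℝ) : ℂ) * x) h2).trans ?_
    rw [Complex.real_smul]
    push_cast
    have : (r : ℂ) ≠ 0 := by exact_mod_cast hr.ne'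
    field_simp

/-- A function that is equal to `|z_i|² / ‖z‖²` near a point does not have vanishing mean oscillation
there. -/
theorem not_tendsto_meanOsc (hk : 2 ≤ k) (i : Fin k) {f : Cn k → ℝ} {a : Cn k} {ρ : ℝ}
    (hρ : 0 < ρ) (hf : ∀ z ∈ Metric.ball a ρ, f z = ratio i (z - a)) :
    ¬ Tendsto (meanOsc f a) (𝓝[>] 0) (𝓝 0) := by
  intro hlim
  obtain ⟨c, M, hc, hM, hp⟩ := exists_probe hk i
  set V : ℝ := volume.real (Metric.ball (0 : Cn k) 1) with hV
  have hV0 : 0 < V := by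
    rw [hV, measureReal_def]
    exact ENNReal.toReal_pos (Metric.measure_ball_pos _ _ one_pos).ne' measure_ball_lt_top.ne
  set ε : ℝ := c / (M * V * 3 ^ (2 * k)) with hε
  have hε0 : 0 < ε := by positivity
  have hev := (hlim.eventually (gt_mem_nhds hε0))
  have hev2 : ∀ᶠ r in 𝓝[>] (0 : ℝ), r < ρ :=
    eventually_nhdsWithin_of_eventually_nhds (gt_mem_nhds hρ)
  obtain ⟨s, ⟨hs1, hs2⟩, hs0⟩ := ((hev.and hev2).and self_mem_nhdsWithin).exists
  have hs0' : 0 < s := hs0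
  set r : ℝ := s / 3 with hr
  have hr0 : 0 < r := by positivity
  have hsr : s = 3 * r := by rw [hr]; ring
  obtain ⟨ψ, hψ, hψs, -, hψM, hψi⟩ := hp a r hr0
  set e : Cn k := EuclideanSpace.single i 1 with he
  have hcs : HasCompactSupport ψ := HasCompactSupport.of_support_subset_isCompact
    (isCompact_closedBall a (2 * r)) ((subset_tsupport _).trans hψs)
  have hdc : Continuous fun z => del ψ z e := (ContDiff.del hψ e).continuous
  set B := Metric.ball a s with hB
  set m : ℝ := ⨍ x in B, f x with hm
  have hvol : volume.real B = s ^ (2 * k) * V := by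
    rw [hB, measureReal_def, Measure.addHaar_ball_of_pos _ _ hs0', ENNReal.toReal_mul,
      ENNReal.toReal_ofReal (by positivity), finrank_real_Cn, hV, measureReal_def]
  have hout : ∀ z, z ∉ B → del ψ z e = 0 := by
    intro z hz
    refine image_eq_zero_of_notMem_tsupport (f := fun z => del ψ z e) fun h => hz ?_
    refine Metric.closedBall_subset_ball (by linarith) (hψs (tsupport_del_subset ψ e h))
  have hfB : ∀ z ∈ B, f z = ratio i (z - a) := fun z hz => hf z (Metric.ball_subset_ball hs2.le hz)
  have hrm : Measurable fun z : Cn k => ratio i (z - a) := by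
    unfold ratio; fun_prop
  have hfi : IntegrableOn f B := by
    have h1 : IntegrableOn (fun z => ratio i (z - a)) B := by
      refine Measure.integrableOn_of_bounded (M := 1) measure_ball_lt_top.ne
        hrm.aestronglyMeasurable (ae_of_all _ fun z => ?_)
      rw [Real.norm_of_nonneg (ratio_nonneg _ _)]
      exact ratio_le_one _ _
    exact h1.congr_fun (fun z hz => (hfB z hz).symm) (Metric.isOpen_ball (x := a)).measurableSet
  have hfi' : IntegrableOn (fun z => f z - m) B := hfi.sub (integrableOn_const (measure_ball_lt_top (x := a)).ne)
  have hra : Integrable fun z => (ratio i (z - a) : ℂ) * del ψ z e := by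
    refine (hdc.integrable_of_hasCompactSupport (hasCompactSupport_del hcs e)).bdd_mul (c := 1)
      (Complex.measurable_ofReal.comp hrm).aestronglyMeasurable (ae_of_all _ fun z => ?_)
    rw [Complex.norm_real, Real.norm_of_nonneg (ratio_nonneg _ _)]
    exact ratio_le_one _ _
  have h1 : ∫ z in B, ((f z - m : ℝ) : ℂ) * del ψ z e = -((c * (r ^ (2 * k) / r) : ℝ) : ℂ) := by
    rw [← hψi]
    have h2 : ∫ z, (m : ℂ) * del ψ z e = 0 := by
      rw [integral_const_mul, integral_del_eq_zero hψ hcs, mul_zero]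
    have h3 : ∫ z, ((ratio i (z - a) : ℂ) * del ψ z e - (m : ℂ) * del ψ z e) =
        ∫ z, (ratio i (z - a) : ℂ) * del ψ z e := by
      rw [integral_sub hra ((hdc.integrable_of_hasCompactSupport
        (hasCompactSupport_del hcs e)).const_mul _), h2, sub_zero]
    rw [← h3]
    refine Eq.trans ?_ (setIntegral_eq_integral_of_forall_compl_eq_zero (s := B)
      (fun z hz => by rw [hout z hz]; simp))
    refine setIntegral_congr_fun (Metric.isOpen_ball (x := a)).measurableSet fun z hz => ?_
    simp only [hfB z hz]
    push_cast
    ring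
  have h4 : c * (r ^ (2 * k) / r) ≤ M / r * ∫ z in B, |f z - m| := by
    have h5 : ‖∫ z in B, ((f z - m : ℝ) : ℂ) * del ψ z e‖ ≤ ∫ z in B, M / r * |f z - m| := by
      refine norm_integral_le_of_norm_le (hfi'.norm.const_mul _) (ae_of_all _ fun z => ?_)
      rw [norm_mul, Complex.norm_real, Real.norm_eq_abs, mul_comm]
      exact mul_le_mul_of_nonneg_right (hψM z) (abs_nonneg _)
    rw [h1, norm_neg, Complex.norm_real, Real.norm_of_nonneg (by positivity),
      integral_const_mul] at h5
    exact h5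
  have h6 : meanOsc f a s = (s ^ (2 * k) * V)⁻¹ * ∫ z in B, |f z - m| := by
    rw [meanOsc, setAverage_eq, hvol, smul_eq_mul]
  have h7 : c * r ^ (2 * k) ≤ M * ∫ z in B, |f z - m| := by
    have := mul_le_mul_of_nonneg_left h4 hr0.le
    calc c * r ^ (2 * k) = r * (c * (r ^ (2 * k) / r)) := by field_simp
      _ ≤ _ := this
      _ = _ := by field_simp
  rw [h6, hε, inv_mul_lt_iff₀ (by positivity)] at hs1
  have h8 : s ^ (2 * k) * V * (c / (M * V * 3 ^ (2 * k))) = c * r ^ (2 * k) / M := by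
    rw [hsr, mul_pow]
    field_simp
  rw [h8, lt_div_iff₀ hM] at hs1
  linarith

end

/-! ### A lower bound for the mass of the currents controlling a perturbation of the model -/

section

variable {k : ℕ} {Ω : Set (Cn k)} {κ : Cn k → SesqForm (Cn k)}

theorem IsMetricOn.aemeasurable_ofReal_volDensity (hκ : IsMetricOn Ω κ) (hΩ : IsOpen Ω) :
    AEMeasurable (fun z => ENNReal.ofReal (volDensity (κ z))) (volume.restrict Ω) :=
  ((continuousOn_volDensity hκ.continuousOn).aemeasurable hΩ.measurableSet).ennreal_ofReal

theorem integrable_volumeOn_iff {E : Type*} [NormedAddCommGroup E] [NormedSpace ℝ E]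
    (hκ : IsMetricOn Ω κ) (hΩ : IsOpen Ω) {F : Cn k → E} :
    Integrable F (volumeOn Ω κ) ↔ IntegrableOn (fun z => volDensity (κ z) • F z) Ω := by
  rw [volumeOn, integrable_withDensity_iff_integrable_smul₀'
    (hκ.aemeasurable_ofReal_volDensity hΩ) (ae_of_all _ fun z => ENNReal.ofReal_lt_top)]
  refine integrable_congr ?_
  filter_upwards [ae_restrict_mem hΩ.measurableSet] with z hz
  rw [ENNReal.toReal_ofReal (hκ.volDensity_pos hz).le]

theorem integral_volumeOn {E : Type*} [NormedAddCommGroup E] [NormedSpace ℝ E]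
    (hκ : IsMetricOn Ω κ) (hΩ : IsOpen Ω) (F : Cn k → E) :
    ∫ z, F z ∂(volumeOn Ω κ) = ∫ z in Ω, volDensity (κ z) • F z := by
  rw [volumeOn, integral_withDensity_eq_integral_toReal_smul₀
    (hκ.aemeasurable_ofReal_volDensity hΩ) (ae_of_all _ fun z => ENNReal.ofReal_lt_top)]
  refine setIntegral_congr_fun hΩ.measurableSet fun z hz => ?_
  simp only [ENNReal.toReal_ofReal (hκ.volDensity_pos hz).le]

theorem volumeOn_absolutelyContinuous : volumeOn Ω κ ≪ volume.restrict Ω :=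
  withDensity_absolutelyContinuous _ _

theorem volumeOn_restrict (hΩ : IsOpen Ω) : (volumeOn Ω κ).restrict Ω = volumeOn Ω κ := by
  rw [volumeOn, restrict_withDensity hΩ.measurableSet, Measure.restrict_restrict hΩ.measurableSet,
    inter_self]

theorem aestronglyMeasurable_wedgeConj_apply {G : Cn k → Cn k →ₗ[ℂ] ℂ} {μ : Measure (Cn k)}
    (hG : ∀ v, AEStronglyMeasurable (fun z => G z v) μ) (v w : Cn k) :
    AEStronglyMeasurable (fun z => wedgeConj (G z) v w) μ := by
  have h : (fun z => wedgeConj (G z) v w) = fun z => 2 * (conj (G z v) * G z w) :=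
    funext fun z => wedgeConj_apply _ _ _
  rw [h]
  exact ((Complex.continuous_conj.comp_aestronglyMeasurable (hG v)).mul (hG w)).const_mul 2

/-- The form `i G ∧ Ḡ` as a current. -/
def HasL2DelOn.current {f : Cn k → ℝ} {G : Cn k → Cn k →ₗ[ℂ] ℂ} (hG : HasL2DelOn Ω κ f G) :
    CurrentOn Ω κ where
  μ := volumeOn Ω κ
  θ z := wedgeConj (G z)
  pos _ _ := isPosForm_wedgeConj _
  meas v w := ((aestronglyMeasurable_wedgeConj_apply hG.1.1 v w).mono_ac
    ((Measure.absolutelyContinuous_of_le Measure.restrict_le_self).trans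
      volumeOn_absolutelyContinuous)).aemeasurable
  finite_mass := hG.2.integrableOn

theorem HasL2DelOn.integrable_mul_wedgeConj (hk : 0 < k) (hκ : IsMetricOn Ω κ) (hΩ : IsOpen Ω)
    {f : Cn k → ℝ} {G : Cn k → Cn k →ₗ[ℂ] ℂ} (hG : HasL2DelOn Ω κ f G) {χ : Cn k → ℝ}
    (hχ : Continuous χ) (hc : HasCompactSupport χ) (hs : tsupport χ ⊆ Ω) (v : Cn k) :
    Integrable (fun z => χ z * (wedgeConj (G z) v v).re) := by
  have hs' : tsupport (fun z => (χ z : ℂ)) ⊆ tsupport χ :=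
    closure_mono fun z hz h => hz (by simp [h])
  have h := (integrable_volumeOn_iff hκ hΩ).1 (hG.current.integrable_mul hk hκ hΩ
    (χ := fun z => (χ z : ℂ)) (Complex.continuous_ofReal.comp hχ)
    (hc.of_isClosed_subset (isClosed_tsupport _) hs') (hs'.trans hs) v v)
  have h2 : IntegrableOn (fun z => χ z * (wedgeConj (G z) v v).re) Ω := by
    refine (integrable_congr ?_).1 h.re
    filter_upwards [ae_restrict_mem hΩ.measurableSet] with z hz
    have hd : (volDensity (κ z) : ℂ) ≠ 0 := by exact_mod_cast (hκ.volDensity_pos hz).ne'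
    have h3 : volDensity (κ z) • ((χ z : ℂ) * (wedgeConj (G z) v v / (volDensity (κ z) : ℂ))) =
        χ z * wedgeConj (G z) v v := by
      rw [Complex.real_smul]
      field_simp
    have h4 := congrArg Complex.re h3
    rw [Complex.re_ofReal_mul] at h4
    exact h4
  refine (integrableOn_iff_integrable_of_support_subset fun z hz => ?_).1 h2
  exact hs (subset_tsupport χ (left_ne_zero_of_mul hz))

/-- The masses of the closed currents that control the sum of the model `|z_i|² / ‖z‖²` and of a
continuous function are bounded below: by Lelong's bound the energy on a ball of radius `r` is
`O(r ^ (2 k - 2))` times the mass, which is not compatible with the oscillation of the model on that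
ball if the mass is small. -/
theorem exists_le_mass_of_controls (hk : 2 ≤ k) (hκ : IsMetricOn Ω κ) (hΩ : IsOpen Ω) (i : Fin k)
    {a : Cn k} {ρ : ℝ} (hρ : 0 < ρ) (ha : Metric.ball a ρ ⊆ Ω) :
    ∃ ε : ℝ, 0 < ε ∧ ∀ h g : Cn k → ℝ, ContinuousOn g (Metric.ball a ρ) →
      (∀ z ∈ Metric.ball a ρ, h z = ratio i (z - a) - g z) →
      ∀ T : CurrentOn Ω κ, T.Controls h → ε ≤ T.mass := by
  obtain ⟨c, M, hc, hM, hp⟩ := exists_probe hk i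
  have hk0 : 0 < k := by omega
  have hR : Metric.closedBall a (ρ / 2) ⊆ Ω :=
    (Metric.closedBall_subset_ball (by linarith)).trans ha
  obtain ⟨C, hC, hL⟩ := exists_setIntegral_closedBall_le hk hκ hΩ (half_pos hρ) hR
  set V : ℝ := volume.real (Metric.ball (0 : Cn k) 1) with hV
  have hV0 : 0 < V := by
    rw [hV, measureReal_def]
    exact ENNReal.toReal_pos (Metric.measure_ball_pos _ _ one_pos).ne' measure_ball_lt_top.ne
  -- `τ r` is the weight in the arithmetic-geometric mean inequality below, chosen such that the term
  -- without the energy is at most half of the oscillation that has to be accounted for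
  set τ : ℝ := M * V * 3 ^ (2 * k) / c with hτ
  have hτ0 : 0 < τ := by positivity
  refine ⟨c / (2 * M * τ * C * 3 ^ (2 * (k - 1))), by positivity, fun h g hg hh T hT => ?_⟩
  obtain ⟨hcl, G, hG, hdom⟩ := hT
  -- the radius is chosen such that the oscillation of `g` is small
  obtain ⟨δ, hδ, hgδ⟩ := Metric.continuousAt_iff.1
    (hg.continuousAt (Metric.ball_mem_nhds a hρ)) (c / (2 * M * V * 3 ^ (2 * k)))
    (by positivity)
  obtain ⟨r, hr0, hrδ, hrρ⟩ : ∃ r : ℝ, 0 < r ∧ 3 * r < δ ∧ 12 * r < ρ := by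
    refine ⟨min δ ρ / 13, by positivity, ?_, ?_⟩
    · have := min_le_left δ ρ; linarith
    · have := min_le_right δ ρ; linarith
  obtain ⟨ψ, hψ, hψs, hψM, hψd, hψi⟩ := hp a r hr0
  set e : Cn k := EuclideanSpace.single i 1 with he
  have he1 : ‖e‖ = 1 := by simp [he]
  let χ : ContDiffBump a := ⟨2 * r, 3 * r, by linarith, by linarith⟩
  set B := Metric.closedBall a (3 * r) with hB
  have hBΩ : B ⊆ Ω := (Metric.closedBall_subset_closedBall (by linarith)).trans hR
  have hχs : tsupport χ = B := χ.tsupport_eq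
  have hχ0 : ∀ z, z ∉ B → χ z = 0 := fun z hz =>
    image_eq_zero_of_notMem_tsupport (f := χ) (hχs ▸ hz)
  have hcs : HasCompactSupport ψ := HasCompactSupport.of_support_subset_isCompact
    (isCompact_closedBall a (2 * r)) ((subset_tsupport _).trans hψs)
  have hψB : tsupport ψ ⊆ B := hψs.trans (Metric.closedBall_subset_closedBall (by linarith))
  have hdc : Continuous fun z => del ψ z e := (ContDiff.del hψ e).continuous
  have hdcs := hasCompactSupport_del hcs e
  have hvol : volume.real B = (3 * r) ^ (2 * k) * V := by
    rw [hB, Measure.addHaar_real_closedBall _ _ (by positivity), finrank_real_Cn]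
  have hweak := hG.1.2 ψ ⟨hψ, hcs, hψB.trans hBΩ⟩ e
  have hout : ∀ z, z ∉ B → del ψ z e = 0 := fun z hz =>
    image_eq_zero_of_notMem_tsupport (f := fun z => del ψ z e)
      fun h => hz (hψB (tsupport_del_subset ψ e h))
  have hrm : Measurable fun z : Cn k => ratio i (z - a) := by
    unfold ratio; fun_prop
  -- the model oscillates
  have hosc : c / 2 * (r ^ (2 * k) / r) ≤ ‖∫ z, (h z : ℂ) * del ψ z e‖ := by
    have hra : Integrable fun z => (ratio i (z - a) : ℂ) * del ψ z e := by
      refine (hdc.integrable_of_hasCompactSupport hdcs).bdd_mul (c := 1)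
        (Complex.measurable_ofReal.comp hrm).aestronglyMeasurable (ae_of_all _ fun z => ?_)
      rw [Complex.norm_real, Real.norm_of_nonneg (ratio_nonneg _ _)]
      exact ratio_le_one _ _
    have hga : Integrable fun z => (g a : ℂ) * del ψ z e :=
      (hdc.integrable_of_hasCompactSupport hdcs).const_mul _
    have hbd : ∀ z ∈ B, |g z - g a| ≤ c / (2 * M * V * 3 ^ (2 * k)) := fun z hz =>
      (hgδ (lt_of_le_of_lt hz hrδ)).le
    have hpt : ∀ z, (ratio i (z - a) : ℂ) * del ψ z e - (h z : ℂ) * del ψ z e -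
        (g a : ℂ) * del ψ z e = ((g z - g a : ℝ) : ℂ) * del ψ z e := by
      intro z
      by_cases hz : z ∈ B
      · rw [hh z (Metric.closedBall_subset_ball (by linarith) hz)]
        push_cast; ring
      · rw [hout z hz]; simp
    have hsmall : ‖∫ z in B, ((g z - g a : ℝ) : ℂ) * del ψ z e‖ ≤ c / 2 * (r ^ (2 * k) / r) := by
      refine (norm_setIntegral_le_of_norm_le_const (isCompact_closedBall _ _).measure_lt_top
        (C := c / (2 * M * V * 3 ^ (2 * k)) * (M / r)) fun z hz => ?_).trans ?_
      · rw [norm_mul, Complex.norm_real]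
        exact mul_le_mul (hbd z hz) (hψd z) (norm_nonneg _) (by positivity)
      · rw [hvol, mul_pow]
        refine le_of_eq ?_
        field_simp
    rw [setIntegral_eq_integral_of_forall_compl_eq_zero (fun z hz => by rw [hout z hz]; simp)]
      at hsmall
    have hDi : Integrable fun z => ((g z - g a : ℝ) : ℂ) * del ψ z e :=
      integrable_mul_of_tsupport Metric.isOpen_ball (F := fun z => ((g z - g a : ℝ) : ℂ))
        (Complex.continuous_ofReal.comp_continuousOn (hg.sub continuousOn_const)) hdc hdcs
        ((tsupport_del_subset ψ e).trans (hψB.trans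
          (Metric.closedBall_subset_ball (by linarith))))
    have h1 : ∫ z, (h z : ℂ) * del ψ z e = -((c * (r ^ (2 * k) / r) : ℝ) : ℂ) -
        ∫ z, ((g z - g a : ℝ) : ℂ) * del ψ z e := by
      have h2 : ∀ z, (h z : ℂ) * del ψ z e = (ratio i (z - a) : ℂ) * del ψ z e -
          (g a : ℂ) * del ψ z e - ((g z - g a : ℝ) : ℂ) * del ψ z e := fun z => by
        rw [← hpt]; ring
      simp only [h2]
      have h3 := integral_sub (hra.sub hga) hDi
      have h4 := integral_sub hra hga
      simp only [Pi.sub_apply] at h3 h4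
      rw [h3, h4, hψi, integral_const_mul, integral_del_eq_zero hψ hcs, mul_zero, sub_zero]
    rw [h1]
    have h2 := norm_sub_norm_le (-((c * (r ^ (2 * k) / r) : ℝ) : ℂ))
      (∫ z, ((g z - g a : ℝ) : ℂ) * del ψ z e)
    rw [norm_neg, Complex.norm_real, Real.norm_of_nonneg (by positivity)] at h2
    linarith
  -- the energy on the ball of radius `3 r` is bounded by the mass
  have hGi : Integrable fun z => χ z * ‖G z e‖ ^ 2 := by
    have h1 := (hG.integrable_mul_wedgeConj hk0 hκ hΩ χ.continuous χ.hasCompactSupport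
      (hχs.trans_subset hBΩ) e).const_mul (1 / 2)
    refine h1.congr (ae_of_all _ fun z => ?_)
    simp only [wedgeConj_self_re]
    ring
  have hJ : 2 * ∫ z, χ z * ‖G z e‖ ^ 2 ≤ C * (3 * r) ^ (2 * (k - 1)) * T.mass := by
    have h1 := hdom χ ⟨χ.contDiff, χ.hasCompactSupport, hχs.trans_subset hBΩ⟩
      (fun z => χ.nonneg) e
    have h2 : ∫ z, χ z * (wedgeConj (G z) e e).re = 2 * ∫ z, χ z * ‖G z e‖ ^ 2 := by
      rw [← integral_const_mul]
      refine integral_congr_ae (ae_of_all _ fun z => ?_)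
      simp only [wedgeConj_self_re]
      ring
    rw [← h2]
    refine h1.trans (le_trans ?_ (hL T hcl (3 * r) (by linarith) (by linarith)))
    rw [← setIntegral_eq_integral_of_forall_compl_eq_zero (s := B) (fun z hz => by
      rw [hχ0 z hz, zero_mul])]
    refine integral_mono_of_nonneg ?_ (T.integrableOn_traceDensity hk0 hκ hΩ
      (isCompact_closedBall _ _) hBΩ) ?_
    · filter_upwards [ae_restrict_mem Metric.isClosed_closedBall.measurableSet] with z hz
      exact mul_nonneg χ.nonneg (div_nonneg ((T.pos z (hBΩ hz)).2 e)
        (hκ.volDensity_pos (hBΩ hz)).le)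
    · filter_upwards [ae_restrict_mem Metric.isClosed_closedBall.measurableSet] with z hz
      have hd := hκ.volDensity_pos (hBΩ hz)
      have h3 : (T.θ z e e).re / volDensity (κ z) ≤ T.traceDensity z := by
        refine div_le_div_of_nonneg_right ?_ hd.le
        simpa [he1] using (T.pos z (hBΩ hz)).apply_self_le e
      exact (mul_le_of_le_one_left (div_nonneg ((T.pos z (hBΩ hz)).2 e) hd.le) χ.le_one).trans h3
  have hχi : ∫ z, χ z ≤ (3 * r) ^ (2 * k) * V := by
    rw [← setIntegral_eq_integral_of_forall_compl_eq_zero (s := B) hχ0, ← hvol]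
    have h1 := norm_setIntegral_le_of_norm_le_const (f := χ) (μ := volume)
      (isCompact_closedBall a (3 * r)).measure_lt_top (C := 1) fun z _ => by
        rw [Real.norm_of_nonneg χ.nonneg]; exact χ.le_one
    rw [one_mul] at h1
    exact (Real.le_norm_self _).trans h1
  have hχI : Integrable χ := χ.continuous.integrable_of_hasCompactSupport χ.hasCompactSupport
  -- Cauchy-Schwarz, in the form of a weighted arithmetic-geometric mean inequality
  have hup : ‖∫ z, G z e * ψ z‖ ≤ M * (τ * r) * (∫ z, χ z * ‖G z e‖ ^ 2) +
      M / (4 * (τ * r)) * ∫ z, χ z := by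
    rw [← integral_const_mul, ← integral_const_mul, ← integral_add (hGi.const_mul _)
      (hχI.const_mul _)]
    refine norm_integral_le_of_norm_le ((hGi.const_mul _).add (hχI.const_mul _))
      (ae_of_all _ fun z => ?_)
    have hlam : 0 < τ * r := by positivity
    by_cases hz : z ∈ tsupport ψ
    · rw [show χ z = 1 from χ.one_of_mem_closedBall (hψs hz), norm_mul]
      have h1 : ‖G z e‖ ≤ τ * r * ‖G z e‖ ^ 2 + 1 / (4 * (τ * r)) := by
        have h2 : τ * r * ‖G z e‖ ^ 2 + 1 / (4 * (τ * r)) - ‖G z e‖ =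
            (2 * (τ * r) * ‖G z e‖ - 1) ^ 2 / (4 * (τ * r)) := by
          field_simp
          ring
        have h3 : 0 ≤ (2 * (τ * r) * ‖G z e‖ - 1) ^ 2 / (4 * (τ * r)) := by positivity
        linarith
      calc ‖G z e‖ * ‖ψ z‖ ≤ (τ * r * ‖G z e‖ ^ 2 + 1 / (4 * (τ * r))) * M :=
            mul_le_mul h1 (hψM z) (norm_nonneg _) (by positivity)
        _ = _ := by ring
    · rw [image_eq_zero_of_notMem_tsupport hz, mul_zero, norm_zero]
      have := χ.nonneg (x := z)
      positivity
  rw [hweak, norm_neg] at hosc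
  have hkr : r ^ (2 * k) / r = r * r ^ (2 * (k - 1)) := by
    rw [show 2 * k = 2 * (k - 1) + 2 by omega, pow_add, pow_two]
    field_simp
  have h5 : M / (4 * (τ * r)) * ∫ z, χ z ≤ c / 4 * (r * r ^ (2 * (k - 1))) := by
    refine (mul_le_mul_of_nonneg_left hχi (by positivity)).trans (le_of_eq ?_)
    rw [← hkr, hτ, mul_pow]
    field_simp
  have h6 : M * (τ * r) * (∫ z, χ z * ‖G z e‖ ^ 2) ≤
      M * (τ * r) * (C * (3 * r) ^ (2 * (k - 1)) * T.mass / 2) :=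
    mul_le_mul_of_nonneg_left (by linarith) (by positivity)
  rw [hkr] at hosc
  have h7 : r * r ^ (2 * (k - 1)) * (c / 4) ≤
      r * r ^ (2 * (k - 1)) * (M * τ * C * 3 ^ (2 * (k - 1)) * T.mass / 2) := by
    have h8 : M * (τ * r) * (C * (3 * r) ^ (2 * (k - 1)) * T.mass / 2) =
        r * r ^ (2 * (k - 1)) * (M * τ * C * 3 ^ (2 * (k - 1)) * T.mass / 2) := by
      rw [mul_pow]; ring
    linarith
  have h9 := le_of_mul_le_mul_left h7 (by positivity)
  rw [div_le_iff₀ (by positivity)]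
  linarith

end

/-! ### Linear combinations of functions and of currents -/

section

section CommonDensity

variable {Y : Type*} [MeasurableSpace Y]

/-- On the set where `t` is not zero, the measure `μ` has the density `c` with respect to `ν`. -/
structure HasDensityOnSupport (ν μ : Measure Y) (c : Y → NNReal) (t : Y → ℝ) : Prop where
  measurable : Measurable c
  exists_set : ∃ D, MeasurableSet D ∧ (ν.withDensity fun y => (c y : ENNReal)) = μ.restrict D ∧
    t =ᵐ[μ.restrict Dᶜ] 0

variable {ν μ : Measure Y} {c : Y → NNReal} {t : Y → ℝ}

theorem HasDensityOnSupport.setIntegral_eq (h : HasDensityOnSupport ν μ c t) {S : Set Y}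
    (hS : MeasurableSet S) {b : Y → ℂ} (hb : ∀ᵐ y ∂(μ.restrict S), t y = 0 → b y = 0) :
    ∫ y in S, (c y : ℂ) * b y ∂ν = ∫ y in S, b y ∂μ := by
  obtain ⟨hc, D, hD, hν, ht⟩ := h
  have h1 : ∫ y in S, b y ∂(ν.withDensity fun y => (c y : ENNReal)) =
      ∫ y in S, (c y : ℂ) * b y ∂ν := by
    rw [restrict_withDensity hS, integral_withDensity_eq_integral_smul hc]
    rfl
  rw [← h1, hν, Measure.restrict_restrict hS]
  rw [setIntegral_eq_of_subset_of_ae_sdiff_eq_zero hS.nullMeasurableSet inter_subset_left]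
  have hSD : S \ (S ∩ D) = S ∩ Dᶜ := by
    ext y
    simp only [Set.mem_sdiff, mem_inter_iff, mem_compl_iff]
    tauto
  rw [← ae_restrict_iff' (hS.diff (hS.inter hD)), hSD]
  have h2 : ∀ᵐ y ∂(μ.restrict (S ∩ Dᶜ)), t y = 0 :=
    (ae_mono (Measure.restrict_mono inter_subset_right le_rfl)) ht
  have h3 := (ae_mono (Measure.restrict_mono (inter_subset_left (s := S) (t := Dᶜ))
    (le_refl μ))) hb
  filter_upwards [h2, h3] with y h4 h5 using h5 h4

theorem HasDensityOnSupport.integrableOn (h : HasDensityOnSupport ν μ c t) {S : Set Y}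
    (hS : MeasurableSet S) {b : Y → ℂ} (hb : IntegrableOn b S μ) :
    IntegrableOn (fun y => (c y : ℂ) * b y) S ν := by
  obtain ⟨hc, D, hD, hν, ht⟩ := h
  have h1 : IntegrableOn b S (ν.withDensity fun y => (c y : ENNReal)) := by
    rw [hν]
    exact hb.mono_measure Measure.restrict_le_self
  rw [IntegrableOn, restrict_withDensity hS, integrable_withDensity_iff_integrable_smul hc] at h1
  exact h1

theorem HasDensityOnSupport.aemeasurable (h : HasDensityOnSupport ν μ c t) {S : Set Y}
    (hS : MeasurableSet S) {b : Y → ℂ} (hb : AEMeasurable b (μ.restrict S)) :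
    AEMeasurable (fun y => (c y : ℂ) * b y) (ν.restrict S) := by
  obtain ⟨hc, D, hD, hν, ht⟩ := h
  have h1 : AEMeasurable b ((ν.withDensity fun y => (c y : ENNReal)).restrict S) := by
    rw [hν]
    exact hb.mono_measure (Measure.restrict_mono le_rfl Measure.restrict_le_self)
  rw [restrict_withDensity hS, aemeasurable_withDensity_iff hc] at h1
  exact h1

/-- Two measures have densities with respect to a common one, on the sets where given integrable
functions do not vanish. The measures need not be `σ`-finite, but their restrictions to these sets
are. -/
theorem exists_hasDensityOnSupport {μ₁ μ₂ : Measure Y} {t₁ t₂ : Y → ℝ} (h₁ : Integrable t₁ μ₁)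
    (h₂ : Integrable t₂ μ₂) : ∃ (ν : Measure Y) (c₁ c₂ : Y → NNReal),
      HasDensityOnSupport ν μ₁ c₁ t₁ ∧ HasDensityOnSupport ν μ₂ c₂ t₂ := by
  have key : ∀ (μ ν : Measure Y) [SigmaFinite μ] [SigmaFinite ν], μ ≤ ν →
      ∃ c : Y → NNReal, Measurable c ∧ (ν.withDensity fun y => (c y : ENNReal)) = μ := by
    intro μ ν _ _ hle
    refine ⟨fun y => (μ.rnDeriv ν y).toNNReal, (Measure.measurable_rnDeriv μ ν).ennreal_toNNReal, ?_⟩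
    rw [← Measure.withDensity_rnDeriv_eq μ ν (Measure.absolutelyContinuous_of_le hle)]
    refine withDensity_congr_ae ?_
    rw [Measure.withDensity_rnDeriv_eq μ ν (Measure.absolutelyContinuous_of_le hle)]
    filter_upwards [Measure.rnDeriv_lt_top μ ν] with y hy using ENNReal.coe_toNNReal hy.ne
  have a₁ := h₁.aefinStronglyMeasurable
  have a₂ := h₂.aefinStronglyMeasurable
  have s₁ : SigmaFinite (μ₁.restrict a₁.sigmaFiniteSet) := inferInstance
  have s₂ : SigmaFinite (μ₂.restrict a₂.sigmaFiniteSet) := inferInstance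
  obtain ⟨c₁, hc₁, e₁⟩ := key (μ₁.restrict a₁.sigmaFiniteSet)
    (μ₁.restrict a₁.sigmaFiniteSet + μ₂.restrict a₂.sigmaFiniteSet)
    (Measure.le_add_right le_rfl)
  obtain ⟨c₂, hc₂, e₂⟩ := key (μ₂.restrict a₂.sigmaFiniteSet)
    (μ₁.restrict a₁.sigmaFiniteSet + μ₂.restrict a₂.sigmaFiniteSet)
    (Measure.le_add_left le_rfl)
  exact ⟨_, c₁, c₂, ⟨hc₁, _, a₁.measurableSet, e₁, a₁.ae_eq_zero_compl⟩,
    ⟨hc₂, _, a₂.measurableSet, e₂, a₂.ae_eq_zero_compl⟩⟩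

end CommonDensity

variable {k : ℕ} {Ω : Set (Cn k)} {κ : Cn k → SesqForm (Cn k)}

/-- Square integrable functions are integrable on compact sets. -/
theorem integrable_mul_of_memLp (hκ : IsMetricOn Ω κ) (hΩ : IsOpen Ω) {f : Cn k → ℝ}
    (hf : MemLp f 2 (volumeOn Ω κ)) {χ : Cn k → ℂ} (hχ : Continuous χ) (hc : HasCompactSupport χ)
    (hs : tsupport χ ⊆ Ω) : Integrable fun z => (f z : ℂ) * χ z := by
  set K := tsupport χ with hK
  have hvc := continuousOn_volDensity hκ.continuousOn
  have hKm : MeasurableSet K := (isClosed_tsupport χ).measurableSet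
  have hfin : IsFiniteMeasure ((volumeOn Ω κ).restrict K) := by
    refine ⟨?_⟩
    rw [Measure.restrict_apply_univ, volumeOn, withDensity_apply _ hKm,
      Measure.restrict_restrict hKm, inter_eq_self_of_subset_left hs]
    have h1 : IntegrableOn (fun z => volDensity (κ z)) K :=
      (hvc.mono hs).integrableOn_compact hc
    exact lt_of_le_of_lt (lintegral_mono fun z => Real.ofReal_le_enorm _) h1.2
  have h1 : IntegrableOn f K (volumeOn Ω κ) :=
    (hf.mono_measure Measure.restrict_le_self).integrable (by norm_num)
  have h2 : IntegrableOn (fun z => volDensity (κ z) • f z) K := by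
    have h3 := (integrable_volumeOn_iff hκ hΩ (F := K.indicator f)).1
      ((integrable_indicator_iff hKm).2 h1)
    refine (h3.mono_set hs).congr_fun (fun z hz => ?_) hKm
    simp only [indicator_of_mem hz]
  have h4 : IntegrableOn (fun z => ((volDensity (κ z) • f z : ℝ) : ℂ) *
      (((volDensity (κ z))⁻¹ : ℝ) * χ z)) K := by
    refine IntegrableOn.mul_continuousOn h2.ofReal ?_ hc
    refine (Complex.continuous_ofReal.comp_continuousOn ((hvc.mono hs).inv₀ fun z hz =>
      (hκ.volDensity_pos (hs hz)).ne')).mul hχ.continuousOn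
  have h5 : IntegrableOn (fun z => (f z : ℂ) * χ z) K := by
    refine h4.congr_fun (fun z hz => ?_) hKm
    have := (hκ.volDensity_pos (hs hz)).ne'
    have h6 : (volDensity (κ z) : ℂ) ≠ 0 := by exact_mod_cast this
    simp only [smul_eq_mul]
    push_cast
    field_simp
  refine (integrableOn_iff_integrable_of_support_subset fun z hz => ?_).1 h5
  exact subset_tsupport χ (right_ne_zero_of_mul hz)

theorem HasL2DelOn.integrable_mul (hk : 0 < k) (hκ : IsMetricOn Ω κ) (hΩ : IsOpen Ω)
    {f : Cn k → ℝ} {G : Cn k → Cn k →ₗ[ℂ] ℂ} (hG : HasL2DelOn Ω κ f G) {χ : Cn k → ℂ}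
    (hχ : Continuous χ) (hc : HasCompactSupport χ) (hs : tsupport χ ⊆ Ω) (v : Cn k) :
    Integrable fun z => G z v * χ z := by
  have hns : tsupport (fun z => ‖χ z‖) = tsupport χ := by
    simp only [tsupport]
    congr 1
    ext z
    simp
  have h1 := hG.integrable_mul_wedgeConj hk hκ hΩ hχ.norm hc.norm (hns.trans_subset hs) v
  have h2 : Integrable fun z => ‖χ z‖ := (hχ.integrable_of_hasCompactSupport hc).norm
  have h3 : IntegrableOn (fun z => G z v * χ z) Ω := by
    refine Integrable.mono' (h1.add h2).integrableOn
      ((hG.1.1 v).mul hχ.aestronglyMeasurable) (ae_of_all _ fun z => ?_)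
    rw [norm_mul, Pi.add_apply, wedgeConj_self_re]
    nlinarith [norm_nonneg (χ z), sq_nonneg (‖G z v‖ - 1 / 2), sq_nonneg ‖G z v‖,
      mul_nonneg (norm_nonneg (χ z)) (sq_nonneg (‖G z v‖ - 1 / 2)),
      mul_nonneg (norm_nonneg (χ z)) (sq_nonneg (‖G z v‖))]
  refine (integrableOn_iff_integrable_of_support_subset fun z hz => ?_).1 h3
  exact hs (subset_tsupport χ (right_ne_zero_of_mul hz))

theorem HasL2DelOn.sub (hk : 0 < k) (hκ : IsMetricOn Ω κ) (hΩ : IsOpen Ω)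
    {f₁ f₂ : Cn k → ℝ} {G₁ G₂ : Cn k → Cn k →ₗ[ℂ] ℂ} (hf₁ : MemLp f₁ 2 (volumeOn Ω κ))
    (hf₂ : MemLp f₂ 2 (volumeOn Ω κ)) (h₁ : HasL2DelOn Ω κ f₁ G₁) (h₂ : HasL2DelOn Ω κ f₂ G₂) :
    HasL2DelOn Ω κ (f₁ - f₂) (fun z => G₁ z - G₂ z) := by
  have hm : ∀ v, AEStronglyMeasurable (fun z => (G₁ z - G₂ z) v) (volume.restrict Ω) := fun v =>
    (h₁.1.1 v).sub (h₂.1.1 v)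
  refine ⟨⟨hm, fun χ hχ v => ?_⟩, ?_⟩
  · obtain ⟨hsm, hc, hs⟩ := hχ
    have hdc : Continuous fun z => del χ z v := (ContDiff.del hsm v).continuous
    have hdcs := hasCompactSupport_del hc v
    have hds := (tsupport_del_subset χ v).trans hs
    have i1 := integrable_mul_of_memLp hκ hΩ hf₁ hdc hdcs hds
    have i2 := integrable_mul_of_memLp hκ hΩ hf₂ hdc hdcs hds
    have j1 := h₁.integrable_mul hk hκ hΩ hsm.continuous hc hs v
    have j2 := h₂.integrable_mul hk hκ hΩ hsm.continuous hc hs v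
    have e1 : (fun z => (((f₁ - f₂) z : ℝ) : ℂ) * del χ z v) =
        fun z => (f₁ z : ℂ) * del χ z v - (f₂ z : ℂ) * del χ z v := by
      funext z; simp only [Pi.sub_apply]; push_cast; ring
    have e2 : (fun z => (G₁ z - G₂ z) v * χ z) = fun z => G₁ z v * χ z - G₂ z v * χ z := by
      funext z; simp only [LinearMap.sub_apply]; ring
    rw [e1, e2, integral_sub i1 i2, integral_sub j1 j2, h₁.1.2 χ ⟨hsm, hc, hs⟩ v,
      h₂.1.2 χ ⟨hsm, hc, hs⟩ v]
    ring
  · refine Integrable.mono' ((h₁.2.const_mul 2).add (h₂.2.const_mul 2)) ?_ ?_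
    · have h3 : AEStronglyMeasurable (fun z => trace (κ z) (wedgeConj (G₁ z - G₂ z)))
          (volume.restrict Ω) :=
        aestronglyMeasurable_trace hΩ.measurableSet hκ.continuousOn hκ.pos
          (aestronglyMeasurable_wedgeConj_apply hm)
      exact h3.mono_ac volumeOn_absolutelyContinuous
    · have h4 : ∀ᵐ z ∂(volumeOn Ω κ), z ∈ Ω :=
        volumeOn_absolutelyContinuous.ae_le (ae_restrict_mem hΩ.measurableSet)
      filter_upwards [h4] with z hz
      rw [Real.norm_of_nonneg (trace_nonneg (hκ.pos z hz) (isPosForm_wedgeConj _))]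
      exact trace_wedgeConj_sub_le (hκ.pos z hz) _ _

theorem CurrentOn.integral_mul_re (hk : 0 < k) (hκ : IsMetricOn Ω κ) (hΩ : IsOpen Ω)
    (T : CurrentOn Ω κ) {χ : Cn k → ℝ} (hχ : IsTest Ω χ) (v : Cn k) :
    ∫ z, χ z * ((T.θ z v v).re / volDensity (κ z)) ∂T.μ =
      (∫ z, (χ z : ℂ) * (T.θ z v v / (volDensity (κ z) : ℂ)) ∂T.μ).re := by
  have hs' : tsupport (fun z => (χ z : ℂ)) ⊆ tsupport χ :=
    closure_mono fun z hz h => hz (by simp [h])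
  have h1 := T.integrable_mul hk hκ hΩ (χ := fun z => (χ z : ℂ))
    (Complex.continuous_ofReal.comp hχ.1.continuous)
    (hχ.2.1.of_isClosed_subset (isClosed_tsupport _) hs') (hs'.trans hχ.2.2) v v
  have h2 := integral_re (𝕜 := ℂ) h1
  rw [RCLike.re_eq_complex_re] at h2
  rw [← h2]
  refine integral_congr_ae (ae_of_all _ fun z => ?_)
  simp only [Complex.re_ofReal_mul, Complex.div_ofReal_re]

/-- The current `2 T₁ + 2 T₂` controls the difference of the functions controlled by `T₁` and
`T₂`. -/
theorem controls_sub (hk : 0 < k) (hκ : IsMetricOn Ω κ) (hΩ : IsOpen Ω)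
    {f₁ f₂ : Cn k → ℝ} {G₁ G₂ : Cn k → Cn k →ₗ[ℂ] ℂ}
    (h₁ : HasL2DelOn Ω κ f₁ G₁) (h₂ : HasL2DelOn Ω κ f₂ G₂) {T T₁ T₂ : CurrentOn Ω κ}
    (hT : ∀ χ : Cn k → ℂ, IsTest Ω χ → ∀ v w,
      ∫ z, χ z * (T.θ z v w / (volDensity (κ z) : ℂ)) ∂T.μ =
        2 * ∫ z, χ z * (T₁.θ z v w / (volDensity (κ z) : ℂ)) ∂T₁.μ +
        2 * ∫ z, χ z * (T₂.θ z v w / (volDensity (κ z) : ℂ)) ∂T₂.μ)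
    (c₁ : IsClosedOn Ω κ T₁.θ T₁.μ) (c₂ : IsClosedOn Ω κ T₂.θ T₂.μ)
    (d₁ : IsDominatedOn Ω κ G₁ T₁.θ T₁.μ) (d₂ : IsDominatedOn Ω κ G₂ T₂.θ T₂.μ) :
    IsClosedOn Ω κ T.θ T.μ ∧ IsDominatedOn Ω κ (fun z => G₁ z - G₂ z) T.θ T.μ := by
  constructor
  · intro χ hχ u v w
    have hd : ∀ u, IsTest Ω fun z => del χ z u := fun u =>
      ⟨ContDiff.del hχ.1 u, hasCompactSupport_del hχ.2.1 u, (tsupport_del_subset χ u).trans hχ.2.2⟩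
    rw [hT _ (hd u), hT _ (hd w), c₁ χ hχ, c₂ χ hχ]
  · intro χ hχ h0 v
    have hχ' : IsTest Ω fun z => (χ z : ℂ) := by
      have hs' : tsupport (fun z => (χ z : ℂ)) ⊆ tsupport χ :=
        closure_mono fun z hz h => hz (by simp [h])
      exact ⟨Complex.ofRealCLM.contDiff.comp hχ.1,
        hχ.2.1.of_isClosed_subset (isClosed_tsupport _) hs', hs'.trans hχ.2.2⟩
    have h3 := congrArg Complex.re (hT _ hχ' v v)
    rw [Complex.add_re, show (2 : ℂ) = ((2 : ℝ) : ℂ) by norm_num, Complex.re_ofReal_mul,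
      Complex.re_ofReal_mul, ← T.integral_mul_re hk hκ hΩ hχ, ← T₁.integral_mul_re hk hκ hΩ hχ,
      ← T₂.integral_mul_re hk hκ hΩ hχ] at h3
    rw [h3]
    have i1 := h₁.integrable_mul_wedgeConj hk hκ hΩ hχ.1.continuous hχ.2.1 hχ.2.2 v
    have i2 := h₂.integrable_mul_wedgeConj hk hκ hΩ hχ.1.continuous hχ.2.1 hχ.2.2 v
    have h4 : ∫ z, χ z * (wedgeConj (G₁ z - G₂ z) v v).re ≤
        ∫ z, (2 * (χ z * (wedgeConj (G₁ z) v v).re) + 2 * (χ z * (wedgeConj (G₂ z) v v).re)) := by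
      refine integral_mono_of_nonneg (ae_of_all _ fun z => mul_nonneg (h0 z)
        ((isPosForm_wedgeConj _).2 v)) ((i1.const_mul 2).add (i2.const_mul 2))
        (ae_of_all _ fun z => ?_)
      simp only [wedgeConj_self_re, LinearMap.sub_apply]
      have h5 : ‖G₁ z v - G₂ z v‖ ^ 2 ≤ 2 * ‖G₁ z v‖ ^ 2 + 2 * ‖G₂ z v‖ ^ 2 := by
        have h6 := norm_sub_le (G₁ z v) (G₂ z v)
        nlinarith [sq_nonneg (‖G₁ z v‖ - ‖G₂ z v‖), norm_nonneg (G₁ z v - G₂ z v)]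
      nlinarith [mul_le_mul_of_nonneg_left h5 (h0 z)]
    refine h4.trans ?_
    rw [integral_add (i1.const_mul 2) (i2.const_mul 2), integral_const_mul, integral_const_mul]
    have h7 := d₁ χ hχ h0 v
    have h8 := d₂ χ hχ h0 v
    linarith

theorem apply_eq_zero_of_trace_eq_zero {κ h : SesqForm (Cn k)} (hκ : IsPosDefForm κ)
    (hh : IsPosForm h) (h0 : trace κ h = 0) : h = 0 := by
  obtain ⟨m, hm, hb⟩ := exists_stdTrace_le_trace (isCompact_singleton (x := (0 : Cn k)))
    (κ := fun _ => κ) (fun v w => continuousOn_const) fun _ _ => hκ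
  have h1 := hb 0 rfl h hh
  rw [h0] at h1
  have h2 : stdTrace h ≤ 0 := nonpos_of_mul_nonpos_right h1 hm
  have h3 : ∀ v, (h v v).re = 0 := fun v =>
    le_antisymm ((hh.apply_self_le v).trans (mul_nonpos_of_nonneg_of_nonpos (by positivity) h2))
      (hh.2 v)
  ext v w
  have h4 := hh.norm_apply_le v w
  rw [h3, h3] at h4
  simpa using norm_le_zero_iff.1 (h4.trans (by norm_num))

/-- The current is `2 T₁ + 2 T₂`, written with respect to a measure for which the measures of `T₁` and
`T₂` have densities. -/
theorem exists_controls_sub (hk : 0 < k) (hκ : IsMetricOn Ω κ) (hΩ : IsOpen Ω) {f₁ f₂ : Cn k → ℝ}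
    (hf₁ : MemLp f₁ 2 (volumeOn Ω κ)) (hf₂ : MemLp f₂ 2 (volumeOn Ω κ)) {T₁ T₂ : CurrentOn Ω κ}
    (h₁ : T₁.Controls f₁) (h₂ : T₂.Controls f₂) : ∃ T : CurrentOn Ω κ, T.Controls (f₁ - f₂) := by
  obtain ⟨cl₁, G₁, hG₁, d₁⟩ := h₁
  obtain ⟨cl₂, G₂, hG₂, d₂⟩ := h₂
  obtain ⟨ν, c₁, c₂, hc₁, hc₂⟩ := exists_hasDensityOnSupport T₁.finite_mass T₂.finite_mass
  have hΩm := hΩ.measurableSet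
  have hrr : ∀ μ : Measure (Cn k), (μ.restrict Ω).restrict Ω = μ.restrict Ω := fun μ => by
    rw [Measure.restrict_restrict hΩm, inter_self]
  have hvan : ∀ (S : CurrentOn Ω κ), ∀ z ∈ Ω, trace (κ z) (S.θ z) = 0 → S.θ z = 0 :=
    fun S z hz h0 => apply_eq_zero_of_trace_eq_zero (hκ.pos z hz) (S.pos z hz) h0
  let T : CurrentOn Ω κ :=
    { μ := ν
      θ := fun z => ((2 * c₁ z : ℝ) : ℂ) • T₁.θ z + ((2 * c₂ z : ℝ) : ℂ) • T₂.θ z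
      pos := fun z hz => ((T₁.pos z hz).smul (by positivity)).add
        ((T₂.pos z hz).smul (by positivity))
      meas := fun v w => by
        have m₁ := hc₁.aemeasurable hΩm (b := fun z => T₁.θ z v w) (by
          rw [hrr]; exact T₁.meas v w)
        have m₂ := hc₂.aemeasurable hΩm (b := fun z => T₂.θ z v w) (by
          rw [hrr]; exact T₂.meas v w)
        refine ((m₁.const_mul 2).add (m₂.const_mul 2)).congr (ae_of_all _ fun z => ?_)
        simp only [Pi.add_apply, LinearMap.add_apply, LinearMap.smul_apply, smul_eq_mul]
        push_cast
        ring
      finite_mass := by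
        have m₁ := (hc₁.integrableOn hΩm (b := fun z => ((trace (κ z) (T₁.θ z) : ℝ) : ℂ)) (by
          rw [IntegrableOn, hrr]; exact T₁.finite_mass.ofReal)).re
        have m₂ := (hc₂.integrableOn hΩm (b := fun z => ((trace (κ z) (T₂.θ z) : ℝ) : ℂ)) (by
          rw [IntegrableOn, hrr]; exact T₂.finite_mass.ofReal)).re
        refine ((m₁.const_mul 2).add (m₂.const_mul 2)).congr (ae_of_all _ fun z => ?_)
        simp only [Pi.add_apply, trace_add, trace_smul, RCLike.re_eq_complex_re,
          Complex.re_ofReal_mul, Complex.ofReal_re]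
        ring }
  have hT : ∀ χ : Cn k → ℂ, IsTest Ω χ → ∀ v w,
      ∫ z, χ z * (T.θ z v w / (volDensity (κ z) : ℂ)) ∂T.μ =
        2 * ∫ z, χ z * (T₁.θ z v w / (volDensity (κ z) : ℂ)) ∂T₁.μ +
        2 * ∫ z, χ z * (T₂.θ z v w / (volDensity (κ z) : ℂ)) ∂T₂.μ := by
    intro χ hχ v w
    have hsupp : ∀ (θ : Cn k → SesqForm (Cn k)) (μ : Measure (Cn k)),
        ∫ z in Ω, χ z * (θ z v w / (volDensity (κ z) : ℂ)) ∂μ =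
        ∫ z, χ z * (θ z v w / (volDensity (κ z) : ℂ)) ∂μ := fun θ μ =>
      setIntegral_eq_integral_of_forall_compl_eq_zero fun z hz => by
        rw [image_eq_zero_of_notMem_tsupport fun h => hz (hχ.2.2 h), zero_mul]
    have hb : ∀ (S : CurrentOn Ω κ), ∀ᵐ z ∂((S.μ.restrict Ω).restrict Ω),
        trace (κ z) (S.θ z) = 0 → χ z * (S.θ z v w / (volDensity (κ z) : ℂ)) = 0 := by
      intro S
      filter_upwards [ae_restrict_mem hΩm] with z hz h0
      rw [hvan S z hz h0]; simp
    have hi : ∀ (S : CurrentOn Ω κ), IntegrableOn (fun z => χ z *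
        (S.θ z v w / (volDensity (κ z) : ℂ))) Ω (S.μ.restrict Ω) := fun S =>
      (S.integrable_mul hk hκ hΩ hχ.1.continuous hχ.2.1 hχ.2.2 v w).restrict.restrict
    have e₁ := hc₁.setIntegral_eq hΩm (hb T₁)
    have e₂ := hc₂.setIntegral_eq hΩm (hb T₂)
    rw [hrr, hsupp] at e₁ e₂
    rw [← hsupp, ← e₁, ← e₂, ← integral_const_mul, ← integral_const_mul, ← integral_add
      ((hc₁.integrableOn hΩm (hi T₁)).const_mul 2) ((hc₂.integrableOn hΩm (hi T₂)).const_mul 2)]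
    refine integral_congr_ae (ae_of_all _ fun z => ?_)
    simp only [T, LinearMap.add_apply, LinearMap.smul_apply, smul_eq_mul]
    push_cast
    ring
  obtain ⟨hcl, hd⟩ := controls_sub hk hκ hΩ hG₁ hG₂ hT cl₁ cl₂ d₁ d₂
  exact ⟨T, hcl, _, hG₁.sub hk hκ hΩ hf₁ hf₂ hG₂, hd⟩

end

/-! ### Currents with smooth coefficients outside a point -/

section

variable {k : ℕ} {Ω : Set (Cn k)} {κ : Cn k → SesqForm (Cn k)} {a : Cn k}

theorem integral_volumeOn_mul_div (hκ : IsMetricOn Ω κ) (hΩ : IsOpen Ω) {F : Cn k → ℂ}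
    (hF : ∀ z, z ∉ Ω → F z = 0) (θ : Cn k → SesqForm (Cn k)) (v w : Cn k) :
    ∫ z, F z * (θ z v w / (volDensity (κ z) : ℂ)) ∂(volumeOn Ω κ) = ∫ z, F z * θ z v w := by
  rw [integral_volumeOn hκ hΩ, ← setIntegral_eq_integral_of_forall_compl_eq_zero (s := Ω)
    (f := fun z => F z * θ z v w) (fun z hz => by rw [hF z hz, zero_mul])]
  refine setIntegral_congr_fun hΩ.measurableSet fun z hz => ?_
  have hd : (volDensity (κ z) : ℂ) ≠ 0 := by exact_mod_cast (hκ.volDensity_pos hz).ne'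
  simp only [Complex.real_smul]
  field_simp

theorem isClosedOn_of_pole (hk : 2 ≤ k) (hκ : IsMetricOn Ω κ) (hΩ : IsOpen Ω)
    {θ : Cn k → SesqForm (Cn k)}
    (hθ : ∀ z ∈ Ω, z ≠ a → ∀ v w, ContDiffAt ℝ ∞ (fun y => θ y v w) z)
    (hb : ∀ v w, HasPoleBound Ω a 2 (fun z => θ z v w))
    (hcl : ∀ z ∈ Ω, z ≠ a → ∀ u v w, del (fun y => θ y v w) z u = del (fun y => θ y v u) z w) :
    IsClosedOn Ω κ θ (volumeOn Ω κ) := by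
  intro χ hχ u v w
  have h0 : ∀ u, ∀ z, z ∉ Ω → del χ z u = 0 := fun u z hz =>
    image_eq_zero_of_notMem_tsupport (f := fun z => del χ z u)
      fun h => hz (hχ.2.2 (tsupport_del_subset χ u h))
  rw [integral_volumeOn_mul_div hκ hΩ (h0 u), integral_volumeOn_mul_div hκ hΩ (h0 w)]
  exact integral_closed_of_pole hk hΩ hθ hb hcl hχ u v w

theorem ae_ne (hk : 2 ≤ k) (a : Cn k) : ∀ᵐ z : Cn k, z ≠ a := by
  have := nontrivial_Cn hk
  rw [ae_iff]; simp

theorem isDominatedOn_of_pole (hk : 2 ≤ k) (hκ : IsMetricOn Ω κ) (hΩ : IsOpen Ω)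
    {θ : Cn k → SesqForm (Cn k)} {G : Cn k → Cn k →ₗ[ℂ] ℂ}
    (hb : ∀ v w, HasPoleBound Ω a 2 (fun z => θ z v w))
    (hle : ∀ z ∈ Ω, z ≠ a → ∀ v, (wedgeConj (G z) v v).re ≤ (θ z v v).re) :
    IsDominatedOn Ω κ G θ (volumeOn Ω κ) := by
  intro χ hχ h0 v
  have hχΩ : ∀ z, z ∉ Ω → χ z = 0 := fun z hz =>
    image_eq_zero_of_notMem_tsupport fun h => hz (hχ.2.2 h)
  have h1 : ∫ z, χ z * ((θ z v v).re / volDensity (κ z)) ∂(volumeOn Ω κ) =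
      ∫ z, χ z * (θ z v v).re := by
    rw [integral_volumeOn hκ hΩ, ← setIntegral_eq_integral_of_forall_compl_eq_zero (s := Ω)
      (f := fun z => χ z * (θ z v v).re) (fun z hz => by rw [hχΩ z hz, zero_mul])]
    refine setIntegral_congr_fun hΩ.measurableSet fun z hz => ?_
    have hd := (hκ.volDensity_pos hz).ne'
    simp only [smul_eq_mul]
    field_simp
  rw [h1]
  have hs' : tsupport (fun z => (χ z : ℂ)) ⊆ tsupport χ :=
    closure_mono fun z hz h => hz (by simp [h])
  have h2 := ((hb v v).integrable_mul hk hΩ (by norm_num) (χ := fun z => (χ z : ℂ))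
    (Complex.continuous_ofReal.comp hχ.1.continuous)
    (hχ.2.1.of_isClosed_subset (isClosed_tsupport _) hs') (hs'.trans hχ.2.2)).re
  have h3 : Integrable fun z => χ z * (θ z v v).re := by
    refine h2.congr (ae_of_all _ fun z => ?_)
    simp only [RCLike.re_eq_complex_re]
    rw [mul_comm, Complex.re_ofReal_mul]
  refine integral_mono_of_nonneg (ae_of_all _ fun z => mul_nonneg (h0 z)
    ((isPosForm_wedgeConj _).2 v)) h3 ?_
  filter_upwards [ae_ne hk a] with z hz
  by_cases hzΩ : z ∈ Ω
  · exact mul_le_mul_of_nonneg_left (hle z hzΩ hz v) (h0 z)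
  · simp [hχΩ z hzΩ]

theorem HasPoleBound.aestronglyMeasurable {m : ℕ} (hk : 2 ≤ k) (hΩ : IsOpen Ω) {F : Cn k → ℂ}
    (hF : HasPoleBound Ω a m F) : AEStronglyMeasurable F (volume.restrict Ω) := by
  have h1 := hF.continuousOn.aestronglyMeasurable (μ := volume)
    (hΩ.sdiff isClosed_singleton).measurableSet
  have h2 : volume.restrict (Ω \ {a}) = (volume.restrict Ω : Measure (Cn k)) := by
    have := nontrivial_Cn hk
    exact Measure.restrict_congr_set (sdiff_null_ae_eq_self (by simp))
  rwa [h2] at h1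

theorem HasPoleBound.integrableOn {m : ℕ} (hk : 2 ≤ k) (hΩ : IsOpen Ω) (hm : m ≤ 3) {F : Cn k → ℂ}
    (hF : HasPoleBound Ω a m F) {K : Set (Cn k)} (hK : IsCompact K) (hKΩ : K ⊆ Ω) :
    IntegrableOn F K := by
  obtain ⟨C, hC0, hC⟩ := hF.bound K hKΩ hK
  refine ((integrableOn_inv_norm_pow hk a hm hK.isBounded).const_mul C).mono'
    ((hF.aestronglyMeasurable hk hΩ).mono_measure (Measure.restrict_mono hKΩ le_rfl)) ?_
  filter_upwards [ae_restrict_mem hK.measurableSet, ae_restrict_of_ae (ae_ne hk a)] with z hz hza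
  have hpos : 0 < ‖z - a‖ ^ m := pow_pos (norm_pos_iff.2 (sub_ne_zero.2 hza)) m
  rw [← div_eq_mul_inv, le_div_iff₀ hpos]
  exact hC z hz hza

theorem integrableOn_trace_of_pole (hk : 2 ≤ k) (hκ : IsMetricOn Ω κ) (hΩ : IsOpen Ω)
    {θ : Cn k → SesqForm (Cn k)} (hb : ∀ v w, HasPoleBound Ω a 2 (fun z => θ z v w))
    {K : Set (Cn k)} (hK : IsCompact K) (hKΩ : K ⊆ Ω) :
    IntegrableOn (fun z => trace (κ z) (θ z)) K (volumeOn Ω κ) := by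
  have h1 : IntegrableOn (fun z => volDensity (κ z) • trace (κ z) (θ z)) K := by
    have hi : ∀ i j : Fin k, IntegrableOn (fun z => (volDensity (κ z) : ℂ) * (coeff (κ z))⁻¹ i j *
        θ z (EuclideanSpace.single j 1) (EuclideanSpace.single i 1)) K := by
      intro i j
      refine ((hb _ _).integrableOn hk hΩ (by norm_num) hK hKΩ).continuousOn_mul ?_ hK
      refine ContinuousOn.mono (ContinuousOn.mul (Complex.continuous_ofReal.comp_continuousOn
        (continuousOn_volDensity hκ.continuousOn)) ?_) hKΩ
      have h2 := continuousOn_coeff_inv hκ.continuousOn hκ.pos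
      exact ((continuous_apply_apply i j).comp_continuousOn h2)
    have h3 : (fun z => volDensity (κ z) • trace (κ z) (θ z)) = fun z => ∑ i, ∑ j,
        ((volDensity (κ z) : ℂ) * (coeff (κ z))⁻¹ i j *
          θ z (EuclideanSpace.single j 1) (EuclideanSpace.single i 1)).re := by
      funext z
      simp only [trace_eq_sum, smul_eq_mul, Finset.mul_sum, mul_assoc, Complex.re_ofReal_mul]
    rw [h3]
    exact integrable_finsetSum _ fun i _ => integrable_finsetSum _ fun j _ => (hi i j).re
  have h2 := (integrable_volumeOn_iff hκ hΩ
    (F := K.indicator fun z => trace (κ z) (θ z))).2 (by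
      have h3 : (fun z => volDensity (κ z) • K.indicator (fun z => trace (κ z) (θ z)) z) =
          K.indicator fun z => volDensity (κ z) • trace (κ z) (θ z) := by
        funext z
        by_cases hz : z ∈ K <;> simp [hz]
      rw [h3]
      exact ((integrable_indicator_iff hK.measurableSet).2 h1).integrableOn)
  exact (integrable_indicator_iff hK.measurableSet).1 h2

/-- Outside of the singularity the form `i ∂f ∧ ∂̄f` of the model function is dominated by
`A κ + (i/2) ∂∂̄u`, where `u` is the model potential. -/
theorem exists_norm_del_modelFun_sq_le (hκ : IsMetricOn Ω κ) (i : Fin k) (β : ContDiffBump a)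
    (hβ : Metric.closedBall a β.rOut ⊆ Ω) : ∃ A : ℝ, 0 ≤ A ∧ ∀ z ∈ Ω, z ≠ a → ∀ v,
      2 * ‖del (fun y => (modelFun i β y : ℂ)) z v‖ ^ 2 ≤
        A * (κ z v v).re + (levi (modelPot β) z v v).re := by
  obtain ⟨K, hKdef⟩ : ∃ K, K = Metric.closedBall a β.rOut \ Metric.ball a β.rIn := ⟨_, rfl⟩
  have hK : IsCompact K := hKdef ▸ (isCompact_closedBall _ _).diff Metric.isOpen_ball
  have hKΩ : K ⊆ Ω := hKdef ▸ sdiff_subset.trans hβ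
  have hKa : ∀ z ∈ K, z ≠ a := by
    rintro z hz rfl
    rw [hKdef] at hz
    exact hz.2 (Metric.mem_ball_self β.rIn_pos)
  obtain ⟨m, hm, hmK⟩ := exists_norm_sq_le hK (fun v w => (hκ.continuousOn v w).mono hKΩ)
    fun z hz => hκ.pos z (hKΩ hz)
  obtain ⟨C₁, hC₁⟩ := hK.exists_bound_of_continuousOn
    (f := fun z => fderiv ℝ (fun y => (modelFun i β y : ℂ)) z) fun z hz =>
      ((ContDiffAt.ofReal (contDiffAt_modelFun i β (hKa z hz))).fderiv_right
        (m := ∞) (by simp)).continuousAt.continuousWithinAt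
  obtain ⟨C₂, hC₂⟩ := hK.exists_bound_of_continuousOn
    (f := fun z => fderiv ℝ (fderiv ℝ (modelPot β)) z) fun z hz =>
      (ContDiffAt.fderiv_right (m := ∞) (n := ∞) ((contDiffAt_modelPot β (hKa z hz)).fderiv_right
        (by simp)) (by simp)).continuousAt.continuousWithinAt
  refine ⟨(2 * C₁ ^ 2 + |C₂|) / m, by positivity, fun z hz hza v => ?_⟩
  have hκv : 0 ≤ (κ z v v).re := (hκ.pos z hz).isPosForm.2 v
  by_cases h1 : z ∈ Metric.ball a β.rIn
  · have h2 := two_mul_norm_del_modelFun_sq_le i β h1 hza v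
    have : 0 ≤ (2 * C₁ ^ 2 + |C₂|) / m * (κ z v v).re := by positivity
    linarith
  · by_cases h2 : z ∈ Metric.closedBall a β.rOut
    · have hzK : z ∈ K := hKdef ▸ ⟨h2, h1⟩
      have h3 := hmK z hzK v
      have h4 : ‖del (fun y => (modelFun i β y : ℂ)) z v‖ ≤ C₁ * ‖v‖ :=
        (norm_del_le _ _ _).trans (mul_le_mul_of_nonneg_right (hC₁ z hzK) (norm_nonneg _))
      have h5 : ‖levi (modelPot β) z v v‖ ≤ C₂ * ‖v‖ * ‖v‖ :=
        (norm_levi_le _ _ _ _).trans (by have := hC₂ z hzK; gcongr)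
      have h6 := (abs_le.1 ((Complex.abs_re_le_norm _).trans h5)).1
      have h7 : 2 * ‖del (fun y => (modelFun i β y : ℂ)) z v‖ ^ 2 ≤ 2 * (C₁ * ‖v‖) ^ 2 := by gcongr
      have h8 : (2 * C₁ ^ 2 + |C₂|) * ‖v‖ ^ 2 ≤ (2 * C₁ ^ 2 + |C₂|) / m * (κ z v v).re := by
        rw [div_mul_eq_mul_div, le_div_iff₀ hm, mul_assoc]
        exact mul_le_mul_of_nonneg_left (by linarith) (by positivity)
      have h9 : C₂ * ‖v‖ * ‖v‖ ≤ |C₂| * ‖v‖ ^ 2 := by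
        rw [mul_assoc, ← sq]
        exact mul_le_mul_of_nonneg_right (le_abs_self _) (by positivity)
      nlinarith
    · have h3 : (fun y => (modelFun i β y : ℂ)) =ᶠ[𝓝 z] fun _ => 0 := by
        filter_upwards [Metric.isClosed_closedBall.isOpen_compl.mem_nhds h2] with y hy
        rw [modelFun_eq_zero i β hy]; simp
      have h4 : modelPot β =ᶠ[𝓝 z] fun _ => 0 := by
        filter_upwards [Metric.isClosed_closedBall.isOpen_compl.mem_nhds h2] with y hy
        rw [modelPot_eq_zero β hy]
      rw [del_congr h3, levi_congr h4]
      have h5 : del (fun _ : Cn k => (0 : ℂ)) z v = 0 := by simp [del]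
      have h6 : levi (fun _ : Cn k => (0 : ℝ)) z v v = 0 := by simp [levi_apply]
      rw [h5, h6]
      simp
      positivity

end

/-! ### The model function belongs to the space `W*`, locally -/

section

variable {k : ℕ} {Ω : Set (Cn k)} {κ : Cn k → SesqForm (Cn k)} {a : Cn k}

theorem HasPoleBound.of_continuousOn {m : ℕ} {F : Cn k → ℂ} (hF : ContinuousOn F Ω) :
    HasPoleBound Ω a m F := by
  refine ⟨hF.mono sdiff_subset, fun K hK hKc => ?_⟩
  obtain ⟨C, hC⟩ := hKc.exists_bound_of_continuousOn
    (f := fun z => ‖F z‖ * ‖z - a‖ ^ m) (((hF.mono hK).norm).mul (by fun_prop))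
  refine ⟨|C|, abs_nonneg _, fun z hz _ => ?_⟩
  exact (Real.le_norm_self _).trans ((hC z hz).trans (le_abs_self _))

theorem HasPoleBound.congr {m : ℕ} {F F' : Cn k → ℂ} (hF : HasPoleBound Ω a m F)
    (h : ∀ z ∈ Ω, z ≠ a → F' z = F z) : HasPoleBound Ω a m F' := by
  refine ⟨hF.continuousOn.congr fun z hz => h z hz.1 hz.2, fun K hK hKc => ?_⟩
  obtain ⟨C, hC0, hC⟩ := hF.bound K hK hKc
  exact ⟨C, hC0, fun z hz hza => by rw [h z (hK hz) hza]; exact hC z hz hza⟩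

theorem HasPoleBound.add {m : ℕ} {F F' : Cn k → ℂ} (hF : HasPoleBound Ω a m F)
    (hF' : HasPoleBound Ω a m F') : HasPoleBound Ω a m fun z => F z + F' z := by
  refine ⟨hF.continuousOn.add hF'.continuousOn, fun K hK hKc => ?_⟩
  obtain ⟨C, hC0, hC⟩ := hF.bound K hK hKc
  obtain ⟨C', hC0', hC'⟩ := hF'.bound K hK hKc
  refine ⟨C + C', by positivity, fun z hz hza => ?_⟩
  calc ‖F z + F' z‖ * ‖z - a‖ ^ m ≤ (‖F z‖ + ‖F' z‖) * ‖z - a‖ ^ m := by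
        gcongr; exact norm_add_le _ _
    _ ≤ C + C' := by
        rw [add_mul]; exact add_le_add (hC z hz hza) (hC' z hz hza)

/-- A smooth closed metric. -/
structure IsKahlerOn (Ω : Set (Cn k)) (κ : Cn k → SesqForm (Cn k)) : Prop where
  pos : ∀ z ∈ Ω, IsPosDefForm (κ z)
  smooth : ∀ z ∈ Ω, ∀ v w, ContDiffAt ℝ ∞ (fun y => κ y v w) z
  closed : ∀ z ∈ Ω, ∀ u v w, del (fun y => κ y v w) z u = del (fun y => κ y v u) z w

theorem IsKahlerOn.isMetricOn (hκ : IsKahlerOn Ω κ) : IsMetricOn Ω κ :=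
  ⟨fun v w z hz => (hκ.smooth z hz v w).continuousAt.continuousWithinAt, hκ.pos⟩

/-- The functions `f` and `u` are smooth on `Ω` outside of the point `a`, with singularities at `a`
that are not worse than those of the model, and `i∂f ∧ ∂̄f ≤ A κ + (i/2) ∂∂̄u`
there. -/
structure IsModelOn (Ω : Set (Cn k)) (κ : Cn k → SesqForm (Cn k)) (a : Cn k) (A : ℝ)
    (f u : Cn k → ℝ) : Prop where
  smooth_fun : ∀ z ∈ Ω, z ≠ a → ContDiffAt ℝ ∞ f z
  smooth_pot : ∀ z ∈ Ω, z ≠ a → ContDiffAt ℝ ∞ u z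
  bound_fun : HasPoleBound Ω a 2 fun z => (f z : ℂ)
  bound_del : ∀ v, HasPoleBound Ω a 3 fun z => del (fun y => (f y : ℂ)) z v
  bound_levi : ∀ v w, HasPoleBound Ω a 2 fun z => levi u z v w
  le : ∀ z ∈ Ω, z ≠ a → ∀ v, 2 * ‖del (fun y => (f y : ℂ)) z v‖ ^ 2 ≤
    A * (κ z v v).re + (levi u z v v).re

variable {A : ℝ} {f u : Cn k → ℝ} {θ : Cn k → SesqForm (Cn k)} {G : Cn k → Cn k →ₗ[ℂ] ℂ}

theorem IsModelOn.hasPoleBound (h : IsModelOn Ω κ a A f u) (hκ : IsKahlerOn Ω κ)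
    (hθ : ∀ z ∈ Ω, z ≠ a → θ z = (A : ℂ) • κ z + levi u z) (v w : Cn k) :
    HasPoleBound Ω a 2 fun z => θ z v w := by
  have h1 : HasPoleBound Ω a 2 fun z => (A : ℂ) * κ z v w :=
    .of_continuousOn (continuousOn_const.mul (hκ.isMetricOn.continuousOn v w))
  refine (h1.add (h.bound_levi v w)).congr fun z hz hza => ?_
  rw [hθ z hz hza]; rfl

theorem IsModelOn.isWeakDelOn (h : IsModelOn Ω κ a A f u) (hk : 2 ≤ k) (hΩ : IsOpen Ω)
    (hG : ∀ z ∈ Ω, z ≠ a → G z = delLin (fun y => (f y : ℂ)) z) : IsWeakDelOn Ω f G := by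
  have hG' : ∀ z ∈ Ω, z ≠ a → ∀ v, G z v = del (fun y => (f y : ℂ)) z v := fun z hz hza v => by
    rw [hG z hz hza, delLin_apply]
  exact isWeakDelOn_of_pole hk hΩ h.smooth_fun h.bound_fun
    (fun v => (h.bound_del v).congr fun z hz hza => hG' z hz hza v) hG'

theorem IsModelOn.isClosedOn (h : IsModelOn Ω κ a A f u) (hk : 2 ≤ k) (hκ : IsKahlerOn Ω κ)
    (hΩ : IsOpen Ω) (hθ : ∀ z ∈ Ω, z ≠ a → θ z = (A : ℂ) • κ z + levi u z) :
    IsClosedOn Ω κ θ (volumeOn Ω κ) := by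
  have hev : ∀ z ∈ Ω, z ≠ a → ∀ v w, (fun y => θ y v w) =ᶠ[𝓝 z]
      fun y => (A : ℂ) * κ y v w + levi u y v w := fun z hz hza v w => by
    filter_upwards [hΩ.mem_nhds hz, isOpen_ne.mem_nhds hza] with y hy hya
    rw [hθ y hy hya]; rfl
  refine isClosedOn_of_pole hk hκ.isMetricOn hΩ (fun z hz hza v w => ?_)
    (h.hasPoleBound hκ hθ) fun z hz hza x v w => ?_
  · exact ((contDiffAt_const.mul (hκ.smooth z hz v w)).add
      (ContDiffAt.levi (h.smooth_pot z hz hza) v w)).congr_of_eventuallyEq (hev z hz hza v w)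
  · have hd : ∀ v w, DifferentiableAt ℝ (fun y => κ y v w) z := fun v w =>
      (hκ.smooth z hz v w).differentiableAt (by simp)
    have hl : ∀ v w, DifferentiableAt ℝ (fun y => levi u y v w) z := fun v w =>
      (ContDiffAt.levi (h.smooth_pot z hz hza) v w).differentiableAt (by simp)
    rw [del_congr (hev z hz hza v w), del_congr (hev z hz hza v x),
      del_add ((hd v w).const_mul _) (hl v w), del_add ((hd v x).const_mul _) (hl v x),
      del_const_mul _ (hd v w), del_const_mul _ (hd v x), hκ.closed z hz,
      del_levi_comm (h.smooth_pot z hz hza)]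

theorem IsModelOn.le_apply (h : IsModelOn Ω κ a A f u)
    (hθ : ∀ z ∈ Ω, z ≠ a → θ z = (A : ℂ) • κ z + levi u z)
    (hG : ∀ z ∈ Ω, z ≠ a → G z = delLin (fun y => (f y : ℂ)) z) {z : Cn k} (hz : z ∈ Ω)
    (hza : z ≠ a) (v : Cn k) : (wedgeConj (G z) v v).re ≤ (θ z v v).re := by
  rw [wedgeConj_self_re, hG z hz hza, hθ z hz hza, delLin_apply]
  simpa [Complex.re_ofReal_mul] using h.le z hz hza v

theorem IsModelOn.isDominatedOn (h : IsModelOn Ω κ a A f u) (hk : 2 ≤ k) (hκ : IsKahlerOn Ω κ)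
    (hΩ : IsOpen Ω) (hθ : ∀ z ∈ Ω, z ≠ a → θ z = (A : ℂ) • κ z + levi u z)
    (hG : ∀ z ∈ Ω, z ≠ a → G z = delLin (fun y => (f y : ℂ)) z) :
    IsDominatedOn Ω κ G θ (volumeOn Ω κ) :=
  isDominatedOn_of_pole hk hκ.isMetricOn hΩ (h.hasPoleBound hκ hθ)
    fun _ hz hza v => h.le_apply hθ hG hz hza v

theorem IsModelOn.isPosForm (h : IsModelOn Ω κ a A f u) (hκ : IsKahlerOn Ω κ)
    (hθ : ∀ z ∈ Ω, z ≠ a → θ z = (A : ℂ) • κ z + levi u z) {z : Cn k} (hz : z ∈ Ω)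
    (hza : z ≠ a) : IsPosForm (θ z) := by
  refine ⟨fun v w => ?_, fun v => ?_⟩
  · rw [hθ z hz hza]
    simp only [LinearMap.add_apply, LinearMap.smul_apply, smul_eq_mul, map_add, map_mul,
      Complex.conj_ofReal, (hκ.pos z hz).isPosForm.1,
      conj_levi ((h.smooth_pot z hz hza).of_le two_le_infty)]
  · exact ((isPosForm_wedgeConj _).2 v).trans
      (h.le_apply (G := fun z => delLin (fun y => (f y : ℂ)) z) hθ (fun _ _ _ => rfl) hz hza v)

theorem IsModelOn.integrableOn_trace_wedgeConj (h : IsModelOn Ω κ a A f u) (hk : 2 ≤ k)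
    (hκ : IsKahlerOn Ω κ) (hΩ : IsOpen Ω)
    (hθ : ∀ z ∈ Ω, z ≠ a → θ z = (A : ℂ) • κ z + levi u z)
    (hG : ∀ z ∈ Ω, z ≠ a → G z = delLin (fun y => (f y : ℂ)) z) {S : Set (Cn k)}
    (hint : IntegrableOn (fun z => trace (κ z) (θ z)) S (volumeOn Ω κ)) :
    IntegrableOn (fun z => trace (κ z) (wedgeConj (G z))) S (volumeOn Ω κ) := by
  have hGm : ∀ v, AEStronglyMeasurable (fun z => G z v) (volume.restrict Ω) := fun v =>
    ((h.bound_del v).congr fun z hz hza => by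
      rw [hG z hz hza, delLin_apply]).aestronglyMeasurable hk hΩ
  have hac : (volumeOn Ω κ).restrict S ≪ volume.restrict Ω :=
    (Measure.absolutelyContinuous_of_le Measure.restrict_le_self).trans
      volumeOn_absolutelyContinuous
  refine hint.mono' ((aestronglyMeasurable_trace hΩ.measurableSet hκ.isMetricOn.continuousOn
    hκ.pos (aestronglyMeasurable_wedgeConj_apply hGm)).mono_ac hac) ?_
  have h4 : ∀ᵐ z ∂((volumeOn Ω κ).restrict S), z ∈ Ω ∧ z ≠ a :=
    hac.ae_le ((ae_restrict_mem hΩ.measurableSet).and (ae_restrict_of_ae (ae_ne hk a)))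
  filter_upwards [h4] with z ⟨hz, hza⟩
  rw [Real.norm_of_nonneg (trace_nonneg (hκ.pos z hz) (isPosForm_wedgeConj _))]
  refine trace_mono (hκ.pos z hz) ⟨fun v w => ?_, fun v => ?_⟩
  · simp only [LinearMap.sub_apply, map_sub, (h.isPosForm hκ hθ hz hza).1,
      (isPosForm_wedgeConj (G z)).1]
  · simp only [LinearMap.sub_apply, Complex.sub_re, sub_nonneg]
    exact h.le_apply hθ hG hz hza v

/-- Near its singularity the model has the required growth. -/
theorem isModelOn_modelFun (i : Fin k) (β : ContDiffBump a)
    (hA : ∀ z ∈ Ω, z ≠ a → ∀ v, 2 * ‖del (fun y => (modelFun i β y : ℂ)) z v‖ ^ 2 ≤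
        A * (κ z v v).re + (levi (modelPot β) z v v).re) :
    IsModelOn Ω κ a A (modelFun i β) (modelPot β) := by
  have hball : ∀ᶠ z in 𝓝[≠] a, z ∈ Metric.ball a β.rIn ∧ z ∈ Metric.ball a 1 ∧ z ≠ a := by
    filter_upwards [mem_nhdsWithin_of_mem_nhds (Metric.ball_mem_nhds a β.rIn_pos),
      mem_nhdsWithin_of_mem_nhds (Metric.ball_mem_nhds a one_pos), self_mem_nhdsWithin] with z h1 h2 h3
    exact ⟨h1, h2, h3⟩
  have hsm : ∀ z ∈ Ω \ {a}, ContDiffAt ℝ ∞ (fun y => (modelFun i β y : ℂ)) z := fun z hz =>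
    ContDiffAt.ofReal (contDiffAt_modelFun i β hz.2)
  refine ⟨fun z _ hza => contDiffAt_modelFun i β hza, fun z _ hza => contDiffAt_modelPot β hza,
    .of_eventually (fun z hz => (hsm z hz).continuousAt.continuousWithinAt) ⟨1, ?_⟩,
    fun v => .of_eventually (fun z hz =>
      (ContDiffAt.del (hsm z hz) v).continuousAt.continuousWithinAt) ⟨2 * ‖v‖, ?_⟩,
    fun v w => .of_eventually (fun z hz => (ContDiffAt.levi (contDiffAt_modelPot β
      hz.2) v w).continuousAt.continuousWithinAt) ⟨4 * ‖v‖ * ‖w‖, ?_⟩, hA⟩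
  · filter_upwards [hball] with z ⟨h1, h2, h3⟩
    rw [Metric.mem_ball, dist_eq_norm] at h2
    rw [Complex.norm_real]
    exact mul_le_one₀ (abs_modelFun_le i β z) (by positivity)
      (pow_le_one₀ (norm_nonneg _) h2.le)
  · filter_upwards [hball] with z ⟨h1, h2, h3⟩
    rw [Metric.mem_ball, dist_eq_norm] at h2
    have h4 := norm_del_modelFun_le i β h1 h3 v
    calc _ = ‖del (fun y => (modelFun i β y : ℂ)) z v‖ * ‖z - a‖ * ‖z - a‖ ^ 2 := by ring
      _ ≤ 2 * ‖v‖ * 1 := mul_le_mul h4 (pow_le_one₀ (norm_nonneg _) h2.le) (by positivity)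
        (by positivity)
      _ = _ := mul_one _
  · filter_upwards [hball] with z ⟨h1, h2, h3⟩
    exact norm_levi_modelPot_le β h1 h3 v w

/-! ### Bounded open sets -/

theorem isKahlerOn_flatForm {c : ℝ} (hc : 0 < c) : IsKahlerOn Ω fun _ => flatForm k c :=
  ⟨fun _ _ => isPosDefForm_flatForm hc, fun _ _ _ _ => contDiffAt_const, fun _ _ _ _ _ => by
    simp [del]⟩

theorem isFiniteMeasure_volumeOn_const (hΩ : Bornology.IsBounded Ω) (h : SesqForm (Cn k)) :
    IsFiniteMeasure (volumeOn Ω fun _ => h) := by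
  have : IsFiniteMeasure (volume.restrict Ω : Measure (Cn k)) :=
    ⟨by rw [Measure.restrict_apply_univ]; exact hΩ.measure_lt_top⟩
  rw [volumeOn, withDensity_const]
  exact Measure.smul_finite _ ENNReal.ofReal_ne_top

theorem measurable_modelFun (i : Fin k) (β : ContDiffBump a) : Measurable (modelFun i β) := by
  have h : Measurable fun z : Cn k => ratio i (z - a) := by
    unfold ratio; fun_prop
  exact β.continuous.measurable.mul h

theorem exists_memWStarOn (hk : 2 ≤ k) {U : Set (Cn k)} {c : ℝ} (hU : IsOpen U)
    (hUb : Bornology.IsBounded U) (hc : 0 < c) (ha : a ∈ U) (i : Fin k) :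
    ∃ f ρ, 0 < ρ ∧ Metric.ball a ρ ⊆ U ∧ MemWStarOn U (fun _ => flatForm k c) f ∧
      ∀ z ∈ Metric.ball a ρ, f z = ratio i (z - a) := by
  obtain ⟨R, hR0, hR⟩ := Metric.isOpen_iff.1 hU a ha
  let β : ContDiffBump a := ⟨R / 4, R / 2, by positivity, by linarith⟩
  have hβ : Metric.closedBall a β.rOut ⊆ U :=
    (Metric.closedBall_subset_ball (show R / 2 < R by linarith)).trans hR
  have hκ : IsKahlerOn U fun _ => flatForm k c := isKahlerOn_flatForm hc
  obtain ⟨A, hA0, hA⟩ := exists_norm_del_modelFun_sq_le hκ.isMetricOn i β hβ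
  have hM := isModelOn_modelFun i β hA
  have hfin := isFiniteMeasure_volumeOn_const hUb (flatForm k c)
  set κ : Cn k → SesqForm (Cn k) := fun _ => flatForm k c with hκdef
  let θ : Cn k → SesqForm (Cn k) := fun z =>
    if z = a then (A : ℂ) • flatForm k c else (A : ℂ) • flatForm k c + levi (modelPot β) z
  have hθ : ∀ z ∈ U, z ≠ a → θ z = (A : ℂ) • κ z + levi (modelPot β) z := fun z _ hza => by
    simp only [θ, if_neg hza, hκdef]
  have hpos : ∀ z ∈ U, IsPosForm (θ z) := fun z hz => by
    by_cases hza : z = a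
    · simp only [θ, if_pos hza]
      exact (isPosDefForm_flatForm hc).isPosForm.smul hA0
    · exact hM.isPosForm hκ hθ hz hza
  have hint : IntegrableOn (fun z => trace (κ z) (θ z)) U (volumeOn U κ) := by
    have h1 := integrableOn_trace_of_pole hk hκ.isMetricOn hU (hM.hasPoleBound hκ hθ)
      (isCompact_closedBall a β.rOut) hβ
    have h2 : IntegrableOn (fun z => trace (κ z) (θ z)) (Metric.closedBall a β.rOut)ᶜ
        (volumeOn U κ) := by
      have h3 : IntegrableOn (fun _ : Cn k => A * trace (flatForm k c) (flatForm k c))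
          (Metric.closedBall a β.rOut)ᶜ (volumeOn U κ) := integrableOn_const (measure_ne_top _ _)
      refine h3.congr_fun (fun z hz => ?_) Metric.isClosed_closedBall.measurableSet.compl
      have hza : z ≠ a := by
        rintro rfl
        exact hz (Metric.mem_closedBall_self β.rOut_pos.le)
      have h4 : modelPot β =ᶠ[𝓝 z] fun _ => 0 := by
        filter_upwards [Metric.isClosed_closedBall.isOpen_compl.mem_nhds hz] with y hy
        rw [modelPot_eq_zero β hy]
      have h5 : levi (fun _ : Cn k => (0 : ℝ)) z = 0 := by ext v w; simp [levi_apply]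
      simp only [θ, if_neg hza, levi_congr h4, h5, add_zero, trace_smul, hκdef]
    have h3 := h1.union h2
    rw [union_compl_self] at h3
    exact h3.mono_set (subset_univ _)
  let T : CurrentOn U κ :=
    { μ := volumeOn U κ
      θ := θ
      pos := hpos
      meas := fun v w => (((hM.hasPoleBound hκ hθ v w).aestronglyMeasurable hk hU).mono_ac
        ((Measure.absolutelyContinuous_of_le Measure.restrict_le_self).trans
          volumeOn_absolutelyContinuous)).aemeasurable
      finite_mass := hint }
  let G : Cn k → Cn k →ₗ[ℂ] ℂ := fun z => delLin (fun y => (modelFun i β y : ℂ)) z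
  have hG : ∀ z ∈ U, z ≠ a → G z = delLin (fun y => (modelFun i β y : ℂ)) z := fun _ _ _ => rfl
  have hweak := hM.isWeakDelOn hk hU hG
  have hL2 : HasL2DelOn U κ (modelFun i β) G := by
    have h1 := hM.integrableOn_trace_wedgeConj hk hκ hU hθ hG hint
    rw [IntegrableOn, volumeOn_restrict hU] at h1
    exact ⟨hweak, h1⟩
  refine ⟨modelFun i β, R / 4, by positivity, (Metric.ball_subset_ball (by linarith)).trans hR,
    ⟨?_, ⟨G, hL2⟩, T, hM.isClosedOn hk hκ hU hθ, G, hL2, hM.isDominatedOn hk hκ hU hθ hG⟩,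
    fun z hz => modelFun_eq i β hz⟩
  exact MemLp.of_bound (measurable_modelFun i β).aestronglyMeasurable 1
    (ae_of_all _ fun z => abs_modelFun_le i β z)

theorem MemVMOOn.memPointwiseVMOOn (hΩ : IsOpen Ω) {f : Cn k → ℝ} (hf : MemVMOOn Ω f) :
    MemPointwiseVMOOn Ω f := by
  refine ⟨hf.1, fun z hz => ?_⟩
  obtain ⟨R, hR0, hR⟩ := Metric.isOpen_iff.1 hΩ z hz
  rw [Metric.tendsto_nhds]
  intro ε hε
  obtain ⟨δ, hδ, hδε⟩ := hf.2 ε hε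
  have h1 : ∀ᶠ r in 𝓝[>] (0 : ℝ), r < min δ R :=
    eventually_nhdsWithin_of_eventually_nhds (gt_mem_nhds (lt_min hδ hR0))
  filter_upwards [h1, self_mem_nhdsWithin] with r hr hr0
  have h2 : 0 ≤ meanOsc f z r := by
    rw [meanOsc, setAverage_eq]
    exact smul_nonneg (by positivity) (integral_nonneg fun y => abs_nonneg _)
  rw [Real.dist_eq, sub_zero, abs_of_nonneg h2]
  exact hδε z r hr0 (hr.trans_le (min_le_left _ _))
    ((Metric.ball_subset_ball (hr.le.trans (min_le_right _ _))).trans hR)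

theorem not_denseInWStarOn_continuousOn (hk : 2 ≤ k) (hκ : IsMetricOn Ω κ) (hΩ : IsOpen Ω)
    (i : Fin k) {ρ : ℝ} (hρ : 0 < ρ) (ha : Metric.ball a ρ ⊆ Ω) (hf : MemWStarOn Ω κ f)
    (hfa : ∀ z ∈ Metric.ball a ρ, f z = ratio i (z - a)) {P : (Cn k → ℝ) → Prop}
    (hP : ∀ g, P g → ContinuousOn g Ω) : ¬ DenseInWStarOn Ω κ P := by
  intro hd
  obtain ⟨ε, hε, hLB⟩ := exists_le_mass_of_controls hk hκ hΩ i hρ ha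
  obtain ⟨g, hg, hPg, hlt⟩ := hd f hf (Real.sqrt ε) (Real.sqrt_pos.2 hε)
  obtain ⟨T₁, h₁⟩ := hf.2.2
  obtain ⟨T₂, h₂⟩ := hg.2.2
  obtain ⟨T, hT⟩ := exists_controls_sub (by omega) hκ hΩ hf.1 hg.1 h₁ h₂
  refine absurd hlt (not_lt.2 (Real.sqrt_le_sqrt ?_))
  have h3 : ε ≤ sInf {m : ℝ | ∃ T : CurrentOn Ω κ, T.Controls (f - g) ∧ m = T.mass} := by
    refine le_csInf ⟨_, T, hT, rfl⟩ ?_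
    rintro _ ⟨S, hS, rfl⟩
    exact hLB (f - g) g ((hP g hPg).mono ha) (fun z hz => by rw [Pi.sub_apply, hfa z hz]) S hS
  have h4 : 0 ≤ ∫ z, (f - g) z ^ 2 ∂(volumeOn Ω κ) := integral_nonneg fun z => sq_nonneg _
  linarith

/-- The case of a bounded open set. -/
theorem wStarOn_bounded (hk : 2 ≤ k) {U : Set (Cn k)} {c : ℝ} (hU : IsOpen U) (hne : U.Nonempty)
    (hUb : Bornology.IsBounded U) (hc : 0 < c) :
    (∃ f, MemWStarOn U (fun _ => flatForm k c) f ∧ ¬ MemVMOOn U f) ∧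
    (∃ f, MemWStarOn U (fun _ => flatForm k c) f ∧ ¬ MemPointwiseVMOOn U f) ∧
    ¬ DenseInWStarOn U (fun _ => flatForm k c) (fun g => ContDiffOn ℝ ∞ g U) ∧
    ¬ DenseInWStarOn U (fun _ => flatForm k c) (fun g => ContinuousOn g U) := by
  obtain ⟨a, ha⟩ := hne
  let i : Fin k := ⟨0, by omega⟩
  obtain ⟨f, ρ, hρ, hρU, hf, hfa⟩ := exists_memWStarOn hk hU hUb hc ha i
  have hnot : ¬ MemPointwiseVMOOn U f := fun h => not_tendsto_meanOsc hk i hρ hfa (h.2 a ha)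
  have hκ : IsMetricOn U fun _ => flatForm k c := (isKahlerOn_flatForm hc).isMetricOn
  exact ⟨⟨f, hf, fun h => hnot (h.memPointwiseVMOOn hU)⟩, ⟨f, hf, hnot⟩,
    not_denseInWStarOn_continuousOn hk hκ hU i hρ hρU hf hfa fun g hg => hg.continuousOn,
    not_denseInWStarOn_continuousOn hk hκ hU i hρ hρU hf hfa fun g hg => hg⟩

end

/-! ### Forms on a complex manifold, in charts -/

section

variable {k : ℕ} {X : Type*} [TopologicalSpace X] [ChartedSpace (Cn k) X]

/-- The derivative of the inverse of a chart, as an endomorphism of `ℂᵏ`: the tangent space at a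
point is identified with `ℂᵏ` by means of the preferred chart at this point. -/
def coordLin (e : OpenPartialHomeomorph X (Cn k)) (z : Cn k) : Cn k →ₗ[ℂ] Cn k :=
  (fderiv ℂ (chartAt (Cn k) (e.symm z) ∘ e.symm) z).toLinearMap

/-- The value of a `(1,1)`-form at a point, as a form on `ℂᵏ`. -/
def formAt (h : ∀ x : X, SesqForm (Tan k x)) (x : X) : SesqForm (Cn k) := h x

/-- The value of a `(1,0)`-form at a point, as a covector of `ℂᵏ`. -/
def covectorAt (G : ∀ x : X, Tan k x →ₗ[ℂ] ℂ) (x : X) : Cn k →ₗ[ℂ] ℂ := G x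

/-- Smoothness at a point, in all charts. -/
def IsSmoothAt (f : X → ℝ) (x : X) : Prop :=
  ∀ e ∈ atlas (Cn k) X, x ∈ e.source → ContDiffAt ℝ ∞ (f ∘ e.symm) (e x)

/-- The `(1,0)`-form `∂f`, computed in the preferred chart at each point. -/
def delForm (f : X → ℝ) (x : X) : Tan k x →ₗ[ℂ] ℂ :=
  delLin (fun y => (f ((chartAt (Cn k) x).symm y) : ℂ)) (chartAt (Cn k) x x)

/-- The form `(i/2) ∂∂̄u`, computed in the preferred chart at each point. -/
def leviForm (u : X → ℝ) (x : X) : SesqForm (Tan k x) :=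
  levi (u ∘ (chartAt (Cn k) x).symm) (chartAt (Cn k) x x)

/-- Near `z`, the inverse of a chart factors through another chart. -/
theorem symm_eventuallyEq {Y : Type*} [TopologicalSpace Y]
    {e e' : OpenPartialHomeomorph Y (Cn k)} {z : Cn k} (hz : z ∈ e.target) (hz' : e.symm z ∈ e'.source) :
    e.symm =ᶠ[𝓝 z] e'.symm ∘ (e' ∘ e.symm) := by
  have h1 : ContinuousAt e.symm z := e.symm.continuousAt hz
  filter_upwards [h1.eventually (e'.open_source.mem_nhds hz')] with y hy
  simp [e'.left_inv hy]

theorem wedgeConj_covectorInChart (e : OpenPartialHomeomorph X (Cn k))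
    (G : ∀ x : X, Tan k x →ₗ[ℂ] ℂ) (z : Cn k) :
    wedgeConj (covectorInChart e G z) = formInChart e (fun x => wedgeConj (G x)) z :=
  wedgeConj_comp _ _

theorem KahlerForm.isPosDefForm (κ : KahlerForm k X) (x : X) : IsPosDefForm (formAt κ.form x) :=
  ⟨κ.hermitian x, κ.pos x⟩

theorem covectorInChart_sub (e : OpenPartialHomeomorph X (Cn k))
    (G₁ G₂ : ∀ x : X, Tan k x →ₗ[ℂ] ℂ) : covectorInChart e (fun x => G₁ x - G₂ x) =
      fun z => covectorInChart e G₁ z - covectorInChart e G₂ z := by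
  funext z
  exact LinearMap.sub_comp _ _ _

theorem IsSmoothAt.continuousAt {f : X → ℝ} {x : X} (hf : IsSmoothAt (k := k) f x) :
    ContinuousAt f x := by
  have hx := mem_chart_source (Cn k) x
  have h1 := (hf _ (chart_mem_atlas _ x) hx).continuousAt.comp
    ((chartAt (Cn k) x).continuousAt hx)
  refine h1.congr ?_
  filter_upwards [(chartAt (Cn k) x).open_source.mem_nhds hx] with y hy
  simp [(chartAt (Cn k) x).left_inv hy]

theorem MemVMO.memPointwiseVMO {f : X → ℝ} (hf : MemVMO k f) : MemPointwiseVMO k f := fun p => by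
  obtain ⟨δ, hδ, hδt, h⟩ := hf p
  exact ⟨δ, hδ, hδt, h.memPointwiseVMOOn Metric.isOpen_ball⟩

section Transition

variable [IsManifold 𝓘(ℂ, Cn k) ω X] {e e' : OpenPartialHomeomorph X (Cn k)}

theorem coordMap_apply (he : e ∈ atlas (Cn k) X) {z : Cn k} (hz : z ∈ e.target) (v : Cn k) :
    (coordMap e z v : Cn k) = coordLin e z v := by
  have h : MDifferentiableAt 𝓘(ℂ, Cn k) 𝓘(ℂ, Cn k) e.symm z := mdifferentiableAt_atlas_symm he hz
  have h1 := h.mfderiv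
  have h2 : writtenInExtChartAt 𝓘(ℂ, Cn k) 𝓘(ℂ, Cn k) z e.symm =
      chartAt (Cn k) (e.symm z) ∘ e.symm := by
    simp only [writtenInExtChartAt, mfld_simps]
    rw [chartAt_self_eq]
    rfl
  rw [h2] at h1
  simp only [mfld_simps, fderivWithin_univ] at h1
  exact DFunLike.congr_fun h1 v

theorem formInChart_apply (he : e ∈ atlas (Cn k) X) {z : Cn k} (hz : z ∈ e.target)
    (h : ∀ x : X, SesqForm (Tan k x)) :
    formInChart e h z = pullback (formAt h (e.symm z)) (coordLin e z) := by
  ext v w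
  rw [pullback_apply, ← coordMap_apply he hz, ← coordMap_apply he hz]
  rfl

theorem covectorInChart_apply (he : e ∈ atlas (Cn k) X) {z : Cn k} (hz : z ∈ e.target)
    (G : ∀ x : X, Tan k x →ₗ[ℂ] ℂ) :
    covectorInChart e G z = covectorAt G (e.symm z) ∘ₗ coordLin e z := by
  ext v
  rw [LinearMap.comp_apply, ← coordMap_apply he hz]
  rfl

theorem contDiffAt_transition (he : e ∈ atlas (Cn k) X) (he' : e' ∈ atlas (Cn k) X) {z : Cn k}
    (hz : z ∈ e.target) (hz' : e.symm z ∈ e'.source) : ContDiffAt ℂ ω (e' ∘ e.symm) z := by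
  have h1 := (contMDiffOn_symm_of_mem_maximalAtlas (I := 𝓘(ℂ, Cn k)) (n := ω)
    (IsManifold.subset_maximalAtlas he)).contMDiffAt (e.open_target.mem_nhds hz)
  have h2 := (contMDiffOn_of_mem_maximalAtlas (I := 𝓘(ℂ, Cn k)) (n := ω)
    (IsManifold.subset_maximalAtlas he')).contMDiffAt (e'.open_source.mem_nhds hz')
  exact contMDiffAt_iff_contDiffAt.1 (h2.comp z h1)

theorem differentiableAt_transition (he : e ∈ atlas (Cn k) X) (he' : e' ∈ atlas (Cn k) X)
    {z : Cn k} (hz : z ∈ e.target) (hz' : e.symm z ∈ e'.source) :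
    DifferentiableAt ℂ (e' ∘ e.symm) z :=
  (contDiffAt_transition he he' hz hz').differentiableAt (by simp)

theorem fderiv_transition_comp (he : e ∈ atlas (Cn k) X) (he' : e' ∈ atlas (Cn k) X)
    {e'' : OpenPartialHomeomorph X (Cn k)} (he'' : e'' ∈ atlas (Cn k) X) {z : Cn k}
    (hz : z ∈ e.target) (hz' : e.symm z ∈ e'.source) (hz'' : e.symm z ∈ e''.source) :
    fderiv ℂ (e'' ∘ e.symm) z =
      (fderiv ℂ (e'' ∘ e'.symm) (e' (e.symm z))).comp (fderiv ℂ (e' ∘ e.symm) z) := by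
  have h1 : e'' ∘ e.symm =ᶠ[𝓝 z] (e'' ∘ e'.symm) ∘ (e' ∘ e.symm) := by
    filter_upwards [symm_eventuallyEq hz hz'] with y hy
    simp only [Function.comp_apply] at hy ⊢
    rw [← hy]
  rw [h1.fderiv_eq, fderiv_comp]
  · rfl
  · refine differentiableAt_transition he' he'' (e'.map_source hz') ?_
    rwa [Function.comp_apply, e'.left_inv hz']
  · exact differentiableAt_transition he he' hz hz'

theorem det_fderiv_transition_ne_zero (he : e ∈ atlas (Cn k) X) (he' : e' ∈ atlas (Cn k) X)
    {z : Cn k} (hz : z ∈ e.target) (hz' : e.symm z ∈ e'.source) :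
    LinearMap.det (fderiv ℂ (e' ∘ e.symm) z).toLinearMap ≠ 0 := by
  have h1 := fderiv_transition_comp he he' he hz hz' (e.map_target hz)
  have h2 : e ∘ e.symm =ᶠ[𝓝 z] id := by
    filter_upwards [e.open_target.mem_nhds hz] with y hy
    exact e.right_inv hy
  rw [h2.fderiv_eq, fderiv_id] at h1
  have h3 := congrArg (fun L : Cn k →L[ℂ] Cn k => LinearMap.det L.toLinearMap) h1
  simp only [ContinuousLinearMap.toLinearMap_comp, LinearMap.det_comp] at h3
  intro h0
  rw [h0, mul_zero] at h3
  have h4 : LinearMap.det (ContinuousLinearMap.id ℂ (Cn k)).toLinearMap = 1 := LinearMap.det_id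
  exact one_ne_zero (h4.symm.trans h3)

theorem det_coordLin_ne_zero (he : e ∈ atlas (Cn k) X) {z : Cn k} (hz : z ∈ e.target) :
    LinearMap.det (coordLin e z) ≠ 0 :=
  det_fderiv_transition_ne_zero he (chart_mem_atlas _ _) hz (mem_chart_source _ _)

theorem formInChart_transition (he : e ∈ atlas (Cn k) X) (he' : e' ∈ atlas (Cn k) X) {z : Cn k}
    (hz : z ∈ e.target) (hz' : e.symm z ∈ e'.source) (h : ∀ x : X, SesqForm (Tan k x)) :
    formInChart e h z = pullback (formInChart e' h (e' (e.symm z)))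
      (fderiv ℂ (e' ∘ e.symm) z).toLinearMap := by
  rw [formInChart_apply he hz, formInChart_apply he' (e'.map_source hz'), e'.left_inv hz']
  have h1 : coordLin e z = coordLin e' (e' (e.symm z)) ∘ₗ
      (fderiv ℂ (e' ∘ e.symm) z).toLinearMap := by
    rw [coordLin, coordLin, e'.left_inv hz',
      fderiv_transition_comp he he' (chart_mem_atlas _ (e.symm z)) hz hz' (mem_chart_source _ _)]
    rfl
  rw [h1]
  rfl

theorem trace_formInChart (he : e ∈ atlas (Cn k) X) {z : Cn k} (hz : z ∈ e.target)
    (h h' : ∀ x : X, SesqForm (Tan k x)) : trace (formInChart e h z) (formInChart e h' z) =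
      trace (formAt h (e.symm z)) (formAt h' (e.symm z)) := by
  rw [formInChart_apply he hz, formInChart_apply he hz,
    trace_pullback _ _ (det_coordLin_ne_zero he hz)]

theorem covectorInChart_delForm (he : e ∈ atlas (Cn k) X) {z : Cn k} (hz : z ∈ e.target)
    {f : X → ℝ} (hf : IsSmoothAt (k := k) f (e.symm z)) :
    covectorInChart e (delForm f) z = delLin (fun y => (f (e.symm y) : ℂ)) z := by
  ext v
  rw [covectorInChart_apply he hz, LinearMap.comp_apply, delLin_apply]
  set x := e.symm z with hx
  set c := chartAt (Cn k) x with hc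
  have h1 : (fun y => (f (e.symm y) : ℂ)) =ᶠ[𝓝 z]
      fun y => (fun w => (f (c.symm w) : ℂ)) ((c ∘ e.symm) y) := by
    filter_upwards [symm_eventuallyEq hz (mem_chart_source (Cn k) x)] with y hy
    simp only [Function.comp_apply] at hy ⊢
    rw [← hy]
  have h2 : DifferentiableAt ℝ (fun w => (f (c.symm w) : ℂ)) ((c ∘ e.symm) z) :=
    (ContDiffAt.ofReal (hf c (chart_mem_atlas _ x) (mem_chart_source _ x))).differentiableAt (by simp)
  rw [del_congr h1, del_comp h2
    (differentiableAt_transition he (chart_mem_atlas _ x) hz (mem_chart_source _ x))]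
  rfl

theorem formInChart_leviForm (he : e ∈ atlas (Cn k) X) {z : Cn k} (hz : z ∈ e.target)
    {u : X → ℝ} (hu : IsSmoothAt (k := k) u (e.symm z)) :
    formInChart e (leviForm u) z = levi (u ∘ e.symm) z := by
  ext v w
  rw [formInChart_apply he hz, pullback_apply]
  set x := e.symm z with hx
  set c := chartAt (Cn k) x with hc
  have h1 : (u ∘ e.symm) =ᶠ[𝓝 z] fun y => (u ∘ c.symm) ((c ∘ e.symm) y) := by
    filter_upwards [symm_eventuallyEq hz (mem_chart_source (Cn k) x)] with y hy
    simp only [Function.comp_apply] at hy ⊢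
    rw [← hy]
  have h2 : ContDiffAt ℝ 2 (u ∘ c.symm) ((c ∘ e.symm) z) :=
    (hu c (chart_mem_atlas _ x) (mem_chart_source _ x)).of_le two_le_infty
  rw [levi_congr h1, levi_comp h2
    ((contDiffAt_transition he (chart_mem_atlas _ x) hz (mem_chart_source _ x)).of_le (by simp))]
  rfl

theorem KahlerForm.isKahlerOn (κ : KahlerForm k X) (he : e ∈ atlas (Cn k) X) :
    IsKahlerOn e.target (formInChart e κ.form) := by
  refine ⟨fun z hz => ?_, fun z hz v w => ?_, fun z hz u v w => κ.closed e he z hz u v w⟩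
  · rw [formInChart_apply he hz]
    refine ⟨fun v w => κ.hermitian _ _ _, fun v hv => κ.pos _ _ ?_⟩
    intro h0
    have hinj : Function.Injective (coordLin e z) :=
      (LinearMap.equivOfDetNeZero _ (det_coordLin_ne_zero he hz)).injective
    exact hv (hinj (h0.trans (map_zero _).symm))
  · exact (κ.smooth e he v w).contDiffAt (e.open_target.mem_nhds hz)

end Transition

end

/-! ### The volume of a Kähler manifold and currents, in charts -/

section

variable {k : ℕ} {X : Type*} [TopologicalSpace X] [MeasurableSpace X] [BorelSpace X]
  {e e' : OpenPartialHomeomorph X (Cn k)}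

theorem aemeasurable_chart (μ : Measure X) : AEMeasurable e (μ.restrict e.source) :=
  e.continuousOn.aemeasurable e.open_source.measurableSet

theorem aemeasurable_chart_symm (ν : Measure (Cn k)) : AEMeasurable e.symm (ν.restrict e.target) :=
  e.continuousOn_symm.aemeasurable e.open_target.measurableSet

theorem measurableSet_target_inter_preimage {s : Set X} (hs : MeasurableSet s) :
    MeasurableSet (e.target ∩ e.symm ⁻¹' s) := by
  have h1 := e.open_target.measurableSet.subtype_image
    ((continuousOn_iff_continuous_domRestrict.1 e.continuousOn_symm).measurable hs)
  convert h1 using 1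
  ext z
  simp [and_comm]

theorem ae_mem_target (μ : Measure X) : ∀ᵐ z ∂(measureInChart e μ), z ∈ e.target := by
  refine (ae_map_iff (p := fun z => z ∈ e.target) (aemeasurable_chart (e := e) μ)
    e.open_target.measurableSet).2 ?_
  filter_upwards [ae_restrict_mem e.open_source.measurableSet] with x hx using e.map_source hx

theorem measureInChart_restrict (μ : Measure X) :
    (measureInChart e μ).restrict e.target = measureInChart e μ :=
  Measure.restrict_eq_self_of_ae_mem (ae_mem_target μ)

theorem map_symm_measureInChart (μ : Measure X) :
    (measureInChart e μ).map e.symm = μ.restrict e.source := by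
  have h1 : AEMeasurable e.symm (measureInChart e μ) := by
    rw [← measureInChart_restrict]; exact aemeasurable_chart_symm _
  rw [measureInChart, AEMeasurable.map_map_of_aemeasurable h1 (aemeasurable_chart μ)]
  have h2 : e.symm ∘ e =ᵐ[μ.restrict e.source] id := by
    filter_upwards [ae_restrict_mem e.open_source.measurableSet] with x hx using e.left_inv hx
  rw [Measure.map_congr h2, Measure.map_id]

theorem aestronglyMeasurable_measureInChart_iff {E : Type*} [TopologicalSpace E]
    {F : Cn k → E} {μ : Measure X} :
    AEStronglyMeasurable F (measureInChart e μ) ↔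
      AEStronglyMeasurable (F ∘ e) (μ.restrict e.source) := by
  refine ⟨fun h => h.comp_aemeasurable (aemeasurable_chart μ), fun h => ?_⟩
  rw [← map_symm_measureInChart] at h
  have h1 : AEMeasurable e.symm (measureInChart e μ) := by
    rw [← measureInChart_restrict]; exact aemeasurable_chart_symm _
  refine (h.comp_aemeasurable h1).congr ?_
  filter_upwards [ae_mem_target μ] with z hz
  simp [e.right_inv hz]

theorem integral_measureInChart {E : Type*} [NormedAddCommGroup E] [NormedSpace ℝ E]
    (F : Cn k → E) (μ : Measure X) :
    ∫ z, F z ∂(measureInChart e μ) = ∫ x in e.source, F (e x) ∂μ := by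
  by_cases h : AEStronglyMeasurable F (measureInChart e μ)
  · exact integral_map (aemeasurable_chart μ) h
  · rw [integral_non_aestronglyMeasurable h, integral_non_aestronglyMeasurable]
    exact fun h' => h (aestronglyMeasurable_measureInChart_iff.2 h')

theorem integrable_measureInChart_iff {E : Type*} [NormedAddCommGroup E]
    {F : Cn k → E} {μ : Measure X} :
    Integrable F (measureInChart e μ) ↔ IntegrableOn (fun x => F (e x)) e.source μ := by
  by_cases h : AEStronglyMeasurable F (measureInChart e μ)
  · exact integrable_map_measure h (aemeasurable_chart μ)
  · exact ⟨fun h' => (h h'.1).elim, fun h' =>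
      (h (aestronglyMeasurable_measureInChart_iff.2 h'.1)).elim⟩

theorem integrable_comp_symm_iff {E : Type*} [NormedAddCommGroup E] {F : X → E} {μ : Measure X} :
    Integrable (fun z => F (e.symm z)) (measureInChart e μ) ↔ IntegrableOn F e.source μ := by
  rw [integrable_measureInChart_iff]
  refine integrableOn_congr_fun (fun x hx => ?_) e.open_source.measurableSet
  simp only [e.left_inv hx]

theorem volumeOn_restrict_self {Ω : Set (Cn k)} {κ : Cn k → SesqForm (Cn k)}
    (hΩ : IsOpen Ω) : volumeOn Ω κ = (volumeOn Ω κ).restrict Ω := (volumeOn_restrict hΩ).symm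

variable [ChartedSpace (Cn k) X]

theorem map_symm_volumeOn_apply (κ : KahlerForm k X) {s : Set X} (hs : MeasurableSet s) :
    (volumeOn e.target (formInChart e κ.form)).map e.symm s =
      ∫⁻ z in e.target ∩ e.symm ⁻¹' s, ENNReal.ofReal (volDensity (formInChart e κ.form z)) := by
  have h1 : AEMeasurable e.symm (volumeOn e.target (formInChart e κ.form)) := by
    rw [volumeOn_restrict_self e.open_target]; exact aemeasurable_chart_symm _
  have hm : MeasurableSet (e.target ∩ e.symm ⁻¹' s) :=
    measurableSet_target_inter_preimage hs
  rw [Measure.map_apply_of_aemeasurable h1 hs, volumeOn_restrict_self e.open_target,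
    Measure.restrict_apply' e.open_target.measurableSet, inter_comm, volumeOn,
    withDensity_apply _ hm, Measure.restrict_restrict hm, inter_assoc, inter_comm (_ ⁻¹' _),
    ← inter_assoc, inter_self]

theorem volumeOn_map_symm_compl (κ : KahlerForm k X) :
    (volumeOn e.target (formInChart e κ.form)).map e.symm e.sourceᶜ = 0 := by
  rw [map_symm_volumeOn_apply κ e.open_source.measurableSet.compl]
  have : e.target ∩ e.symm ⁻¹' e.sourceᶜ = ∅ := by
    ext z
    simp only [mem_inter_iff, mem_preimage, mem_compl_iff, mem_empty_iff_false, iff_false, not_and,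
      not_not]
    exact fun hz => e.map_target hz
  rw [this]; simp

variable [IsManifold 𝓘(ℂ, Cn k) ω X]

/-- The change of variables formula: the volumes computed in two charts agree where both are
defined. -/
theorem map_symm_volumeOn_eq (κ : KahlerForm k X) (he : e ∈ atlas (Cn k) X)
    (he' : e' ∈ atlas (Cn k) X) {s : Set X} (hs : MeasurableSet s) (hse : s ⊆ e.source)
    (hse' : s ⊆ e'.source) : (volumeOn e.target (formInChart e κ.form)).map e.symm s =
      (volumeOn e'.target (formInChart e' κ.form)).map e'.symm s := by
  rw [map_symm_volumeOn_apply κ hs, map_symm_volumeOn_apply κ hs]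
  set A := e.target ∩ e.symm ⁻¹' s with hA
  have hAm : MeasurableSet A :=
    measurableSet_target_inter_preimage hs
  have himg : (e' ∘ e.symm) '' A = e'.target ∩ e'.symm ⁻¹' s := by
    ext w
    constructor
    · rintro ⟨z, ⟨hz, hzs⟩, rfl⟩
      refine ⟨e'.map_source (hse' hzs), ?_⟩
      rw [mem_preimage, Function.comp_apply, e'.left_inv (hse' hzs)]
      exact hzs
    · rintro ⟨hw, hws⟩
      have hx : e'.symm w ∈ s := hws
      refine ⟨e (e'.symm w), ⟨e.map_source (hse hx), ?_⟩, ?_⟩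
      · rw [mem_preimage, e.left_inv (hse hx)]
        exact hx
      · rw [Function.comp_apply, e.left_inv (hse hx), e'.right_inv hw]
  have hd : ∀ z ∈ A, HasFDerivWithinAt (e' ∘ e.symm)
      ((fderiv ℂ (e' ∘ e.symm) z).restrictScalars ℝ) A z := fun z hz =>
    ((differentiableAt_transition he he' hz.1 (hse' hz.2)).hasFDerivAt.restrictScalars
      ℝ).hasFDerivWithinAt
  have hinj : InjOn (e' ∘ e.symm) A := fun z hz w hw hzw =>
    e.symm.injOn hz.1 hw.1 (e'.injOn (hse' hz.2) (hse' hw.2) hzw)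
  rw [← himg, lintegral_image_eq_lintegral_abs_det_fderiv_mul volume hAm hd hinj]
  refine setLIntegral_congr_fun hAm fun z hz => ?_
  have hdet : ((fderiv ℂ (e' ∘ e.symm) z).restrictScalars ℝ).det =
      ‖LinearMap.det (fderiv ℂ (e' ∘ e.symm) z).toLinearMap‖ ^ 2 := by
    have h1 := LinearMap.det_restrictScalars (R := ℝ) (f := (fderiv ℂ (e' ∘ e.symm) z).toLinearMap)
    rw [Algebra.norm_complex_apply, Complex.normSq_eq_norm_sq] at h1
    exact h1
  simp only
  rw [hdet, abs_of_nonneg (by positivity), ← ENNReal.ofReal_mul (by positivity),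
    formInChart_transition he he' hz.1 (hse' hz.2), volDensity_pullback]
  rfl

theorem KahlerForm.volume_restrict_source (κ : KahlerForm k X) (he : e ∈ atlas (Cn k) X) :
    κ.volume.restrict e.source = (volumeOn e.target (formInChart e κ.form)).map e.symm := by
  set M : OpenPartialHomeomorph X (Cn k) → Measure X := fun e =>
    (volumeOn e.target (formInChart e κ.form)).map e.symm with hM
  have hsm : MeasurableSet e.source := e.open_source.measurableSet
  have hMe : (M e).restrict e.source = M e :=
    Measure.restrict_eq_self_of_ae_mem (by
      rw [ae_iff]; exact volumeOn_map_symm_compl κ)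
  have hle : ∀ e' ∈ atlas (Cn k) X, M e' ≤ κ.volume := fun e' he' =>
    le_iSup₂ (f := fun e (_ : e ∈ atlas (Cn k) X) => M e) e' he'
  refine le_antisymm ?_ ?_
  · have hB : κ.volume ≤ M e + κ.volume.restrict e.sourceᶜ := by
      refine iSup₂_le fun e' he' => Measure.le_iff.2 fun s hs => ?_
      rw [Measure.add_apply, Measure.restrict_apply hs]
      have h1 : M e' s = M e' (s ∩ e.source) + M e' (s ∩ e.sourceᶜ) := by
        rw [← sdiff_eq]; exact (measure_inter_add_sdiff s hsm).symm
      change M e' s ≤ _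
      rw [h1]
      refine add_le_add ?_ (hle e' he' _)
      have h2 : M e' (s ∩ e.source) = M e' (s ∩ e.source ∩ e'.source) := by
        rw [← measure_inter_add_sdiff (s ∩ e.source) e'.open_source.measurableSet]
        have h3 : M e' ((s ∩ e.source) \ e'.source) = 0 :=
          measure_mono_null (fun x hx => hx.2) (volumeOn_map_symm_compl κ)
        rw [h3, add_zero]
      rw [h2]
      have h4 := map_symm_volumeOn_eq κ he' he ((hs.inter hsm).inter e'.open_source.measurableSet)
        inter_subset_right (inter_subset_left.trans inter_subset_right)
      exact h4.trans_le (measure_mono (inter_subset_left.trans inter_subset_left))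
    have h5 := Measure.restrict_mono (le_refl e.source) hB
    rw [Measure.restrict_add, hMe, Measure.restrict_restrict hsm, inter_compl_self,
      Measure.restrict_empty, add_zero] at h5
    exact h5
  · calc M e = (M e).restrict e.source := hMe.symm
      _ ≤ κ.volume.restrict e.source := Measure.restrict_mono le_rfl (hle e he)

theorem KahlerForm.measureInChart_volume (κ : KahlerForm k X) (he : e ∈ atlas (Cn k) X) :
    measureInChart e κ.volume = volumeOn e.target (formInChart e κ.form) := by
  have h1 : AEMeasurable e.symm (volumeOn e.target (formInChart e κ.form)) := by
    rw [volumeOn_restrict_self e.open_target]; exact aemeasurable_chart_symm _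
  have h0 : AEMeasurable e ((volumeOn e.target (formInChart e κ.form)).map e.symm) := by
    rw [← κ.volume_restrict_source he]; exact aemeasurable_chart _
  rw [measureInChart, κ.volume_restrict_source he, AEMeasurable.map_map_of_aemeasurable h0 h1]
  have h2 : e ∘ e.symm =ᵐ[volumeOn e.target (formInChart e κ.form)] id := by
    rw [volumeOn_restrict_self e.open_target]
    filter_upwards [ae_restrict_mem e.open_target.measurableSet] with x hx using e.right_inv hx
  rw [Measure.map_congr h2, Measure.map_id]

/-! ### Restriction of currents to a chart -/

/-- The restriction of a current to the domain of a chart. -/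
def Current.inChart {κ : KahlerForm k X} (T : Current κ) (he : e ∈ atlas (Cn k) X) :
    CurrentOn e.target (formInChart e κ.form) where
  μ := measureInChart e T.μ
  θ := formInChart e T.θ
  pos z _ := (T.pos _).pullback _
  meas v w := (T.meas e he v w).mono_measure Measure.restrict_le_self
  finite_mass := by
    rw [IntegrableOn, measureInChart_restrict]
    have h1 := (integrable_comp_symm_iff (e := e)).2 (T.finite_mass.integrableOn (s := e.source))
    refine h1.congr ?_
    filter_upwards [ae_mem_target T.μ] with z hz
    exact (trace_formInChart he hz κ.form T.θ).symm

theorem Current.mass_inChart_le {κ : KahlerForm k X} (T : Current κ) (he : e ∈ atlas (Cn k) X) :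
    (T.inChart he).mass ≤ T.mass := by
  refine mul_le_mul_of_nonneg_left ?_ (by positivity)
  change ∫ z in e.target, trace (formInChart e κ.form z) (formInChart e T.θ z)
    ∂(measureInChart e T.μ) ≤ _
  rw [measureInChart_restrict, integral_measureInChart]
  have h1 : ∫ x in e.source, trace (formInChart e κ.form (e x)) (formInChart e T.θ (e x)) ∂T.μ =
      ∫ x in e.source, trace (formAt κ.form x) (formAt T.θ x) ∂T.μ := by
    refine setIntegral_congr_fun e.open_source.measurableSet fun x hx => ?_
    rw [trace_formInChart he (e.map_source hx), e.left_inv hx]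
  rw [h1]
  exact setIntegral_le_integral T.finite_mass (ae_of_all _ fun x =>
    trace_nonneg (κ.isPosDefForm x) (T.pos x))

theorem HasL2Del.inChart {κ : KahlerForm k X} {f : X → ℝ} {G : ∀ x : X, Tan k x →ₗ[ℂ] ℂ}
    (h : HasL2Del κ f G) (he : e ∈ atlas (Cn k) X) :
    HasL2DelOn e.target (formInChart e κ.form) (f ∘ e.symm) (covectorInChart e G) := by
  refine ⟨h.1 e he, ?_⟩
  rw [← κ.measureInChart_volume he]
  have h1 := (integrable_comp_symm_iff (e := e)).2 (h.2.integrableOn (s := e.source))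
  refine h1.congr ?_
  filter_upwards [ae_mem_target κ.volume] with z hz
  rw [wedgeConj_covectorInChart]
  exact (trace_formInChart he hz κ.form fun x => wedgeConj (G x)).symm

theorem Current.Controls.inChart {κ : KahlerForm k X} {f : X → ℝ} {T : Current κ}
    (h : T.Controls f) (he : e ∈ atlas (Cn k) X) : (T.inChart he).Controls (f ∘ e.symm) := by
  obtain ⟨h1, G, h2, h3⟩ := h
  exact ⟨h1 e he, _, h2.inChart he, h3 e he⟩

theorem memLp_inChart {κ : KahlerForm k X} {f : X → ℝ} (hf : MemLp f 2 κ.volume)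
    (he : e ∈ atlas (Cn k) X) :
    MemLp (f ∘ e.symm) 2 (volumeOn e.target (formInChart e κ.form)) := by
  have h1 : MemLp f 2 (κ.volume.restrict e.source) := hf.mono_measure Measure.restrict_le_self
  rw [κ.volume_restrict_source he] at h1
  have h2 : AEMeasurable e.symm (volumeOn e.target (formInChart e κ.form)) := by
    rw [volumeOn_restrict_self e.open_target]; exact aemeasurable_chart_symm _
  exact h1.comp_of_map h2

end

/-! ### Linear combinations of functions and of currents on a compact Kähler manifold -/

section

variable {k : ℕ} {X : Type*} [TopologicalSpace X] [MeasurableSpace X] [BorelSpace X]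
  [ChartedSpace (Cn k) X] [IsManifold 𝓘(ℂ, Cn k) ω X] [CompactSpace X] {κ : KahlerForm k X}

/-- On a compact manifold the integrability of the trace of a form can be checked in charts. -/
theorem integrable_trace_of_forall_chart (h : ∀ x : X, SesqForm (Tan k x))
    (hint : ∀ e ∈ atlas (Cn k) X, ∀ K ⊆ e.target, IsCompact K →
      IntegrableOn (fun z => trace (formInChart e κ.form z) (formInChart e h z)) K
        (volumeOn e.target (formInChart e κ.form))) :
    Integrable (fun x => trace (formAt κ.form x) (formAt h x)) κ.volume := by
  rw [← integrableOn_univ]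
  refine LocallyIntegrable.integrableOn_isCompact (fun x => ?_) isCompact_univ
  set e := chartAt (Cn k) x with he
  have hea : e ∈ atlas (Cn k) X := chart_mem_atlas _ x
  have hx : x ∈ e.source := mem_chart_source _ x
  obtain ⟨K, hKn, hKt, hK⟩ := local_compact_nhds (e.open_target.mem_nhds (e.map_source hx))
  have h1 := (integrable_indicator_iff hK.measurableSet).2 (hint e hea K hKt hK)
  rw [← κ.measureInChart_volume hea, integrable_measureInChart_iff] at h1
  have hN : e.source ∩ e ⁻¹' (interior K) ∈ 𝓝 x :=
    (e.isOpen_inter_preimage isOpen_interior).mem_nhds ⟨hx, mem_interior_iff_mem_nhds.2 hKn⟩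
  refine ⟨_, hN, (h1.mono_set inter_subset_left).congr_fun (fun y hy => ?_)
    (e.isOpen_inter_preimage isOpen_interior).measurableSet⟩
  simp only
  rw [indicator_of_mem (interior_subset hy.2), trace_formInChart hea (e.map_source hy.1),
    e.left_inv hy.1]

theorem HasL2Del.sub (hk : 0 < k) {f₁ f₂ : X → ℝ} {G₁ G₂ : ∀ x : X, Tan k x →ₗ[ℂ] ℂ}
    (hf₁ : MemLp f₁ 2 κ.volume) (hf₂ : MemLp f₂ 2 κ.volume) (h₁ : HasL2Del κ f₁ G₁)
    (h₂ : HasL2Del κ f₂ G₂) : HasL2Del κ (f₁ - f₂) fun x => G₁ x - G₂ x := by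
  have key : ∀ e ∈ atlas (Cn k) X, HasL2DelOn e.target (formInChart e κ.form)
      ((f₁ - f₂) ∘ e.symm) (covectorInChart e fun x => G₁ x - G₂ x) := by
    intro e he
    rw [covectorInChart_sub]
    exact (h₁.inChart he).sub hk (κ.isKahlerOn he).isMetricOn e.open_target (memLp_inChart hf₁ he)
      (memLp_inChart hf₂ he) (h₂.inChart he)
  refine ⟨fun e he => (key e he).1, ?_⟩
  refine integrable_trace_of_forall_chart (fun x => wedgeConj (G₁ x - G₂ x)) fun e he K _ _ => ?_
  have h3 := (key e he).2
  simp only [wedgeConj_covectorInChart] at h3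
  exact h3.integrableOn

/-- As for open sets, the current is `2 T₁ + 2 T₂`, written with respect to a measure for which the
measures of `T₁` and `T₂` have densities. -/
theorem Current.exists_controls_sub (hk : 0 < k) {f₁ f₂ : X → ℝ} (hf₁ : MemLp f₁ 2 κ.volume)
    (hf₂ : MemLp f₂ 2 κ.volume) {T₁ T₂ : Current κ} (h₁ : T₁.Controls f₁) (h₂ : T₂.Controls f₂) :
    ∃ T : Current κ, T.Controls (f₁ - f₂) := by
  obtain ⟨cl₁, G₁, hG₁, d₁⟩ := h₁
  obtain ⟨cl₂, G₂, hG₂, d₂⟩ := h₂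
  obtain ⟨ν, c₁, c₂, hc₁, hc₂⟩ := exists_hasDensityOnSupport T₁.finite_mass T₂.finite_mass
  let θ : ∀ x : X, SesqForm (Tan k x) := fun x =>
    ((2 * c₁ x : ℝ) : ℂ) • T₁.θ x + ((2 * c₂ x : ℝ) : ℂ) • T₂.θ x
  have hθ : ∀ (e : OpenPartialHomeomorph X (Cn k)), ∀ x ∈ e.source, ∀ v w,
      formInChart e θ (e x) v w = 2 * ((c₁ x : ℂ) * formInChart e T₁.θ (e x) v w) +
        2 * ((c₂ x : ℂ) * formInChart e T₂.θ (e x) v w) := by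
    intro e x hx v w
    have h1 : formInChart e θ (e x) v w =
        ((2 * c₁ (e.symm (e x)) : ℝ) : ℂ) * formInChart e T₁.θ (e x) v w +
        ((2 * c₂ (e.symm (e x)) : ℝ) : ℂ) * formInChart e T₂.θ (e x) v w := rfl
    rw [h1, e.left_inv hx]
    push_cast
    ring
  let T : Current κ :=
    { μ := ν
      θ := θ
      pos := fun x => ((T₁.pos x).smul (by positivity)).add ((T₂.pos x).smul (by positivity))
      meas := fun e he v w => by
        have hs := e.open_source.measurableSet
        have m : ∀ S : Current κ, AEMeasurable (fun x => formInChart e S.θ (e x) v w)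
            (S.μ.restrict e.source) := fun S => (aestronglyMeasurable_measureInChart_iff.1
          (S.meas e he v w).aestronglyMeasurable).aemeasurable
        refine (aestronglyMeasurable_measureInChart_iff.2 (AEMeasurable.aestronglyMeasurable
          ((((hc₁.aemeasurable hs (m T₁)).const_mul 2).add
            ((hc₂.aemeasurable hs (m T₂)).const_mul 2)).congr ?_))).aemeasurable
        filter_upwards [ae_restrict_mem hs] with x hx
        exact (hθ e x hx v w).symm
      finite_mass := by
        have m₁ := (hc₁.integrableOn MeasurableSet.univ (integrableOn_univ.2
          T₁.finite_mass.ofReal)).re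
        have m₂ := (hc₂.integrableOn MeasurableSet.univ (integrableOn_univ.2
          T₂.finite_mass.ofReal)).re
        rw [Measure.restrict_univ] at m₁ m₂
        refine ((m₁.const_mul 2).add (m₂.const_mul 2)).congr (ae_of_all _ fun x => ?_)
        have h1 : trace (formAt κ.form x) (formAt θ x) =
            2 * c₁ x * trace (formAt κ.form x) (formAt T₁.θ x) +
            2 * c₂ x * trace (formAt κ.form x) (formAt T₂.θ x) := by
          have h2 : formAt θ x = ((2 * c₁ x : ℝ) : ℂ) • formAt T₁.θ x +
            ((2 * c₂ x : ℝ) : ℂ) • formAt T₂.θ x := rfl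
          rw [h2, trace_add, trace_smul, trace_smul]
        refine Eq.trans ?_ h1.symm
        simp only [Pi.add_apply, RCLike.re_eq_complex_re, Complex.re_ofReal_mul]
        change 2 * (c₁ x * trace (formAt κ.form x) (formAt T₁.θ x)) +
          2 * (c₂ x * trace (formAt κ.form x) (formAt T₂.θ x)) = _
        ring }
  have key : ∀ e (he : e ∈ atlas (Cn k) X),
      IsClosedOn e.target (formInChart e κ.form) (T.inChart he).θ (T.inChart he).μ ∧
      IsDominatedOn e.target (formInChart e κ.form)
        (fun z => covectorInChart e G₁ z - covectorInChart e G₂ z)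
        (T.inChart he).θ (T.inChart he).μ := by
    intro e he
    have hs := e.open_source.measurableSet
    have hκ := (κ.isKahlerOn he).isMetricOn
    refine controls_sub hk hκ e.open_target (hG₁.inChart he) (hG₂.inChart he)
      (T₁ := T₁.inChart he) (T₂ := T₂.inChart he) ?_ (cl₁ e he) (cl₂ e he) (d₁ e he) (d₂ e he)
    intro χ hχ v w
    have hb : ∀ (S : Current κ), ∀ᵐ x ∂(S.μ.restrict e.source),
        trace (k := k) (κ.form x) (S.θ x) = 0 →
        χ (e x) * (formInChart e S.θ (e x) v w / (volDensity (formInChart e κ.form (e x)) : ℂ))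
          = 0 := by
      intro S
      filter_upwards [ae_restrict_mem hs] with x hx h0
      have h2 : formAt S.θ x = 0 := apply_eq_zero_of_trace_eq_zero (κ.isPosDefForm x) (S.pos x) h0
      rw [formInChart_apply he (e.map_source hx), e.left_inv hx, h2]
      simp
    have hi : ∀ (S : Current κ), IntegrableOn (fun x => χ (e x) *
        (formInChart e S.θ (e x) v w / (volDensity (formInChart e κ.form (e x)) : ℂ)))
        e.source S.μ := fun S => integrable_measureInChart_iff.1
      ((S.inChart he).integrable_mul hk hκ e.open_target hχ.1.continuous hχ.2.1 hχ.2.2 v w)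
    change ∫ z, χ z * (formInChart e θ z v w / (volDensity (formInChart e κ.form z) : ℂ))
        ∂(measureInChart e ν) =
      2 * ∫ z, χ z * (formInChart e T₁.θ z v w / (volDensity (formInChart e κ.form z) : ℂ))
        ∂(measureInChart e T₁.μ) +
      2 * ∫ z, χ z * (formInChart e T₂.θ z v w / (volDensity (formInChart e κ.form z) : ℂ))
        ∂(measureInChart e T₂.μ)
    rw [integral_measureInChart, integral_measureInChart, integral_measureInChart,
      ← hc₁.setIntegral_eq hs (hb T₁), ← hc₂.setIntegral_eq hs (hb T₂), ← integral_const_mul,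
      ← integral_const_mul, ← integral_add
      ((hc₁.integrableOn hs (hi T₁)).const_mul 2) ((hc₂.integrableOn hs (hi T₂)).const_mul 2)]
    refine setIntegral_congr_fun hs fun x hx => ?_
    simp only [hθ e x hx]
    ring
  exact ⟨T, fun e he => (key e he).1, _, hG₁.sub hk hf₁ hf₂ hG₂, fun e he => by
    rw [covectorInChart_sub]; exact (key e he).2⟩

theorem KahlerForm.isFiniteMeasure_volume (hk : 2 ≤ k) (κ : KahlerForm k X) :
    IsFiniteMeasure κ.volume := by
  have h1 := integrable_trace_of_forall_chart (κ := κ) κ.form fun e he K hKe hK =>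
    integrableOn_trace_of_pole (a := 0) hk (κ.isKahlerOn he).isMetricOn e.open_target
      (fun v w => .of_continuousOn ((κ.isKahlerOn he).isMetricOn.continuousOn v w)) hK hKe
  simp only [trace_self (κ.isPosDefForm _)] at h1
  rw [integrable_const_iff] at h1
  refine h1.resolve_left ?_
  have : k ≠ 0 := by omega
  exact_mod_cast this

theorem not_denseInWStar_continuous (hk : 2 ≤ k) {κ : KahlerForm k X}
    {e : OpenPartialHomeomorph X (Cn k)} (he : e ∈ atlas (Cn k) X) (i : Fin k) {a : Cn k} {ρ : ℝ}
    (hρ : 0 < ρ) (ha : Metric.ball a ρ ⊆ e.target) {f : X → ℝ} (hf : MemWStar κ f)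
    (hfa : ∀ z ∈ Metric.ball a ρ, f (e.symm z) = ratio i (z - a)) {P : (X → ℝ) → Prop}
    (hP : ∀ g, P g → Continuous g) : ¬ DenseInWStar κ P := by
  intro hd
  obtain ⟨ε, hε, hLB⟩ := exists_le_mass_of_controls hk (κ.isKahlerOn he).isMetricOn
    e.open_target i hρ ha
  obtain ⟨g, hg, hPg, hlt⟩ := hd f hf (Real.sqrt ε) (Real.sqrt_pos.2 hε)
  obtain ⟨T₁, h₁⟩ := hf.2.2
  obtain ⟨T₂, h₂⟩ := hg.2.2
  obtain ⟨T, hT⟩ := Current.exists_controls_sub (by omega) hf.1 hg.1 h₁ h₂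
  refine absurd hlt (not_lt.2 (Real.sqrt_le_sqrt ?_))
  have h3 : ε ≤ sInf {m : ℝ | ∃ T : Current κ, T.Controls (f - g) ∧ m = T.mass} := by
    refine le_csInf ⟨_, T, hT, rfl⟩ ?_
    rintro _ ⟨S, hS, rfl⟩
    refine (hLB ((f - g) ∘ e.symm) (g ∘ e.symm)
      ((hP g hPg).comp_continuousOn (e.continuousOn_symm.mono ha)) (fun z hz => ?_) _
      (hS.inChart he)).trans (S.mass_inChart_le he)
    simp only [Function.comp_apply, Pi.sub_apply, hfa z hz]
  have h4 : 0 ≤ ∫ x, (f - g) x ^ 2 ∂κ.volume := integral_nonneg fun x => sq_nonneg _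
  linarith

end

/-! ### The model function on a compact Kähler manifold -/

section

/-- The extension by zero of a function given in a chart. -/
def extendZero {k : ℕ} {X : Type*} [TopologicalSpace X] (c : OpenPartialHomeomorph X (Cn k))
    (m : Cn k → ℝ) : X → ℝ := c.source.indicator (m ∘ c)

section ExtendZero

variable {k : ℕ} {X : Type*} [TopologicalSpace X] {c e : OpenPartialHomeomorph X (Cn k)}
  {m : Cn k → ℝ} {z : Cn k}

theorem extendZero_symm (hz : z ∈ c.target) : extendZero c m (c.symm z) = m z := by
  rw [extendZero, indicator_of_mem (c.map_target hz), Function.comp_apply, c.right_inv hz]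

theorem extendZero_comp_symm_eventuallyEq (hz : z ∈ e.target) (hz' : e.symm z ∈ c.source) :
    extendZero c m ∘ e.symm =ᶠ[𝓝 z] fun y => m ((c ∘ e.symm) y) := by
  filter_upwards [(e.symm.continuousAt hz).eventually (c.open_source.mem_nhds hz')] with y hy
  rw [Function.comp_apply, extendZero, indicator_of_mem hy]
  rfl

theorem extendZero_comp_symm_eventuallyEq_zero [T2Space X] {K : Set (Cn k)} (hK : IsCompact K)
    (hKc : K ⊆ c.target) (hm : ∀ z ∉ K, m z = 0) (hz : z ∈ e.target)
    (hz' : e.symm z ∉ c.source) : extendZero c m ∘ e.symm =ᶠ[𝓝 z] fun _ => 0 := by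
  have h1 : IsClosed (c.symm '' K) := (hK.image_of_continuousOn
    (c.continuousOn_symm.mono hKc)).isClosed
  have h2 : e.symm z ∈ (c.symm '' K)ᶜ := by
    rintro ⟨w, hw, hwz⟩
    exact hz' (hwz ▸ c.map_target (hKc hw))
  filter_upwards [(e.symm.continuousAt hz).eventually (h1.isOpen_compl.mem_nhds h2)] with y hy
  by_cases hy' : e.symm y ∈ c.source
  · rw [Function.comp_apply, extendZero, indicator_of_mem hy']
    exact hm _ fun h => hy ⟨_, h, c.left_inv hy'⟩
  · rw [Function.comp_apply, extendZero, indicator_of_notMem hy']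

theorem abs_extendZero_le {C : ℝ} (hC : 0 ≤ C) (h : ∀ z, |m z| ≤ C) (x : X) :
    |extendZero c m x| ≤ C := by
  by_cases hx : x ∈ c.source
  · rw [extendZero, indicator_of_mem hx]; exact h _
  · rw [extendZero, indicator_of_notMem hx, abs_zero]; exact hC

variable [ChartedSpace (Cn k) X] [IsManifold 𝓘(ℂ, Cn k) ω X]

theorem isSmoothAt_extendZero [T2Space X] (hc : c ∈ atlas (Cn k) X) {K : Set (Cn k)}
    (hK : IsCompact K) (hKc : K ⊆ c.target) (hm : ∀ z ∉ K, m z = 0) {x : X}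
    (hx : x ∈ c.source → ContDiffAt ℝ ∞ m (c x)) : IsSmoothAt (k := k) (extendZero c m) x := by
  intro e he hxe
  by_cases hxc : x ∈ c.source
  · have hz' : e.symm (e x) ∈ c.source := by rwa [e.left_inv hxe]
    refine ContDiffAt.congr_of_eventuallyEq ?_
      (extendZero_comp_symm_eventuallyEq (e.map_source hxe) hz')
    have h1 : ContDiffAt ℝ ∞ (c ∘ e.symm) (e x) :=
      ((contDiffAt_transition he hc (e.map_source hxe) hz').restrict_scalars ℝ).of_le (by simp)
    refine ContDiffAt.comp (g := m) (f := c ∘ e.symm) (e x) ?_ h1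
    rw [Function.comp_apply, e.left_inv hxe]
    exact hx hxc
  · refine ContDiffAt.congr_of_eventuallyEq contDiffAt_const
      (extendZero_comp_symm_eventuallyEq_zero hK hKc hm (e.map_source hxe) ?_)
    rwa [e.left_inv hxe]

/-- A change of charts distorts distances and vectors by a bounded factor. -/
theorem exists_transition_bound (he : e ∈ atlas (Cn k) X) (hc : c ∈ atlas (Cn k) X) {p : X}
    (hpe : p ∈ e.source) (hpc : p ∈ c.source) : ∃ C : ℝ, 0 ≤ C ∧ ∀ᶠ z in 𝓝 (e p),
      ‖z - e p‖ ≤ C * ‖(c ∘ e.symm) z - c p‖ ∧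
      ∀ v, ‖fderiv ℂ (c ∘ e.symm) z v‖ ≤ C * ‖v‖ := by
  have hz : e p ∈ e.target := e.map_source hpe
  have hz' : e.symm (e p) ∈ c.source := by rwa [e.left_inv hpe]
  have hψ := contDiffAt_transition he hc hz hz'
  have hη : DifferentiableAt ℂ (e ∘ c.symm) (c p) :=
    differentiableAt_transition hc he (c.map_source hpc) (by rwa [c.left_inv hpc])
  obtain ⟨C₁, hC₁⟩ := hη.isBigO_sub.bound
  have hlim : Tendsto (c ∘ e.symm) (𝓝 (e p)) (𝓝 (c p)) := by
    have := hψ.continuousAt.tendsto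
    rwa [Function.comp_apply, e.left_inv hpe] at this
  have hc : ContinuousAt (fderiv ℂ (c ∘ e.symm)) (e p) :=
    (hψ.fderiv_right (m := 0) (by simp)).continuousAt
  have h2 : ∀ᶠ z in 𝓝 (e p), ‖fderiv ℂ (c ∘ e.symm) z‖ < ‖fderiv ℂ (c ∘ e.symm) (e p)‖ + 1 :=
    hc.norm.eventually_lt continuousAt_const (lt_add_one _)
  refine ⟨|C₁| + (‖fderiv ℂ (c ∘ e.symm) (e p)‖ + 1), by positivity, ?_⟩
  filter_upwards [hlim.eventually hC₁, h2, symm_eventuallyEq hz hz', e.open_target.mem_nhds hz]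
    with z h3 h4 h5 h6
  constructor
  · have h7 : (e ∘ c.symm) ((c ∘ e.symm) z) = z := by
      rw [Function.comp_apply]
      simp only [Function.comp_apply] at h5 ⊢
      rw [← h5, e.right_inv h6]
    rw [h7, Function.comp_apply, c.left_inv hpc] at h3
    refine h3.trans (mul_le_mul_of_nonneg_right ?_ (norm_nonneg _))
    linarith [le_abs_self C₁, norm_nonneg (fderiv ℂ (c ∘ e.symm) (e p))]
  · intro v
    refine (ContinuousLinearMap.le_opNorm _ v).trans
      (mul_le_mul_of_nonneg_right ?_ (norm_nonneg _))
    linarith [abs_nonneg C₁]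

end ExtendZero

section Model

variable {k : ℕ} {X : Type*} [TopologicalSpace X] [T2Space X] [ChartedSpace (Cn k) X]
  [IsManifold 𝓘(ℂ, Cn k) ω X] {c e : OpenPartialHomeomorph X (Cn k)} {p : X}

theorem isSmoothAt_modelFun (hc : c ∈ atlas (Cn k) X) (hp : p ∈ c.source) (i : Fin k)
    (β : ContDiffBump (c p)) (hβ : Metric.closedBall (c p) β.rOut ⊆ c.target) {x : X}
    (hx : x ≠ p) : IsSmoothAt (k := k) (extendZero c (modelFun i β)) x :=
  isSmoothAt_extendZero hc (isCompact_closedBall _ _) hβ (fun _ hz => modelFun_eq_zero i β hz)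
    fun hxc => contDiffAt_modelFun i β fun h => hx (c.injOn hxc hp h)

theorem isSmoothAt_modelPot (hc : c ∈ atlas (Cn k) X) (hp : p ∈ c.source)
    (β : ContDiffBump (c p)) (hβ : Metric.closedBall (c p) β.rOut ⊆ c.target) {x : X}
    (hx : x ≠ p) : IsSmoothAt (k := k) (extendZero c (modelPot β)) x :=
  isSmoothAt_extendZero hc (isCompact_closedBall _ _) hβ (fun _ hz => modelPot_eq_zero β hz)
    fun hxc => contDiffAt_modelPot β fun h => hx (c.injOn hxc hp h)

theorem del_levi_modelFun_le {κ : KahlerForm k X} {A : ℝ} (hA0 : 0 ≤ A)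
    (hc : c ∈ atlas (Cn k) X) (hp : p ∈ c.source) (i : Fin k)
    (β : ContDiffBump (c p)) (hβ : Metric.closedBall (c p) β.rOut ⊆ c.target)
    (hA : ∀ z ∈ c.target, z ≠ c p → ∀ v,
      2 * ‖del (fun y => (modelFun i β y : ℂ)) z v‖ ^ 2 ≤
        A * (formInChart c κ.form z v v).re + (levi (modelPot β) z v v).re)
    (he : e ∈ atlas (Cn k) X) {z : Cn k} (hz : z ∈ e.target) (hzp : e.symm z ≠ p) (v : Cn k) :
    2 * ‖del (fun y => ((extendZero c (modelFun i β) ∘ e.symm) y : ℂ)) z v‖ ^ 2 ≤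
      A * (formInChart e κ.form z v v).re +
        (levi (extendZero c (modelPot β) ∘ e.symm) z v v).re := by
  by_cases hzc : e.symm z ∈ c.source
  · have hne : (c ∘ e.symm) z ≠ c p := fun h => hzp (c.injOn hzc hp h)
    have h1 : (fun y => ((extendZero c (modelFun i β) ∘ e.symm) y : ℂ)) =ᶠ[𝓝 z]
        fun y => (fun w => (modelFun i β w : ℂ)) ((c ∘ e.symm) y) :=
      (extendZero_comp_symm_eventuallyEq hz hzc).fun_comp fun t : ℝ => (t : ℂ)
    rw [del_congr h1, del_comp ((ContDiffAt.ofReal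
        (contDiffAt_modelFun i β hne)).differentiableAt (by simp))
        (differentiableAt_transition he hc hz hzc),
      levi_congr (extendZero_comp_symm_eventuallyEq hz hzc),
      levi_comp ((contDiffAt_modelPot β hne).of_le two_le_infty)
        ((contDiffAt_transition he hc hz hzc).of_le (by simp)),
      formInChart_transition he hc hz hzc]
    exact hA _ (c.map_source hzc) hne _
  · have h1 : (fun y => ((extendZero c (modelFun i β) ∘ e.symm) y : ℂ)) =ᶠ[𝓝 z]
        fun _ => ((0 : ℝ) : ℂ) :=
      (extendZero_comp_symm_eventuallyEq_zero (isCompact_closedBall _ _) hβ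
        (fun _ hz => modelFun_eq_zero i β hz) hz hzc).fun_comp fun t : ℝ => (t : ℂ)
    have h5 : levi (fun _ : Cn k => (0 : ℝ)) z = 0 := by ext v w; simp [levi_apply]
    have h6 : del (fun _ : Cn k => ((0 : ℝ) : ℂ)) z v = 0 := by simp [del]
    rw [del_congr h1, levi_congr (extendZero_comp_symm_eventuallyEq_zero
      (isCompact_closedBall _ _) hβ (fun _ hz => modelPot_eq_zero β hz) hz hzc), h5, h6]
    have h7 := mul_nonneg hA0 (((κ.isKahlerOn he).pos z hz).isPosForm.2 v)
    simpa using h7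

/-- In every chart, the extended model function and the extended potential have at most the
singularities of the model. If `p` is not in the domain of the chart `e`, then `e p` is an arbitrary
point, and there is no singularity at all. -/
theorem isModelOn_inChart {κ : KahlerForm k X} {A : ℝ} (hA0 : 0 ≤ A)
    (hc : c ∈ atlas (Cn k) X) (hp : p ∈ c.source) (i : Fin k)
    (β : ContDiffBump (c p)) (hβ : Metric.closedBall (c p) β.rOut ⊆ c.target)
    (hA : ∀ z ∈ c.target, z ≠ c p → ∀ v,
      2 * ‖del (fun y => (modelFun i β y : ℂ)) z v‖ ^ 2 ≤
        A * (formInChart c κ.form z v v).re + (levi (modelPot β) z v v).re)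
    (he : e ∈ atlas (Cn k) X) :
    IsModelOn e.target (formInChart e κ.form) (e p) A (extendZero c (modelFun i β) ∘ e.symm)
      (extendZero c (modelPot β) ∘ e.symm) := by
  have hsf : ∀ z ∈ e.target, e.symm z ≠ p →
      ContDiffAt ℝ ∞ (extendZero c (modelFun i β) ∘ e.symm) z := fun z hz hzp => by
    have := isSmoothAt_modelFun hc hp i β hβ hzp e he (e.map_target hz)
    rwa [e.right_inv hz] at this
  have hsu : ∀ z ∈ e.target, e.symm z ≠ p →
      ContDiffAt ℝ ∞ (extendZero c (modelPot β) ∘ e.symm) z := fun z hz hzp => by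
    have := isSmoothAt_modelPot hc hp β hβ hzp e he (e.map_target hz)
    rwa [e.right_inv hz] at this
  have hle : ∀ z ∈ e.target, e.symm z ≠ p → ∀ v, _ := fun z hz hzp v =>
    del_levi_modelFun_le hA0 hc hp i β hβ hA he hz hzp v
  have cf : ∀ z ∈ e.target, e.symm z ≠ p → ContinuousAt
      (fun z => ((extendZero c (modelFun i β) ∘ e.symm) z : ℂ)) z := fun z hz hzp =>
    (ContDiffAt.ofReal (hsf z hz hzp)).continuousAt
  have cd : ∀ v, ∀ z ∈ e.target, e.symm z ≠ p → ContinuousAt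
      (fun z => del (fun y => ((extendZero c (modelFun i β) ∘ e.symm) y : ℂ)) z v) z :=
    fun v z hz hzp => (ContDiffAt.del (ContDiffAt.ofReal (hsf z hz hzp)) v).continuousAt
  have cl : ∀ v w, ∀ z ∈ e.target, e.symm z ≠ p → ContinuousAt
      (fun z => levi (extendZero c (modelPot β) ∘ e.symm) z v w) z :=
    fun v w z hz hzp => (ContDiffAt.levi (hsu z hz hzp) v w).continuousAt
  by_cases hpe : p ∈ e.source
  · have hne : ∀ z ∈ e.target, z ≠ e p → e.symm z ≠ p := fun z hz hzp h =>
      hzp (by rw [← h, e.right_inv hz])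
    obtain ⟨C, hC0, hC⟩ := exists_transition_bound he hc hpe hp
    have hz0 : e p ∈ e.target := e.map_source hpe
    have hz0' : e.symm (e p) ∈ c.source := by rwa [e.left_inv hpe]
    have hlim : Tendsto (c ∘ e.symm) (𝓝 (e p)) (𝓝 (c p)) := by
      have := (differentiableAt_transition he hc hz0 hz0').continuousAt.tendsto
      rwa [Function.comp_apply, e.left_inv hpe] at this
    have hnear : ∀ᶠ z in 𝓝[≠] (e p), (z ≠ e p ∧ z ∈ e.target ∧ e.symm z ∈ c.source ∧
        ‖z - e p‖ ≤ 1) ∧ (c ∘ e.symm) z ∈ Metric.ball (c p) β.rIn ∧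
        ‖z - e p‖ ≤ C * ‖(c ∘ e.symm) z - c p‖ ∧
        ∀ v, ‖fderiv ℂ (c ∘ e.symm) z v‖ ≤ C * ‖v‖ := by
      filter_upwards [self_mem_nhdsWithin,
        mem_nhdsWithin_of_mem_nhds (Metric.closedBall_mem_nhds (e p) one_pos),
        mem_nhdsWithin_of_mem_nhds (e.open_target.mem_nhds hz0), nhdsWithin_le_nhds hC,
        nhdsWithin_le_nhds ((e.symm.continuousAt hz0).eventually (c.open_source.mem_nhds hz0')),
        nhdsWithin_le_nhds (hlim.eventually (Metric.ball_mem_nhds _ β.rIn_pos))]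
        with z h1 h2 h3 h4 h5 h6
      exact ⟨⟨h1, h3, h5, by rwa [Metric.mem_closedBall, dist_eq_norm] at h2⟩, h6, h4⟩
    refine ⟨fun z hz hzp => hsf z hz (hne z hz hzp), fun z hz hzp => hsu z hz (hne z hz hzp),
      .of_eventually (fun z hz => (cf z hz.1 (hne z hz.1 hz.2)).continuousWithinAt) ⟨1, ?_⟩,
      fun v => .of_eventually (fun z hz =>
        (cd v z hz.1 (hne z hz.1 hz.2)).continuousWithinAt) ⟨C * (2 * (C * ‖v‖)), ?_⟩,
      fun v w => .of_eventually (fun z hz =>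
        (cl v w z hz.1 (hne z hz.1 hz.2)).continuousWithinAt)
          ⟨C ^ 2 * (4 * (C * ‖v‖) * (C * ‖w‖)), ?_⟩,
      fun z hz hzp => hle z hz (hne z hz hzp)⟩
    · filter_upwards [hnear] with z ⟨⟨_, _, _, h1⟩, _⟩
      rw [Complex.norm_real]
      exact mul_le_one₀ (abs_extendZero_le zero_le_one (abs_modelFun_le i β) _) (by positivity)
        (pow_le_one₀ (norm_nonneg _) h1)
    · filter_upwards [hnear] with z ⟨⟨hzp, hz, hzc, h1⟩, h2, h3, h4⟩
      have hψ : (c ∘ e.symm) z ≠ c p := fun h => hne z hz hzp (c.injOn hzc hp h)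
      have h5 : (fun y => ((extendZero c (modelFun i β) ∘ e.symm) y : ℂ)) =ᶠ[𝓝 z]
          fun y => (fun w => (modelFun i β w : ℂ)) ((c ∘ e.symm) y) :=
        (extendZero_comp_symm_eventuallyEq hz hzc).fun_comp fun t : ℝ => (t : ℂ)
      rw [del_congr h5, del_comp ((ContDiffAt.ofReal
        (contDiffAt_modelFun i β hψ)).differentiableAt (by simp))
        (differentiableAt_transition he hc hz hzc)]
      have h6 := norm_del_modelFun_le i β h2 hψ (fderiv ℂ (c ∘ e.symm) z v)
      set D := ‖del (fun w => (modelFun i β w : ℂ)) ((c ∘ e.symm) z)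
        (fderiv ℂ (c ∘ e.symm) z v)‖
      calc D * ‖z - e p‖ ^ 3 = D * ‖z - e p‖ * ‖z - e p‖ ^ 2 := by ring
        _ ≤ D * ‖z - e p‖ * 1 := by
            gcongr
            exact pow_le_one₀ (norm_nonneg _) h1
        _ ≤ D * (C * ‖(c ∘ e.symm) z - c p‖) * 1 := by gcongr
        _ = C * (D * ‖(c ∘ e.symm) z - c p‖) := by ring
        _ ≤ C * (2 * (C * ‖v‖)) := by
            exact mul_le_mul_of_nonneg_left
              (h6.trans (mul_le_mul_of_nonneg_left (h4 v) zero_le_two)) hC0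
    · filter_upwards [hnear] with z ⟨⟨hzp, hz, hzc, h1⟩, h2, h3, h4⟩
      have hψ : (c ∘ e.symm) z ≠ c p := fun h => hne z hz hzp (c.injOn hzc hp h)
      rw [levi_congr (extendZero_comp_symm_eventuallyEq hz hzc),
        levi_comp ((contDiffAt_modelPot β hψ).of_le two_le_infty)
        ((contDiffAt_transition he hc hz hzc).of_le (by simp))]
      have h6 := norm_levi_modelPot_le β h2 hψ (fderiv ℂ (c ∘ e.symm) z v)
        (fderiv ℂ (c ∘ e.symm) z w)
      set D := ‖levi (modelPot β) ((c ∘ e.symm) z) (fderiv ℂ (c ∘ e.symm) z v)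
        (fderiv ℂ (c ∘ e.symm) z w)‖
      calc D * ‖z - e p‖ ^ 2 ≤ D * (C * ‖(c ∘ e.symm) z - c p‖) ^ 2 := by gcongr
        _ = C ^ 2 * (D * ‖(c ∘ e.symm) z - c p‖ ^ 2) := by ring
        _ ≤ C ^ 2 * (4 * (C * ‖v‖) * (C * ‖w‖)) := by
            refine mul_le_mul_of_nonneg_left (h6.trans ?_) (by positivity)
            gcongr
            exacts [h4 v, h4 w]
  -- away from the singularity everything is smooth
  · have hne : ∀ z ∈ e.target, e.symm z ≠ p := fun z hz h => hpe (h ▸ e.map_target hz)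
    exact ⟨fun z hz _ => hsf z hz (hne z hz), fun z hz _ => hsu z hz (hne z hz),
      .of_continuousOn fun z hz => (cf z hz (hne z hz)).continuousWithinAt,
      fun v => .of_continuousOn fun z hz => (cd v z hz (hne z hz)).continuousWithinAt,
      fun v w => .of_continuousOn fun z hz => (cl v w z hz (hne z hz)).continuousWithinAt,
      fun z hz _ => hle z hz (hne z hz)⟩

end Model

end

/-! ### Compact Kähler manifolds -/

section

variable {k : ℕ} {X : Type*} [TopologicalSpace X] [T2Space X] [CompactSpace X] [MeasurableSpace X]
  [BorelSpace X] [ChartedSpace (Cn k) X] [IsManifold 𝓘(ℂ, Cn k) ω X]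

theorem exists_memWStar (hk : 2 ≤ k) (κ : KahlerForm k X) (p : X) (i : Fin k) :
    ∃ f ρ, 0 < ρ ∧ Metric.ball (chartAt (Cn k) p p) ρ ⊆ (chartAt (Cn k) p).target ∧
      MemWStar κ f ∧ ∀ z ∈ Metric.ball (chartAt (Cn k) p p) ρ,
        f ((chartAt (Cn k) p).symm z) = ratio i (z - chartAt (Cn k) p p) := by
  set c := chartAt (Cn k) p with hcdef
  have hc : c ∈ atlas (Cn k) X := chart_mem_atlas _ p
  have hp : p ∈ c.source := mem_chart_source _ p
  obtain ⟨R, hR0, hR⟩ := Metric.isOpen_iff.1 c.open_target (c p) (c.map_source hp)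
  let β : ContDiffBump (c p) := ⟨R / 4, R / 2, by positivity, by linarith⟩
  have hβ : Metric.closedBall (c p) β.rOut ⊆ c.target :=
    (Metric.closedBall_subset_ball (show R / 2 < R by linarith)).trans hR
  obtain ⟨A, hA0, hA⟩ := exists_norm_del_modelFun_sq_le (κ.isKahlerOn hc).isMetricOn i β hβ
  have hM : ∀ e (he : e ∈ atlas (Cn k) X), _ := fun e he =>
    isModelOn_inChart (κ := κ) hA0 hc hp i β hβ hA he
  have hfin := κ.isFiniteMeasure_volume hk
  set f : X → ℝ := extendZero c (modelFun i β) with hf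
  set u : X → ℝ := extendZero c (modelPot β) with hu
  have hsf : ∀ x, x ≠ p → IsSmoothAt (k := k) f x := fun x hx => isSmoothAt_modelFun hc hp i β hβ hx
  have hsu : ∀ x, x ≠ p → IsSmoothAt (k := k) u x := fun x hx => isSmoothAt_modelPot hc hp β hβ hx
  -- the value of `θ` at `p` does not matter, as `{p}` is a null set, but it has to be a positive form
  let θ : ∀ x : X, SesqForm (Tan k x) := by
    classical
    exact fun x => if x = p then (A : ℂ) • κ.form x else (A : ℂ) • κ.form x + leviForm u x
  have hθx : ∀ x, x ≠ p → θ x = (A : ℂ) • κ.form x + leviForm u x := fun x hx => if_neg hx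
  have hne : ∀ (e : OpenPartialHomeomorph X (Cn k)), ∀ z ∈ e.target, z ≠ e p → e.symm z ≠ p :=
    fun e z hz hzp h => hzp (by rw [← h, e.right_inv hz])
  have hθ : ∀ e ∈ atlas (Cn k) X, ∀ z ∈ e.target, z ≠ e p → formInChart e θ z =
      (A : ℂ) • formInChart e κ.form z + levi (u ∘ e.symm) z := fun e he z hz hzp => by
    rw [← formInChart_leviForm he hz (hsu _ (hne e z hz hzp))]
    ext v w
    change θ (e.symm z) _ _ = _
    rw [hθx _ (hne e z hz hzp)]
    rfl
  have hG : ∀ e ∈ atlas (Cn k) X, ∀ z ∈ e.target, z ≠ e p → covectorInChart e (delForm f) z =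
      delLin (fun y => ((f ∘ e.symm) y : ℂ)) z := fun e he z hz hzp =>
    covectorInChart_delForm he hz (hsf _ (hne e z hz hzp))
  have hpos : ∀ x, IsPosForm (θ x) := fun x => by
    by_cases hx : x = p
    · have h1 : θ x = (A : ℂ) • κ.form x := if_pos hx
      rw [h1]
      exact (κ.isPosDefForm x).isPosForm.smul hA0
    · by_cases hxc : x ∈ c.source
      · have hz : c x ∈ c.target := c.map_source hxc
        have h1 := (hM c hc).isPosForm (κ.isKahlerOn hc) (hθ c hc) hz
          fun h => hx (c.injOn hxc hp h)
        rw [formInChart_apply hc hz, c.left_inv hxc] at h1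
        have hs : Function.Surjective (coordLin c (c x)) :=
          (LinearMap.equivOfDetNeZero _ (det_coordLin_ne_zero hc hz)).surjective
        refine ⟨fun v w => ?_, fun v => ?_⟩
        · obtain ⟨v, rfl⟩ := hs v
          obtain ⟨w, rfl⟩ := hs w
          exact h1.1 v w
        · obtain ⟨v, rfl⟩ := hs v
          exact h1.2 v
      · have h0 : levi (u ∘ (chartAt (Cn k) x).symm) (chartAt (Cn k) x x) = 0 := by
          rw [levi_congr (extendZero_comp_symm_eventuallyEq_zero (isCompact_closedBall _ _) hβ
            (fun _ hz => modelPot_eq_zero β hz) (mem_chart_target _ x)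
            (by rwa [(chartAt (Cn k) x).left_inv (mem_chart_source _ x)]))]
          ext v w
          simp [levi_apply]
        have h1 : leviForm (k := k) u x = 0 := h0
        rw [hθx x hx, h1, add_zero]
        exact (κ.isPosDefForm x).isPosForm.smul hA0
  have hint : Integrable (fun x => trace (formAt κ.form x) (formAt θ x)) κ.volume :=
    integrable_trace_of_forall_chart θ fun e he K hKe hK =>
      integrableOn_trace_of_pole hk (κ.isKahlerOn he).isMetricOn e.open_target
        ((hM e he).hasPoleBound (κ.isKahlerOn he) (hθ e he)) hK hKe
  let T : Current κ :=
    { μ := κ.volume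
      θ := θ
      pos := hpos
      meas := fun e he v w => by
        rw [κ.measureInChart_volume he]
        exact ((((hM e he).hasPoleBound (κ.isKahlerOn he) (hθ e he) v w).aestronglyMeasurable hk
          e.open_target).mono_ac volumeOn_absolutelyContinuous).aemeasurable
      finite_mass := hint }
  have hL2 : HasL2Del κ f (delForm f) := by
    refine ⟨fun e he => (hM e he).isWeakDelOn hk e.open_target (hG e he), ?_⟩
    refine integrable_trace_of_forall_chart (fun x => wedgeConj (delForm f x))
      fun e he K hKe hK => ?_
    have h1 := (hM e he).integrableOn_trace_wedgeConj hk (κ.isKahlerOn he) e.open_target (hθ e he)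
      (hG e he) (integrableOn_trace_of_pole hk (κ.isKahlerOn he).isMetricOn e.open_target
        ((hM e he).hasPoleBound (κ.isKahlerOn he) (hθ e he)) hK hKe)
    simp only [wedgeConj_covectorInChart] at h1
    exact h1
  have hmeas : Measurable f := by
    refine measurable_of_continuousOn_compl_singleton p fun x hx => ?_
    exact (hsf x hx).continuousAt.continuousWithinAt
  refine ⟨f, R / 4, by positivity, (Metric.ball_subset_ball (by linarith)).trans hR,
    ⟨MemLp.of_bound hmeas.aestronglyMeasurable 1
      (ae_of_all _ fun x => abs_extendZero_le zero_le_one (abs_modelFun_le i β) x),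
      ⟨_, hL2⟩, T, fun e he => ?_, _, hL2, fun e he => ?_⟩, fun z hz => ?_⟩
  · change IsClosedOn _ _ _ (measureInChart e κ.volume)
    rw [κ.measureInChart_volume he]
    exact (hM e he).isClosedOn hk (κ.isKahlerOn he) e.open_target (hθ e he)
  · change IsDominatedOn _ _ _ _ (measureInChart e κ.volume)
    rw [κ.measureInChart_volume he]
    exact (hM e he).isDominatedOn hk (κ.isKahlerOn he) e.open_target (hθ e he) (hG e he)
  · rw [hf, extendZero_symm (((Metric.ball_subset_ball (by linarith)).trans hR) hz)]
    exact modelFun_eq i β hz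

/-- The case of a compact Kähler manifold. -/
theorem wStar_compact (hk : 2 ≤ k) [Nonempty X] (κ : KahlerForm k X) :
    (∃ f, MemWStar κ f ∧ ¬ MemVMO k f) ∧
    (∃ f, MemWStar κ f ∧ ¬ MemPointwiseVMO k f) ∧
    ¬ DenseInWStar κ (fun g => ContMDiff 𝓘(ℝ, Cn k) 𝓘(ℝ, ℝ) ∞ g) ∧
    ¬ DenseInWStar κ (fun g => Continuous g) := by
  obtain ⟨p⟩ := ‹Nonempty X›
  let i : Fin k := ⟨0, by omega⟩
  obtain ⟨f, ρ, hρ, hρt, hf, hfa⟩ := exists_memWStar hk κ p i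
  have hnot : ¬ MemPointwiseVMO k f := fun h => by
    obtain ⟨δ, hδ, -, h⟩ := h p
    exact not_tendsto_meanOsc hk i hρ hfa (h.2 _ (Metric.mem_ball_self hδ))
  have hc := chart_mem_atlas (Cn k) p
  exact ⟨⟨f, hf, fun h => hnot h.memPointwiseVMO⟩, ⟨f, hf, hnot⟩,
    not_denseInWStar_continuous hk hc i hρ hρt hf hfa fun g hg => hg.continuous,
    not_denseInWStar_continuous hk hc i hρ hρt hf hfa fun g hg => hg⟩

end

end WStar

end

theorem proposition2p7 (k : ℕ) (hk : 2 ≤ k) :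
    -- compact Kähler manifolds of dimension `k`
    (∀ (X : Type*) [TopologicalSpace X] [T2Space X] [CompactSpace X] [Nonempty X]
        [MeasurableSpace X] [BorelSpace X] [ChartedSpace (WStar.Cn k) X]
        [IsManifold 𝓘(ℂ, WStar.Cn k) ω X] (κ : WStar.KahlerForm k X),
      (∃ f, WStar.MemWStar κ f ∧ ¬ WStar.MemVMO k f) ∧
      (∃ f, WStar.MemWStar κ f ∧ ¬ WStar.MemPointwiseVMO k f) ∧
      ¬ WStar.DenseInWStar κ (fun g => ContMDiff 𝓘(ℝ, WStar.Cn k) 𝓘(ℝ, ℝ) ∞ g) ∧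
      ¬ WStar.DenseInWStar κ (fun g => Continuous g)) ∧
    -- bounded open subsets of `ℂᵏ`
    (∀ (U : Set (WStar.Cn k)) (c : ℝ), IsOpen U → U.Nonempty → Bornology.IsBounded U → 0 < c →
      (∃ f, WStar.MemWStarOn U (fun _ => WStar.flatForm k c) f ∧ ¬ WStar.MemVMOOn U f) ∧
      (∃ f, WStar.MemWStarOn U (fun _ => WStar.flatForm k c) f ∧ ¬ WStar.MemPointwiseVMOOn U f) ∧
      ¬ WStar.DenseInWStarOn U (fun _ => WStar.flatForm k c) (fun g => ContDiffOn ℝ ∞ g U) ∧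
      ¬ WStar.DenseInWStarOn U (fun _ => WStar.flatForm k c) (fun g => ContinuousOn g U)) := by
  exact ⟨fun X _ _ _ _ _ _ _ _ κ => WStar.wStar_compact hk κ,
    fun U c hU hne hUb hc => WStar.wStarOn_bounded hk hU hne hUb hc⟩
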